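/- **Definitions.** A *parametric MDP* consists of a finite non-empty set $S$ of states, a finite set of actions with a non-empty set $L(s)$ of legal actions for every $s\in S$, a finite set $X$ of real-valued parameters, polynomials $T(s,a)(s')\in\mathbb{Q}[X]$ for $s,s'\in S$ and $a\in L(s)$, a labelling of the states by subsets of a finite set of atomic propositions, and a finite set $C$ of constraints $A\bowtie' B$ with $A,B\in\mathbb{Q}[X]$ and $\bowtie'\in\{<,>,\le,\ge,=\}$. A valuation $v:X\to\mathbb{R}$ is *well-defined* if for all $s$ and $a\in L(s)$ the values of $T(s,a)(\cdot)$ under $v$ are non-negative and sum to $1$, and all constraints of $C$ hold under $v$; it then yields an MDP. For $b\in\mathbb{N}_+$, a *$b$-bounded strategy* is a randomized scheduler with a set $Q$ of $b$ memory modes: in an initial state $s_0$ the first mode is drawn from a distribution $\mathit{start}(s_0)$ on $Q$; in state $s$ and mode $q$ an action is drawn from a distribution $\mathit{act}(q,s)$ on $L(s)$, the next state is drawn from $T(s,a)$, and the next mode is drawn independently from a distribution $\Delta(q,s)$ on $Q$. Such a strategy and an initial state induce a probability measure on infinite sequences of states. $\forall\mathbb{R}$ is the class of decision problems that are polynomial-time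 many-one reducible to deciding the truth of sentences $\forall x_1\dots\forall x_n\,\Phi(x_1,\dots,x_n)$ over the reals, where $\Phi$ is a Boolean combination of conditions $f\ge 0$ and $f>0$ for polynomials $f$ with rational coefficients. Polynomials (in the sentences and in the inputs below) are given as arithmetic expressions built from variables and rational constants (written in binary) by $+$ and $\cdot$. **Theorem.** The following problem is in $\forall\mathbb{R}$. Given a parametric MDP (with an arbitrary number of parameters), a state $s_0$, a Boolean combination $R$ of atomic propositions, a memory bound $b\in\mathbb{N}_+$ (in binary), a relation $\bowtie\;\in\{<,>,\le,\ge\}$ and a rational number $d\in[0,1]$, determine whether for all well-defined valuations $v$ of the parameters and all $b$-bounded strategies in the MDP obtained from $v$, the probability that a play from $s_0$ eventually visits a state whose label satisfies $R$ is $\bowtie d$. -/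

import Mathlib

/-! ### Polynomials, comparisons, constraints -/

namespace PReach

/-- Arithmetic expressions with rational constants, in variables from `V`; a finite presentation of
the elements of `ℚ[V]`. -/
inductive PolyExpr (V : Type) : Type
  | const (q : ℚ) : PolyExpr V
  | var (x : V) : PolyExpr V
  | add (p q : PolyExpr V) : PolyExpr V
  | mul (p q : PolyExpr V) : PolyExpr V

/-- The polynomial denoted by an expression. -/
noncomputable def PolyExpr.toPoly {V : Type} : PolyExpr V → MvPolynomial V ℚ
  | .const q => MvPolynomial.C q
  | .var x => MvPolynomial.X x
  | .add p q => p.toPoly + q.toPoly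
  | .mul p q => p.toPoly * q.toPoly

/-- The comparisons `<`, `>`, `≤`, `≥` with a threshold. -/
inductive Cmp : Type
  | lt | gt | le | ge

def Cmp.Holds : Cmp → ℝ → ℝ → Prop
  | .lt, x, y => x < y
  | .gt, x, y => x > y
  | .le, x, y => x ≤ y
  | .ge, x, y => x ≥ y

/-- The relations `<`, `>`, `≤`, `≥`, `=` of a parameter constraint. -/
inductive Rel : Type
  | cmp (c : Cmp)
  | eq

def Rel.Holds : Rel → ℝ → ℝ → Prop
  | .cmp c, x, y => c.Holds x y
  | .eq, x, y => x = y

/-- A constraint `lhs ⋈ rhs` between two objects of type `T` that denote polynomials. -/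
structure Constraint (T : Type) : Type where
  lhs : T
  rel : Rel
  rhs : T

/-- Boolean combinations of atomic propositions. -/
inductive BoolComb (P : Type) : Type
  | atom (p : P) : BoolComb P
  | neg (φ : BoolComb P) : BoolComb P
  | and (φ ψ : BoolComb P) : BoolComb P
  | or (φ ψ : BoolComb P) : BoolComb P

/-- Truth under the set `T` of true propositions. -/
def BoolComb.Holds {P : Type} (T : Set P) : BoolComb P → Prop
  | .atom p => p ∈ T
  | .neg φ => ¬ φ.Holds T
  | .and φ ψ => φ.Holds T ∧ ψ.Holds T
  | .or φ ψ => φ.Holds T ∨ ψ.Holds T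

/-! ### Markov decision processes, bounded-memory strategies, path measure -/

/-- A (labelled) Markov decision process: every state has a non-empty set of legal actions, and each
legal action gives a distribution on successor states. -/
structure MDP (S A P : Type) where
  legal : S → Finset A
  legal_nonempty : ∀ s, (legal s).Nonempty
  trans : (s : S) → legal s → PMF S
  label : S → Set P

/-- A general randomized strategy with `b` memory modes: a scheduler whose starting mode, action
choice and mode update are all randomized. -/
structure Scheduler {S A P : Type} (M : MDP S A P) (b : ℕ) where
  start : S → PMF (Fin b)
  act : Fin b → (s : S) → PMF (M.legal s)
  update : Fin b → S → PMF (Fin b)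

namespace Scheduler

variable {S A P : Type} {M : MDP S A P} {b : ℕ}

/-- One step of the Markov chain induced on states and modes: in state `s` and mode `q`, an action is
drawn from `act q s`, the successor state from the transition distribution, and (independently) the
next mode from `update q s`. -/
noncomputable def step (σ : Scheduler M b) (x : S × Fin b) : PMF (S × Fin b) :=
  (σ.act x.2 x.1).bind fun a =>
    (M.trans x.1 a).bind fun s' => (σ.update x.2 x.1).map fun q' => (s', q')

variable [MeasurableSpace S] [MeasurableSingletonClass S] [Countable S]

open ProbabilityTheory MeasureTheory in
noncomputable def stepKernel (σ : Scheduler M b) : Kernel (S × Fin b) (S × Fin b) :=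
  Kernel.ofFunOfCountable fun x => (σ.step x).toMeasure

instance (σ : Scheduler M b) : ProbabilityTheory.IsMarkovKernel σ.stepKernel :=
  ⟨fun x => PMF.toMeasure.isProbabilityMeasure (σ.step x)⟩

open ProbabilityTheory MeasureTheory in
/-- The law of the infinite sequence of states and modes from state `s₀`. -/
noncomputable def chainMeasure (σ : Scheduler M b) (s₀ : S) : Measure (ℕ → S × Fin b) :=
  Kernel.trajMeasure (X := fun _ => S × Fin b)
    ((σ.start s₀).map fun q => (s₀, q)).toMeasure
    (fun n => σ.stepKernel.comap
      (fun h : (i : Finset.Iic n) → S × Fin b => h ⟨n, Finset.mem_Iic.2 le_rfl⟩)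
      (measurable_pi_apply _))

open MeasureTheory in
/-- The law of the play (infinite sequence of states) from state `s₀`. -/
noncomputable def playMeasure (σ : Scheduler M b) (s₀ : S) : Measure (ℕ → S) :=
  (σ.chainMeasure s₀).map fun ω n => (ω n).1

/-- The probability, from `s₀`, that the play eventually visits a state whose label satisfies `R`. -/
noncomputable def reachProb (σ : Scheduler M b) (s₀ : S) (R : BoolComb P) : ℝ :=
  (σ.playMeasure s₀).real {π | ∃ k, R.Holds (M.label (π k))}

end Scheduler

/-! ### Parametric Markov decision processes -/

/-- A parametric MDP: the transition probabilities are polynomials in the parameters `X`, which are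
subject to finitely many polynomial constraints. -/
structure PMDP (S A X P : Type) where
  legal : S → Finset A
  legal_nonempty : ∀ s, (legal s).Nonempty
  trans : (s : S) → legal s → S → MvPolynomial X ℚ
  label : S → Set P
  constraints : List (Constraint (MvPolynomial X ℚ))

/-- A valuation is well-defined if it turns the transition polynomials into probability
distributions and satisfies the constraints. -/
structure PMDP.WellDefined {S A X P : Type} [Fintype S] (M : PMDP S A X P) (v : X → ℝ) :
    Prop where
  nonneg : ∀ s a s', 0 ≤ MvPolynomial.aeval v (M.trans s a s')
  sum_eq_one : ∀ s a, ∑ s', MvPolynomial.aeval v (M.trans s a s') = 1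
  constraints : ∀ c ∈ M.constraints,
    c.rel.Holds (MvPolynomial.aeval v c.lhs) (MvPolynomial.aeval v c.rhs)

/-- The MDP obtained from a parametric MDP by a well-defined valuation. -/
noncomputable def PMDP.inst {S A X P : Type} [Fintype S] (M : PMDP S A X P) (v : X → ℝ)
    (h : M.WellDefined v) : MDP S A P where
  legal := M.legal
  legal_nonempty := M.legal_nonempty
  trans s a := PMF.ofFintype (fun s' => ENNReal.ofReal (MvPolynomial.aeval v (M.trans s a s'))) (by
    rw [← ENNReal.ofReal_sum_of_nonneg fun s' _ => h.nonneg s a s', h.sum_eq_one,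
      ENNReal.ofReal_one])
  label := M.label

/-- For all well-defined valuations and all strategies with memory bound `b`, the target `R` is
reached from `s₀` with probability `⋈ d`. -/
def PMDP.UniversalReach {S A X P : Type} [Fintype S] [MeasurableSpace S]
    [MeasurableSingletonClass S] (M : PMDP S A X P) (s₀ : S) (R : BoolComb P) (b : ℕ) (c : Cmp)
    (d : ℚ) : Prop :=
  ∀ (v : X → ℝ) (h : M.WellDefined v) (σ : Scheduler (M.inst v h) b),
    c.Holds (σ.reachProb s₀ R) d

/-! ### Instances of the decision problem -/

/-- A finite presentation of an instance: a parametric MDP on states `Fin numStates`, actions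
`Fin numActions`, parameters `Fin numParams` and propositions `Fin numProps`, whose polynomials are
given by expressions, with an initial state, a target, a memory bound, and a threshold condition.
`trans s a` is `none` if action `a` is not legal in state `s`. -/
structure Instance : Type where
  numStates : ℕ
  numActions : ℕ
  numParams : ℕ
  numProps : ℕ
  trans : Fin numStates → Fin numActions → Option (Fin numStates → PolyExpr (Fin numParams))
  exists_legal : ∀ s, ∃ a, (trans s a).isSome
  label : Fin numStates → Fin numProps → Bool
  constraints : List (Constraint (PolyExpr (Fin numParams)))
  target : BoolComb (Fin numProps)
  init : Fin numStates
  bound : ℕ+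
  cmp : Cmp
  threshold : ℚ
  threshold_nonneg : 0 ≤ threshold
  threshold_le_one : threshold ≤ 1

/-- The parametric MDP presented by an instance. -/
noncomputable def Instance.toPMDP (I : Instance) :
    PMDP (Fin I.numStates) (Fin I.numActions) (Fin I.numParams) (Fin I.numProps) where
  legal s := Finset.univ.filter fun a => (I.trans s a).isSome
  legal_nonempty s := (I.exists_legal s).imp fun a ha => by simpa using ha
  trans s a s' := ((I.trans s a).get (Finset.mem_filter.1 a.2).2 s').toPoly
  label s := {p | I.label s p = true}
  constraints := I.constraints.map fun c => ⟨c.lhs.toPoly, c.rel, c.rhs.toPoly⟩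

/-- The universal reachability problem for parametric MDPs, as the set of its yes-instances. -/
def universalReachability : Set Instance :=
  {I | I.toPMDP.UniversalReach I.init I.target I.bound I.cmp I.threshold}

/-! ### Universal sentences over the reals -/

/-- Quantifier-free formulas over the reals: Boolean combinations of conditions `f ≥ 0` and `f > 0`
for polynomials `f` with rational coefficients in the variables `x₀, x₁, …`. -/
inductive RFormula : Type
  | nonneg (f : PolyExpr ℕ) : RFormula
  | pos (f : PolyExpr ℕ) : RFormula
  | neg (φ : RFormula) : RFormula
  | and (φ ψ : RFormula) : RFormula
  | or (φ ψ : RFormula) : RFormula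

def RFormula.Holds (v : ℕ → ℝ) : RFormula → Prop
  | .nonneg f => MvPolynomial.aeval v f.toPoly ≥ 0
  | .pos f => MvPolynomial.aeval v f.toPoly > 0
  | .neg φ => ¬ φ.Holds v
  | .and φ ψ => φ.Holds v ∧ ψ.Holds v
  | .or φ ψ => φ.Holds v ∨ ψ.Holds v

/-- Truth of the sentence `∀ x₀ ∀ x₁ … φ` in which every variable of `φ` is quantified. -/
def RFormula.UniversallyTrue (φ : RFormula) : Prop :=
  ∀ v : ℕ → ℝ, φ.Holds v

/-! ### Encodings as strings

Expressions and formulas are written in prefix notation. Rational constants, variable indices and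
the memory bound are in binary; the states, actions, parameters and propositions are listed, that
is, their numbers are in unary. -/

/-- The alphabet for both instances and formulas. -/
inductive Token : Type
  | bit (b : Bool)
  | tick | endmark | semi
  | const | var | add | mul
  | atom | nonneg | pos | neg | and | or
  | lt | gt | le | ge | eq
  | legal | illegal
  | item
  deriving DecidableEq, Fintype

def encNat (n : ℕ) : List Token :=
  (Computability.encodeNat n).map Token.bit ++ [Token.endmark]

def encUnary (n : ℕ) : List Token :=
  List.replicate n Token.tick ++ [Token.endmark]

/-- The sign bit, then the absolute value of the numerator, then the denominator. -/
def encRat (q : ℚ) : List Token :=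
  Token.bit (decide (q < 0)) :: (encNat q.num.natAbs ++ encNat q.den)

def encExpr {V : Type} (ix : V → ℕ) : PolyExpr V → List Token
  | .const q => Token.const :: encRat q
  | .var x => Token.var :: encNat (ix x)
  | .add p q => Token.add :: (encExpr ix p ++ encExpr ix q)
  | .mul p q => Token.mul :: (encExpr ix p ++ encExpr ix q)

def encCmp : Cmp → Token
  | .lt => Token.lt
  | .gt => Token.gt
  | .le => Token.le
  | .ge => Token.ge

def encRel : Rel → Token
  | .cmp c => encCmp c
  | .eq => Token.eq

def encConstraint {V : Type} (ix : V → ℕ) (c : Constraint (PolyExpr V)) : List Token :=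
  encRel c.rel :: (encExpr ix c.lhs ++ Token.semi :: (encExpr ix c.rhs ++ [Token.semi]))

def encBoolComb {n : ℕ} : BoolComb (Fin n) → List Token
  | .atom p => Token.atom :: encNat p
  | .neg φ => Token.neg :: encBoolComb φ
  | .and φ ψ => Token.and :: (encBoolComb φ ++ encBoolComb ψ)
  | .or φ ψ => Token.or :: (encBoolComb φ ++ encBoolComb ψ)

def encFormula : RFormula → List Token
  | .nonneg f => Token.nonneg :: encExpr id f
  | .pos f => Token.pos :: encExpr id f
  | .neg φ => Token.neg :: encFormula φ
  | .and φ ψ => Token.and :: (encFormula φ ++ encFormula ψ)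
  | .or φ ψ => Token.or :: (encFormula φ ++ encFormula ψ)

/-- A function on `Fin n`, as the concatenation of the codes of its values. -/
def encFn {α : Type} {n : ℕ} (e : α → List Token) (f : Fin n → α) : List Token :=
  (List.ofFn fun i => e (f i)).flatten

def encList {α : Type} (e : α → List Token) : List α → List Token
  | [] => [Token.endmark]
  | a :: l => Token.item :: (e a ++ encList e l)

/-- The entry of the transition table for one state and one action. -/
def encRow {n m : ℕ} : Option (Fin n → PolyExpr (Fin m)) → List Token
  | none => [Token.illegal]
  | some f => Token.legal :: encFn (fun t => encExpr Fin.val t ++ [Token.semi]) f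

def encInstance (I : Instance) : List Token :=
  encUnary I.numStates ++ (encUnary I.numActions ++ (encUnary I.numParams ++
  (encUnary I.numProps ++ (encUnary I.init ++ (encNat I.bound ++ ([encCmp I.cmp] ++
  (encRat I.threshold ++
  (encFn (encFn encRow) I.trans ++
  (encFn (encFn fun t => [Token.bit t]) I.label ++
  (encList (encConstraint Fin.val) I.constraints ++
  encBoolComb I.target))))))))))

/-! The encodings are injective. -/

/-- `e` is injective and no code word is a proper prefix of another one. -/
def Uniquely {α : Type} (e : α → List Token) : Prop :=
  ∀ a a' r r', e a ++ r = e a' ++ r' → a = a' ∧ r = r'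

theorem Uniquely.injective {α : Type} {e : α → List Token} (h : Uniquely e) :
    Function.Injective e := fun a a' haa' => (h a a' [] [] (by rw [haa'])).1

theorem uniquely_encNat : Uniquely encNat := by
  have key : ∀ (l l' : List Bool) (r r' : List Token),
      l.map Token.bit ++ Token.endmark :: r = l'.map Token.bit ++ Token.endmark :: r' →
        l = l' ∧ r = r' := by
    intro l
    induction l with
    | nil => intro l' r r' h; cases l' <;> simp_all
    | cons x l ih =>
      intro l' r r' h
      cases l' with
      | nil => simp at h
      | cons y l' =>
        simp only [List.map_cons, List.cons_append, List.cons.injEq, Token.bit.injEq] at h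
        obtain ⟨h1, h2⟩ := ih l' r r' h.2
        exact ⟨by rw [h.1, h1], h2⟩
  intro a a' r r' h
  obtain ⟨h1, h2⟩ := key _ _ r r' (by simpa [encNat] using h)
  exact ⟨Computability.encodingNatBool.encode_injective h1, h2⟩

theorem uniquely_encUnary : Uniquely encUnary := by
  intro a
  induction a with
  | zero =>
    intro a' r r' h
    cases a' <;> simp_all [encUnary, List.replicate_succ]
  | succ a ih =>
    intro a' r r' h
    cases a' with
    | zero => simp [encUnary, List.replicate_succ] at h
    | succ a' =>
      have h' : encUnary a ++ r = encUnary a' ++ r' := by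
        simpa [encUnary, List.replicate_succ] using h
      obtain ⟨h1, h2⟩ := ih a' r r' h'
      exact ⟨by rw [h1], h2⟩

theorem uniquely_encRat : Uniquely encRat := by
  intro q q' r r' h
  simp only [encRat, List.cons_append, List.append_assoc, List.cons.injEq, Token.bit.injEq,
    decide_eq_decide] at h
  obtain ⟨hs, h⟩ := h
  obtain ⟨hn, h⟩ := uniquely_encNat _ _ _ _ h
  obtain ⟨hd, h⟩ := uniquely_encNat _ _ _ _ h
  refine ⟨Rat.ext ?_ hd, h⟩
  have h1 : q.num < 0 ↔ q < 0 := Rat.num_neg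
  have h2 : q'.num < 0 ↔ q' < 0 := Rat.num_neg
  rw [← h1, ← h2] at hs
  omega

theorem uniquely_encExpr {V : Type} {ix : V → ℕ} (hix : Function.Injective ix) :
    Uniquely (encExpr ix) := by
  intro p
  induction p with
  | const q =>
    intro p' r r' h
    cases p' <;> simp only [encExpr, List.cons_append, List.cons.injEq, reduceCtorEq, false_and,
      true_and] at h
    obtain ⟨h1, h2⟩ := uniquely_encRat _ _ _ _ h
    exact ⟨by rw [h1], h2⟩
  | var x =>
    intro p' r r' h
    cases p' <;> simp only [encExpr, List.cons_append, List.cons.injEq, reduceCtorEq, false_and,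
      true_and] at h
    obtain ⟨h1, h2⟩ := uniquely_encNat _ _ _ _ h
    exact ⟨by rw [hix h1], h2⟩
  | add p q ihp ihq =>
    intro p' r r' h
    cases p' <;> simp only [encExpr, List.cons_append, List.append_assoc, List.cons.injEq,
      reduceCtorEq, false_and, true_and] at h
    obtain ⟨h1, h2⟩ := ihp _ _ _ h
    obtain ⟨h3, h4⟩ := ihq _ _ _ h2
    exact ⟨by rw [h1, h3], h4⟩
  | mul p q ihp ihq =>
    intro p' r r' h
    cases p' <;> simp only [encExpr, List.cons_append, List.append_assoc, List.cons.injEq,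
      reduceCtorEq, false_and, true_and] at h
    obtain ⟨h1, h2⟩ := ihp _ _ _ h
    obtain ⟨h3, h4⟩ := ihq _ _ _ h2
    exact ⟨by rw [h1, h3], h4⟩

theorem encCmp_injective : Function.Injective encCmp := by
  intro a b h
  cases a <;> cases b <;> simp_all [encCmp]

theorem encRel_injective : Function.Injective encRel := by
  rintro ((_ | _ | _ | _) | _) ((_ | _ | _ | _) | _) h <;> first | rfl | (simp [encRel, encCmp] at h)

theorem uniquely_encConstraint {V : Type} {ix : V → ℕ} (hix : Function.Injective ix) :
    Uniquely (encConstraint ix) := by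
  rintro ⟨l, c, p⟩ ⟨l', c', p'⟩ r r' h
  simp only [encConstraint, List.cons_append, List.append_assoc, List.cons.injEq] at h
  obtain ⟨h1, h⟩ := h
  obtain ⟨h2, h⟩ := uniquely_encExpr hix _ _ _ _ h
  simp only [List.cons.injEq, true_and] at h
  obtain ⟨h3, h⟩ := uniquely_encExpr hix _ _ _ _ h
  simp only [List.nil_append, List.cons.injEq, true_and] at h
  exact ⟨by rw [encRel_injective h1, h2, h3], h⟩

theorem uniquely_encBoolComb {n : ℕ} : Uniquely (encBoolComb (n := n)) := by
  intro p
  induction p with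
  | atom x =>
    intro p' r r' h
    cases p' <;> simp only [encBoolComb, List.cons_append, List.cons.injEq, reduceCtorEq,
      false_and, true_and] at h
    obtain ⟨h1, h2⟩ := uniquely_encNat _ _ _ _ h
    exact ⟨by rw [Fin.ext h1], h2⟩
  | neg p ihp =>
    intro p' r r' h
    cases p' <;> simp only [encBoolComb, List.cons_append, List.cons.injEq, reduceCtorEq,
      false_and, true_and] at h
    obtain ⟨h1, h2⟩ := ihp _ _ _ h
    exact ⟨by rw [h1], h2⟩
  | and p q ihp ihq =>
    intro p' r r' h
    cases p' <;> simp only [encBoolComb, List.cons_append, List.append_assoc, List.cons.injEq,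
      reduceCtorEq, false_and, true_and] at h
    obtain ⟨h1, h2⟩ := ihp _ _ _ h
    obtain ⟨h3, h4⟩ := ihq _ _ _ h2
    exact ⟨by rw [h1, h3], h4⟩
  | or p q ihp ihq =>
    intro p' r r' h
    cases p' <;> simp only [encBoolComb, List.cons_append, List.append_assoc, List.cons.injEq,
      reduceCtorEq, false_and, true_and] at h
    obtain ⟨h1, h2⟩ := ihp _ _ _ h
    obtain ⟨h3, h4⟩ := ihq _ _ _ h2
    exact ⟨by rw [h1, h3], h4⟩

theorem uniquely_encFormula : Uniquely encFormula := by
  intro p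
  induction p with
  | nonneg f =>
    intro p' r r' h
    cases p' <;> simp only [encFormula, List.cons_append, List.cons.injEq, reduceCtorEq,
      false_and, true_and] at h
    obtain ⟨h1, h2⟩ := uniquely_encExpr Function.injective_id _ _ _ _ h
    exact ⟨by rw [h1], h2⟩
  | pos f =>
    intro p' r r' h
    cases p' <;> simp only [encFormula, List.cons_append, List.cons.injEq, reduceCtorEq,
      false_and, true_and] at h
    obtain ⟨h1, h2⟩ := uniquely_encExpr Function.injective_id _ _ _ _ h
    exact ⟨by rw [h1], h2⟩
  | neg p ihp =>
    intro p' r r' h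
    cases p' <;> simp only [encFormula, List.cons_append, List.cons.injEq, reduceCtorEq,
      false_and, true_and] at h
    obtain ⟨h1, h2⟩ := ihp _ _ _ h
    exact ⟨by rw [h1], h2⟩
  | and p q ihp ihq =>
    intro p' r r' h
    cases p' <;> simp only [encFormula, List.cons_append, List.append_assoc, List.cons.injEq,
      reduceCtorEq, false_and, true_and] at h
    obtain ⟨h1, h2⟩ := ihp _ _ _ h
    obtain ⟨h3, h4⟩ := ihq _ _ _ h2
    exact ⟨by rw [h1, h3], h4⟩
  | or p q ihp ihq =>
    intro p' r r' h
    cases p' <;> simp only [encFormula, List.cons_append, List.append_assoc, List.cons.injEq,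
      reduceCtorEq, false_and, true_and] at h
    obtain ⟨h1, h2⟩ := ihp _ _ _ h
    obtain ⟨h3, h4⟩ := ihq _ _ _ h2
    exact ⟨by rw [h1, h3], h4⟩

theorem uniquely_encFn {α : Type} {e : α → List Token} (he : Uniquely e) {n : ℕ} :
    Uniquely (encFn (n := n) e) := by
  induction n with
  | zero => intro f f' r r' h; exact ⟨Subsingleton.elim _ _, by simpa [encFn] using h⟩
  | succ n ih =>
    intro f f' r r' h
    simp only [encFn, List.ofFn_succ, List.flatten_cons, List.append_assoc] at h
    obtain ⟨h1, h⟩ := he _ _ _ _ h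
    obtain ⟨h2, h⟩ := ih (fun i => f i.succ) (fun i => f' i.succ) _ _ h
    refine ⟨funext fun i => ?_, h⟩
    induction i using Fin.cases with
    | zero => exact h1
    | succ i => exact congrFun h2 i

theorem uniquely_encList {α : Type} {e : α → List Token} (he : Uniquely e) :
    Uniquely (encList e) := by
  intro l
  induction l with
  | nil => intro l' r r' h; cases l' <;> simp_all [encList]
  | cons a l ih =>
    intro l' r r' h
    cases l' with
    | nil => simp [encList] at h
    | cons a' l' =>
      simp only [encList, List.cons_append, List.append_assoc, List.cons.injEq, true_and] at h
      obtain ⟨h1, h⟩ := he _ _ _ _ h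
      obtain ⟨h2, h⟩ := ih _ _ _ h
      exact ⟨by rw [h1, h2], h⟩

theorem uniquely_encRow {n m : ℕ} : Uniquely (encRow (n := n) (m := m)) := by
  have he : Uniquely fun t : PolyExpr (Fin m) => encExpr Fin.val t ++ [Token.semi] := by
    intro t t' r r' h
    simp only [List.append_assoc] at h
    obtain ⟨h1, h⟩ := uniquely_encExpr Fin.val_injective _ _ _ _ h
    exact ⟨h1, by simpa using h⟩
  rintro (_ | f) (_ | f') r r' h
  · exact ⟨rfl, by simpa [encRow] using h⟩
  · simp [encRow] at h
  · simp [encRow] at h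
  · simp only [encRow, List.cons_append, List.cons.injEq, true_and] at h
    obtain ⟨h1, h⟩ := uniquely_encFn he _ _ _ _ h
    exact ⟨by rw [h1], h⟩

theorem encInstance_injective : Function.Injective encInstance := by
  rintro ⟨nS, nA, nX, nP, T, hT, L, C, R, i, b, c, d, hd, hd'⟩
    ⟨nS', nA', nX', nP', T', hT', L', C', R', i', b', c', d', hd2, hd2'⟩ h
  simp only [encInstance] at h
  obtain ⟨h1, h⟩ := uniquely_encUnary _ _ _ _ h
  obtain ⟨h2, h⟩ := uniquely_encUnary _ _ _ _ h
  obtain ⟨h3, h⟩ := uniquely_encUnary _ _ _ _ h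
  obtain ⟨h4, h⟩ := uniquely_encUnary _ _ _ _ h
  subst h1 h2 h3 h4
  obtain ⟨h5, h⟩ := uniquely_encUnary _ _ _ _ h
  obtain ⟨h6, h⟩ := uniquely_encNat _ _ _ _ h
  simp only [List.cons_append, List.nil_append, List.cons.injEq] at h
  obtain ⟨h7, h⟩ := h
  obtain ⟨h8, h⟩ := uniquely_encRat _ _ _ _ h
  obtain ⟨h9, h⟩ := uniquely_encFn (uniquely_encFn uniquely_encRow) _ _ _ _ h
  have hb : Uniquely fun t : Bool => [Token.bit t] := by
    intro t t' r r' h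
    simpa using h
  obtain ⟨h10, h⟩ := uniquely_encFn (uniquely_encFn hb) _ _ _ _ h
  obtain ⟨h11, h⟩ := uniquely_encList (uniquely_encConstraint Fin.val_injective) _ _ _ _ h
  have h12 := uniquely_encBoolComb.injective h
  have h5' := Fin.ext h5
  have h6' := PNat.coe_injective h6
  have h7' := encCmp_injective h7
  subst h5' h6' h7' h8 h9 h10 h11 h12
  rfl

open Classical in
/-- An injective map into strings, with the decoding it determines. -/
noncomputable def encodingOfInjective {α Γ : Type} (e : α → List Γ)
    (he : Function.Injective e) : Computability.Encoding α Γ where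
  encode := e
  decode w := if h : ∃ a, e a = w then some h.choose else none
  decode_encode a := by
    have h : ∃ a', e a' = e a := ⟨a, rfl⟩
    rw [dif_pos h, he h.choose_spec]

noncomputable def formulaEncoding : Computability.Encoding RFormula Token :=
  encodingOfInjective encFormula uniquely_encFormula.injective

noncomputable def instanceEncoding : Computability.Encoding Instance Token :=
  encodingOfInjective encInstance encInstance_injective

/-! ### The complexity class -/

/-- Membership in `∀ℝ` of a decision problem, given by the set `L` of yes-instances among objects
that are encoded as strings by `e`: it reduces, by a function that a Turing machine computes in
polynomial time, to the truth of universal sentences over the reals. -/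
def InForallR {α Γ : Type} [Fintype Γ] (e : Computability.Encoding α Γ) (L : Set α) : Prop :=
  ∃ f : α → RFormula,
    Nonempty (Turing.TM2ComputableInPolyTime e.encode formulaEncoding.encode f) ∧
      ∀ a, a ∈ L ↔ (f a).UniversallyTrue

end PReach

/-! ### Stack programs and their compilation to Turing machines -/

namespace PReach

open Turing

/-! Memory is irrelevant for reachability: for every valuation, the suprema and infima of the
reachability probabilities over all `b`-bounded strategies are attained by memoryless deterministic
ones. So a violating valuation and strategy exist iff there are a valuation and one action per state
whose reachability probability violates the threshold. This is an existential statement over the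
reals of polynomial size, and the sentence produced is its negation; the bound `b` does not occur in
it.

For fixed actions the vector `x` of reachability probabilities solves the linear equations "1 on the
target, average of the successors elsewhere", but it is only the least non-negative solution. To
exclude larger solutions, each state also gets a real rank: where `x` is positive off the target,
the chosen action must lead with positive probability to a state of positive value and smaller rank.
Such a pair is a certificate (`IsCert`). It is sound (`IsCert.exists_scheduler`): if `x` exceeded
the true probabilities, look at a state of lowest rank among those of maximal excess; the excess is
averaged over successors, so the successor of lower rank has maximal excess too, a contradiction.

Certificates for the optimal values exist (`exists_isCert_max`, `exists_isCert_min`). Take the least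
function that dominates the Bellman operator, which is a fixed point, and let the rank be the number
of steps to the target along actions that attain the value. A state of positive value with no such
path cannot exist: lowering the value on all states without a path would give a smaller dominating
function. Every `b`-bounded strategy lies between these two values (`Dominates.reachProb_le`,
`exists_dominates_le_reachProb`), whence `exists_scheduler_iff_exists_isCert`. The link to the path
measure is `Scheduler.reachProb_eq`.

For polynomial time, structured stack programs are compiled to Turing machines (`Runs.reach`), and a
calculus of transducers (`Trans`) tracks consumed input, emitted output, registers and time,
uniformly in the remaining input and the earlier output. The formula is designed for streaming:
transition probabilities, legality and labels get variables of their own, so the tables are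
translated in one pass, and the conditions on values are written afterwards by loops over counters
alone. -/

/-- Structured programs over stacks of tokens. `cases k f` pops stack `k` and continues with
`f` of the popped symbol; `loop k halt body` pops stack `k` and runs `body` on the popped symbol,
until the stack is empty or a symbol with `halt` is popped. -/
inductive Prog (K : Type) : Type
  | skip : Prog K
  | push (k : K) (t : Token) : Prog K
  | seq (p q : Prog K) : Prog K
  | cases (k : K) (f : Option Token → Prog K) : Prog K
  | loop (k : K) (halt : Token → Bool) (body : Token → Prog K) : Prog K

notation:60 p:61 ";;" q:60 => Prog.seq p q

section

variable {K : Type} [DecidableEq K]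

/-- `Runs p S S' n`: started with stacks `S`, the program `p` ends with stacks `S'` after at most
`n` steps. -/
inductive Runs : Prog K → (K → List Token) → (K → List Token) → ℕ → Prop
  | skip {S} : Runs .skip S S 1
  | push {S k t} : Runs (.push k t) S (Function.update S k (t :: S k)) 1
  | seq {p q S S₁ S₂ a b} : Runs p S S₁ a → Runs q S₁ S₂ b → Runs (p ;; q) S S₂ (a + b)
  | cases {k f S S' a} : Runs (f (S k).head?) (Function.update S k (S k).tail) S' a →
      Runs (.cases k f) S S' (a + 1)
  | loop_nil {k halt body S} : S k = [] → Runs (.loop k halt body) S S 1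
  | loop_halt {k halt body S t r} : S k = t :: r → halt t = true →
      Runs (.loop k halt body) S (Function.update S k r) 1
  | loop_next {k halt body S S₁ S₂ t r a b} : S k = t :: r → halt t = false →
      Runs (body t) (Function.update S k r) S₁ a → Runs (.loop k halt body) S₁ S₂ b →
      Runs (.loop k halt body) S S₂ (a + b + 1)
  | mono {p S S' a b} : Runs p S S' a → a ≤ b → Runs p S S' b

/-- The program points of a program. -/
def Prog.Label : Prog K → Type
  | .skip => Unit
  | .push _ _ => Unit
  | .seq p q => p.Label ⊕ q.Label
  | .cases _ f => Option (Σ o, (f o).Label)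
  | .loop _ _ body => Option (Σ t, (body t).Label)

/-- A branch carries a separate copy of its continuation for every symbol that can be popped; this
stays finite because there are finitely many tokens. -/
noncomputable instance Prog.fintypeLabel : (p : Prog K) → Fintype p.Label
  | .skip => inferInstanceAs (Fintype Unit)
  | .push _ _ => inferInstanceAs (Fintype Unit)
  | .seq p q =>
    letI := p.fintypeLabel
    letI := q.fintypeLabel
    inferInstanceAs (Fintype (p.Label ⊕ q.Label))
  | .cases _ f =>
    letI := fun o => (f o).fintypeLabel
    inferInstanceAs (Fintype (Option (Σ o, (f o).Label)))
  | .loop _ _ body =>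
    letI := fun t => (body t).fintypeLabel
    inferInstanceAs (Fintype (Option (Σ t, (body t).Label)))

def Prog.entry : (p : Prog K) → p.Label
  | .skip => ()
  | .push _ _ => ()
  | .seq p _ => Sum.inl p.entry
  | .cases _ _ => none
  | .loop _ _ _ => none

/-- The machine code of a program whose program points are placed by `emb` among the labels `L` and
that continues at `exit`. The internal state holds the symbol popped last. -/
def Prog.code {L : Type} : (p : Prog K) → (p.Label → L) → L → p.Label →
    TM2.Stmt (fun _ : K => Token) L (Option Token)
  | .skip, _, exit, _ => .goto fun _ => exit
  | .push k t, _, exit, _ => .push k (fun _ => t) (.goto fun _ => exit)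
  | .seq p q, emb, _, .inl l => p.code (fun l => emb (.inl l)) (emb (.inr q.entry)) l
  | .seq _ q, emb, exit, .inr l => q.code (fun l => emb (.inr l)) exit l
  | .cases k f, emb, _, none => .pop k (fun _ o => o) (.goto fun v => emb (some ⟨v, (f v).entry⟩))
  | .cases _ f, emb, exit, some ⟨o, l⟩ => (f o).code (fun l => emb (some ⟨o, l⟩)) exit l
  | .loop k halt body, emb, exit, none => .pop k (fun _ o => o) (.goto fun v =>
      match v with
      | none => exit
      | some t => if halt t then exit else emb (some ⟨t, (body t).entry⟩))
  | .loop _ _ body, emb, _, some ⟨t, l⟩ =>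
    (body t).code (fun l => emb (some ⟨t, l⟩)) (emb none) l

/-- `Reach M c c' n`: the machine `M` goes from `c` to `c'` in at most `n` steps. -/
def Reach {L : Type} (M : L → TM2.Stmt (fun _ : K => Token) L (Option Token))
    (c c' : TM2.Cfg (fun _ : K => Token) L (Option Token)) (n : ℕ) : Prop :=
  ∃ m ≤ n, (flip bind (TM2.step M))^[m] (some c) = some c'

theorem Reach.trans {L : Type} {M : L → TM2.Stmt (fun _ : K => Token) L (Option Token)}
    {c c' c'' : TM2.Cfg (fun _ : K => Token) L (Option Token)} {a b : ℕ}
    (h : Reach M c c' a) (h' : Reach M c' c'' b) : Reach M c c'' (a + b) := by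
  obtain ⟨m, hm, h⟩ := h
  obtain ⟨m', hm', h'⟩ := h'
  exact ⟨m' + m, by omega, by rw [Function.iterate_add_apply, h, h']⟩

theorem Reach.single {L : Type} {M : L → TM2.Stmt (fun _ : K => Token) L (Option Token)}
    {c c' : TM2.Cfg (fun _ : K => Token) L (Option Token)} (h : TM2.step M c = some c') :
    Reach M c c' 1 := ⟨1, le_rfl, h⟩

/-- Compiled programs do what the programs do. -/
theorem Runs.reach {p : Prog K} {S S' : K → List Token} {n : ℕ} (h : Runs p S S' n) {L : Type}
    (M : L → TM2.Stmt (fun _ : K => Token) L (Option Token)) (emb : p.Label → L) (exit : L)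
    (hM : ∀ l, M (emb l) = p.code emb exit l) (v : Option Token) :
    ∃ v', Reach M ⟨some (emb p.entry), v, S⟩ ⟨some exit, v', S'⟩ n := by
  -- The exit varies because parts of a program continue elsewhere than the whole. The internal
  -- state is arbitrary because code inspects it only right after a pop.
  induction h generalizing v exit with
  | skip => exact ⟨v, Reach.single (by simp [hM, Prog.code])⟩
  | push => exact ⟨v, Reach.single (by simp [hM, Prog.code])⟩
  | @seq p q S S₁ S₂ a b _ _ ih₁ ih₂ =>
    obtain ⟨v₁, h₁⟩ := ih₁ (fun l => emb (.inl l)) (emb (.inr q.entry))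
      (fun l => hM (.inl l)) v
    obtain ⟨v₂, h₂⟩ := ih₂ (fun l => emb (.inr l)) exit (fun l => hM (.inr l)) v₁
    exact ⟨v₂, h₁.trans h₂⟩
  | @cases k f S S' a _ ih =>
    obtain ⟨v₁, h₁⟩ := ih (fun l => emb (some ⟨_, l⟩)) exit (fun l => hM (some ⟨_, l⟩))
      (S k).head?
    refine ⟨v₁, ?_⟩
    rw [add_comm]
    refine Reach.trans (Reach.single ?_) h₁
    have h₀ : M (emb (Prog.entry _)) = _ := hM none
    rw [TM2.step, h₀]
    rfl
  | @loop_nil k halt body S hS =>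
    refine ⟨none, Reach.single ?_⟩
    have h₀ : M (emb (Prog.entry _)) = _ := hM none
    rw [TM2.step, h₀]
    simp only [Prog.code, TM2.stepAux, hS, List.head?_nil, List.tail_nil]
    rw [← hS, Function.update_eq_self]
  | @loop_halt k halt body S t r hS ht =>
    refine ⟨some t, Reach.single ?_⟩
    have h₀ : M (emb (Prog.entry _)) = _ := hM none
    rw [TM2.step, h₀]
    simp [Prog.code, hS, ht]
  | @loop_next k halt body S S₁ S₂ t r a b hS ht _ _ ih₁ ih₂ =>
    obtain ⟨v₁, h₁⟩ := ih₁ (fun l => emb (some ⟨t, l⟩)) (emb none) (fun l => hM (some ⟨t, l⟩))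
      (some t)
    obtain ⟨v₂, h₂⟩ := ih₂ emb exit hM v₁
    refine ⟨v₂, ?_⟩
    rw [add_comm]
    refine Reach.trans (Reach.single ?_) (h₁.trans h₂)
    have h₀ : M (emb (Prog.entry _)) = _ := hM none
    rw [TM2.step, h₀]
    simp [Prog.code, hS, ht]
  | mono _ hab ih =>
    obtain ⟨v', m, hm, h⟩ := ih emb exit hM v
    exact ⟨v', m, hm.trans hab, h⟩

/-- The Turing machine that runs a program. -/
noncomputable def Prog.machine [Fintype K] (p : Prog K) (k₀ k₁ : K) : FinTM2 where
  K := K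
  k₀ := k₀
  k₁ := k₁
  Γ _ := Token
  Λ := Option p.Label
  main := some p.entry
  σ := Option Token
  initialState := none
  Γk₀Fin := inferInstanceAs (Fintype Token)
  m
    | none => .load (fun _ => none) .halt
    | some l => p.code some none l

/-- A function is computable in polynomial time if a program computes it, on strings, in polynomial
time. -/
theorem Prog.computableInPolyTime [Fintype K] {α β : Type} {ea : α → List Token}
    {eb : β → List Token} {f : α → β} (p : Prog K) (k₀ k₁ : K) (time : Polynomial ℕ)
    (h : ∀ a, Runs p (Function.update (fun _ => []) k₀ (ea a))
      (Function.update (fun _ => []) k₁ (eb (f a))) (time.eval (ea a).length)) :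
    Nonempty (TM2ComputableInPolyTime ea eb f) := by
  have key : ∀ a, ∃ m ≤ (time + 1).eval (ea a).length,
      (flip bind (p.machine k₀ k₁).step)^[m] (some (initList (p.machine k₀ k₁) (ea a))) =
        some (haltList (p.machine k₀ k₁) (eb (f a))) := by
    intro a
    obtain ⟨v, hv⟩ := (h a).reach (L := Option p.Label) (p.machine k₀ k₁).m some none
      (fun _ => rfl) none
    -- The label `none` is the exit of the program. One more step there resets the internal state,
    -- as a halting configuration requires, which accounts for `time + 1`.
    have hfin := hv.trans (Reach.single (M := (p.machine k₀ k₁).m)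
      (c' := haltList (p.machine k₀ k₁) (eb (f a))) ?_)
    · obtain ⟨m, hm, hm'⟩ := hfin
      refine ⟨m, by simpa using hm, ?_⟩
      have hinit : initList (p.machine k₀ k₁) (ea a) = (⟨some (some p.entry), none,
          Function.update (fun _ => []) k₀ (ea a)⟩ : TM2.Cfg _ _ _) := by
        refine congrArg (TM2.Cfg.mk _ _) (funext fun k : K => ?_)
        by_cases hk : k = k₀
        · obtain rfl := hk
          exact (dif_pos rfl).trans (Function.update_self k (ea a) fun _ => []).symm
        · exact (dif_neg hk).trans (Function.update_of_ne hk (ea a) fun _ => []).symm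
      exact (congrArg (fun c => (flip bind (p.machine k₀ k₁).step)^[m] (some c)) hinit).trans hm'
    · simp only [Prog.machine, TM2.step, TM2.stepAux, haltList]
      congr 2
      funext k
      by_cases hk : k = k₁
      · subst hk; simp; rfl
      · simp [hk]
  choose m hm hm' using key
  exact ⟨{ tm := p.machine k₀ k₁
           inputAlphabet := Equiv.refl _
           outputAlphabet := Equiv.refl _
           time := time + 1
           outputsFun := fun a => ⟨⟨m a, by
              have := hm' a
              simp only [Equiv.invFun_as_coe, Equiv.refl_symm, Equiv.coe_refl]
              erw [List.map_id, List.map_id]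
              exact this⟩, hm a⟩ }⟩

end

end PReach

/-! ### Transducers: programs that consume input and emit output -/

namespace PReach

open Function

/-- The registers of the program that performs the reduction. -/
inductive Reg : Type
  | states | actions | params | props
  | init | cmp | threshold | target
  | state | action | succ
  | stateLeft | actionLeft | succLeft
  | tmp | bin | lhs | rhs | result
  deriving DecidableEq

instance : Fintype Reg where
  elems := {.states, .actions, .params, .props, .init, .cmp, .threshold, .target, .state, .action,
    .succ, .stateLeft, .actionLeft, .succLeft, .tmp, .bin, .lhs, .rhs, .result}
  complete r := by cases r <;> simp

inductive Stack : Type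
  | inp | out
  | reg (r : Reg)
  deriving DecidableEq, Fintype

/-- The contents of the store: remaining input, reversed output, registers. -/
def store (i w : List Token) (ρ : Reg → List Token) : Stack → List Token
  | .inp => i
  | .out => w
  | .reg r => ρ r

section

variable (i w l : List Token) (ρ : Reg → List Token)

@[simp] theorem store_inp : store i w ρ .inp = i := rfl
@[simp] theorem store_out : store i w ρ .out = w := rfl
@[simp] theorem store_reg (r : Reg) : store i w ρ (.reg r) = ρ r := rfl

@[simp] theorem update_store_inp : update (store i w ρ) .inp l = store l w ρ := by
  funext k; cases k <;> simp [update]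

@[simp] theorem update_store_out : update (store i w ρ) .out l = store i l ρ := by
  funext k; cases k <;> simp [update]

@[simp] theorem update_store_reg (r : Reg) :
    update (store i w ρ) (.reg r) l = store i w (update ρ r l) := by
  funext k
  rcases k with _ | _ | r'
  · simp [update]
  · simp [update]
  · by_cases h : r' = r
    · subst h; simp
    · simp [h]

end

/-- `Trans p ρ ρ' u o n`: the program `p` consumes the input `u`, emits the output `o`, changes the
registers from `ρ` to `ρ'`, and takes at most `n` steps. -/
def Trans (p : Prog Stack) (ρ ρ' : Reg → List Token) (u o : List Token) (n : ℕ) : Prop :=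
  ∀ i w, Runs p (store (u ++ i) w ρ) (store i (o.reverse ++ w) ρ') n

namespace Trans

variable {p q : Prog Stack} {ρ ρ₁ ρ₂ : Reg → List Token} {u u' o o' : List Token} {a b : ℕ}
  {r r' : Reg} {t : Token} {l : List Token} {halt : Token → Bool} {body : Token → Prog Stack}

theorem mono (h : Trans p ρ ρ₁ u o a) (hab : a ≤ b) : Trans p ρ ρ₁ u o b :=
  fun i w => (h i w).mono hab

theorem congr (h : Trans p ρ ρ₁ u o a) (hab : a ≤ b) (hρ : ∀ r, ρ₂ r = ρ₁ r) (hu : u' = u)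
    (ho : o' = o) : Trans p ρ ρ₂ u' o' b := by
  obtain rfl : ρ₂ = ρ₁ := funext hρ
  subst hu ho
  exact h.mono hab

theorem seq (h : Trans p ρ ρ₁ u o a) (h' : Trans q ρ₁ ρ₂ u' o' b) :
    Trans (p ;; q) ρ ρ₂ (u ++ u') (o ++ o') (a + b) := by
  intro i w
  have h₁ := h (u' ++ i) w
  have h₂ := h' i (o.reverse ++ w)
  rw [List.append_assoc, List.reverse_append, List.append_assoc]
  exact h₁.seq h₂

/-- Sequential composition when the first part does not read. -/
theorem seqE (h : Trans p ρ ρ₁ [] o a) (h' : Trans q ρ₁ ρ₂ u' o' b) :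
    Trans (p ;; q) ρ ρ₂ u' (o ++ o') (a + b) := h.seq h'

/-- Sequential composition when the first part does not write. -/
theorem seqR (h : Trans p ρ ρ₁ u [] a) (h' : Trans q ρ₁ ρ₂ u' o' b) :
    Trans (p ;; q) ρ ρ₂ (u ++ u') o' (a + b) := h.seq h'

/-- Sequential composition when the first part neither reads nor writes. -/
theorem seqS (h : Trans p ρ ρ₁ [] [] a) (h' : Trans q ρ₁ ρ₂ u' o' b) :
    Trans (p ;; q) ρ ρ₂ u' o' (a + b) := h.seq h'

theorem skip : Trans .skip ρ ρ [] [] 1 := fun _ _ => Runs.skip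

theorem write : Trans (.push .out t) ρ ρ [] [t] 1 := by
  intro i w
  simpa using Runs.push (S := store i w ρ) (k := .out) (t := t)

theorem push : Trans (.push (.reg r) t) ρ (update ρ r (t :: ρ r)) [] [] 1 := by
  intro i w
  simpa using Runs.push (S := store i w ρ) (k := Stack.reg r) (t := t)

theorem read {f : Option Token → Prog Stack} (h : Trans (f (some t)) ρ ρ₁ u o a) :
    Trans (.cases .inp f) ρ ρ₁ (t :: u) o (a + 1) := by
  intro i w
  refine Runs.cases ?_
  simpa using h i w

theorem cases {f : Option Token → Prog Stack} (hr : ρ r = t :: l)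
    (h : Trans (f (some t)) (update ρ r l) ρ₁ u o a) :
    Trans (.cases (.reg r) f) ρ ρ₁ u o (a + 1) := by
  intro i w
  refine Runs.cases ?_
  simpa [hr] using h i w

theorem loop_nil (hr : ρ r = []) : Trans (.loop (.reg r) halt body) ρ ρ [] [] 1 :=
  fun _ _ => Runs.loop_nil hr

theorem loop_halt (hr : ρ r = t :: l) (ht : halt t = true) :
    Trans (.loop (.reg r) halt body) ρ (update ρ r l) [] [] 1 := by
  intro i w
  have := Runs.loop_halt (S := store i w ρ) (k := Stack.reg r) (halt := halt) (body := body)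
    (t := t) (r := l) hr ht
  simpa using this

theorem loop_next (hr : ρ r = t :: l) (ht : halt t = false)
    (h : Trans (body t) (update ρ r l) ρ₁ u o a)
    (h' : Trans (.loop (.reg r) halt body) ρ₁ ρ₂ u' o' b) :
    Trans (.loop (.reg r) halt body) ρ ρ₂ (u ++ u') (o ++ o') (a + b + 1) := by
  intro i w
  have h₁ := h (u' ++ i) w
  have h₂ := h' i (o.reverse ++ w)
  rw [List.append_assoc, List.reverse_append, List.append_assoc]
  refine Runs.loop_next (S := store (u ++ (u' ++ i)) w ρ) (k := Stack.reg r) (r := l) hr ht ?_ h₂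
  simpa using h₁

theorem read_loop_halt (ht : halt t = true) :
    Trans (.loop .inp halt body) ρ ρ [t] [] 1 := by
  intro i w
  have := Runs.loop_halt (S := store (t :: i) w ρ) (k := Stack.inp) (halt := halt) (body := body)
    rfl ht
  simpa using this

theorem read_loop_next (ht : halt t = false) (h : Trans (body t) ρ ρ₁ u o a)
    (h' : Trans (.loop .inp halt body) ρ₁ ρ₂ u' o' b) :
    Trans (.loop .inp halt body) ρ ρ₂ (t :: (u ++ u')) (o ++ o') (a + b + 1) := by
  intro i w
  have h₁ := h (u' ++ i) w
  have h₂ := h' i (o.reverse ++ w)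
  rw [List.reverse_append, List.append_assoc]
  refine Runs.loop_next (S := store (t :: (u ++ u' ++ i)) w ρ) (k := Stack.inp) rfl ht ?_ h₂
  simpa using h₁

end Trans

/-- Emit a fixed string. -/
def writeAll : List Token → Prog Stack
  | [] => .skip
  | t :: l => .push .out t ;; writeAll l

theorem Trans.writeAll {ρ : Reg → List Token} :
    (l : List Token) → Trans (writeAll l) ρ ρ [] l (l.length + 1)
  | [] => Trans.skip
  | t :: l => (Trans.write.seqE (Trans.writeAll l)).mono (by simp; omega)

/-- Empty a register. -/
def clear (r : Reg) : Prog Stack := .loop (.reg r) (fun _ => false) fun _ => .skip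

theorem Trans.clear {r : Reg} {ρ : Reg → List Token} :
    Trans (clear r) ρ (update ρ r []) [] [] (2 * (ρ r).length + 1) := by
  unfold PReach.clear
  generalize hl : ρ r = l
  induction l generalizing ρ with
  | nil =>
    have e : update ρ r [] = ρ := by rw [← hl, update_eq_self]
    rw [e]
    exact Trans.loop_nil hl
  | cons t l ih =>
    have := Trans.loop_next (halt := fun _ => false) (body := fun _ => .skip) hl rfl Trans.skip
      (by simpa using ih (ρ := update ρ r l) (by simp))
    exact this.mono (by simp; omega)

/-- Move the contents of a register to another one, which reverses it. -/
def pour (r r' : Reg) : Prog Stack := .loop (.reg r) (fun _ => false) fun t => .push (.reg r') t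

theorem Trans.pour {r r' : Reg} (h : r ≠ r') {ρ : Reg → List Token} {l l' : List Token}
    (hl : ρ r = l) (hl' : ρ r' = l') :
    Trans (pour r r') ρ (update (update ρ r []) r' (l.reverse ++ l')) [] []
      (2 * l.length + 1) := by
  unfold PReach.pour
  induction l generalizing ρ l' with
  | nil =>
    refine (Trans.loop_nil hl).congr le_rfl (fun k => ?_) rfl rfl
    by_cases hk : k = r'
    · subst hk; simp [hl']
    · by_cases hk' : k = r
      · subst hk'; simp [hk, hl]
      · simp [hk, hk']
  | cons t l ih =>
    have h₁ : Trans (.push (.reg r') t) (update ρ r l) _ [] [] 1 := Trans.push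
    have h₂ := ih (ρ := update (update ρ r l) r' (t :: l')) (l' := t :: l')
      (by simp [h]) (by simp)
    refine (Trans.loop_next hl rfl (by simpa [h.symm, hl'] using h₁) h₂).congr (by simp; omega)
      (fun k => ?_) rfl rfl
    by_cases hk : k = r'
    · subst hk; simp
    · by_cases hk' : k = r
      · subst hk'; simp [hk]
      · simp [hk, hk']

/-- Append the contents of register `r` to the stack `k`, keeping the register. -/
def copyTo (k : Stack) (r : Reg) : Prog Stack :=
  pour r .tmp ;; .loop (.reg .tmp) (fun _ => false) fun t => .push (.reg r) t ;; .push k t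

/-- Pouring into the scratch register reverses the contents and unloading it reverses them again, so
both copies end up in the original order. -/
theorem Trans.copyTo_reg {r r' : Reg} (h : r ≠ .tmp) (h' : r' ≠ .tmp) (hr : r ≠ r')
    {ρ : Reg → List Token} (ht : ρ .tmp = []) (hn : ρ r' = []) :
    Trans (copyTo (.reg r') r) ρ (update ρ r' (ρ r)) [] [] (5 * (ρ r).length + 3) := by
  have key : ∀ (l : List Token) (ρ : Reg → List Token), ρ .tmp = l →
      Trans (.loop (.reg .tmp) (fun _ => false) fun t => .push (.reg r) t ;; .push (.reg r') t) ρ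
        (update (update (update ρ .tmp []) r (l.reverse ++ ρ r)) r' (l.reverse ++ ρ r'))
        [] [] (3 * l.length + 1) := by
    intro l
    induction l with
    | nil =>
      intro ρ hl
      refine (Trans.loop_nil hl).congr le_rfl (fun k => ?_) rfl rfl
      have e : update ρ .tmp [] = ρ := by rw [← hl, update_eq_self]
      simp [e]
    | cons t l ih =>
      intro ρ hl
      have h₁ : Trans (.push (.reg r) t ;; .push (.reg r') t) (update ρ .tmp l) _ [] [] (1 + 1) :=
        Trans.push.seqS Trans.push
      have h₂ := Trans.loop_next (halt := fun _ => false)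
        (body := fun t => .push (.reg r) t ;; .push (.reg r') t) hl rfl h₁
        (ih _ (by simp [h.symm, h'.symm]))
      refine h₂.congr (by simp; omega) (fun k => ?_) rfl rfl
      by_cases hk : k = r'
      · subst hk; simp [hr.symm, h, h']
      · by_cases hk' : k = r
        · subst hk'; simp [hk, h]
        · by_cases hk'' : k = .tmp
          · subst hk''; simp [h.symm, h'.symm]
          · simp [hk, hk', hk'']
  have h₁ := Trans.pour h (ρ := ρ) rfl ht
  have h₂ := h₁.seqS (key (ρ r).reverse _ (by simp))
  refine h₂.congr (by simp; omega) (fun k => ?_) rfl rfl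
  by_cases hk : k = r'
  · subst hk; simp [hr.symm, hn, h']
  · by_cases hk' : k = r
    · subst hk'; simp [hk, h]
    · by_cases hk'' : k = .tmp
      · subst hk''; simp [h.symm, h'.symm, ht]
      · simp [hk, hk', hk'']

/-- Emit the contents of a register, keeping the register. -/
def emit (r : Reg) : Prog Stack :=
  (.loop (.reg r) (fun _ => false) fun t => .push .out t ;; .push (.reg .tmp) t) ;; pour .tmp r

theorem Trans.emit {r : Reg} (h : r ≠ .tmp) {ρ : Reg → List Token} (ht : ρ .tmp = []) :
    Trans (emit r) ρ ρ [] (ρ r) (5 * (ρ r).length + 3) := by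
  have key : ∀ (l : List Token) (ρ : Reg → List Token), ρ r = l →
      Trans (.loop (.reg r) (fun _ => false) fun t => .push .out t ;; .push (.reg .tmp) t) ρ
        (update (update ρ r []) .tmp (l.reverse ++ ρ .tmp)) [] l (3 * l.length + 1) := by
    intro l
    induction l with
    | nil =>
      intro ρ hl
      refine (Trans.loop_nil hl).congr le_rfl (fun k => ?_) rfl rfl
      have e : update ρ r [] = ρ := by rw [← hl, update_eq_self]
      simp [e]
    | cons t l ih =>
      intro ρ hl
      have h₁ : Trans (.push .out t ;; .push (.reg .tmp) t) (update ρ r l) _ [] [t] (1 + 1) :=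
        Trans.write.seqE Trans.push
      have h₂ := Trans.loop_next (halt := fun _ => false)
        (body := fun t => .push .out t ;; .push (.reg .tmp) t) hl rfl h₁
        (ih _ (by simp [h]))
      refine h₂.congr (by simp; omega) (fun k => ?_) rfl rfl
      by_cases hk : k = .tmp
      · subst hk; simp [h.symm]
      · by_cases hk' : k = r
        · subst hk'; simp [hk]
        · simp [hk, hk']
  have h₂ := (key (ρ r) ρ rfl).seqE (Trans.pour h.symm rfl rfl)
  refine h₂.congr (by simp [ht]; omega) (fun k => ?_) rfl (by simp)
  by_cases hk : k = r
  · subst hk; simp [h, ht]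
  · by_cases hk' : k = .tmp
    · subst hk'; simp [h.symm, ht]
    · simp [hk, hk']

/-- The unary representation of a number in a register. -/
def ticks (n : ℕ) : List Token := List.replicate n (.bit false)

@[simp] theorem length_ticks (n : ℕ) : (ticks n).length = n := by simp [ticks]

theorem ticks_succ (n : ℕ) : ticks (n + 1) = .bit false :: ticks n := rfl

/-- Run `body` with register `cnt` holding the numbers below the one in register `bound`. -/
def forLoop (bound cnt left : Reg) (body : Prog Stack) : Prog Stack :=
  copyTo (.reg left) bound ;;
    (.loop (.reg left) (fun _ => false) fun _ => body ;; .push (.reg cnt) (.bit false)) ;; clear cnt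

/-- The body has to restore all registers, for every number of ticks in `left`, so that rounds can
be chained. Bounding the time by `N` instead of `n` lets nested loops share one cost function of the
input size. -/
theorem Trans.forLoop {bound cnt left : Reg} {body : Prog Stack} {ρ : Reg → List Token}
    (hbt : bound ≠ .tmp) (hlt : left ≠ .tmp) (hbl : bound ≠ left) (hcl : cnt ≠ left)
    {n N B : ℕ} (hn : n ≤ N) {u o : Fin n → List Token}
    (ht : ρ .tmp = []) (hb : ρ bound = ticks n) (hc : ρ cnt = []) (hl : ρ left = [])
    (h : ∀ (i : Fin n) (k : ℕ), Trans body (update (update ρ left (ticks k)) cnt (ticks i))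
      (update (update ρ left (ticks k)) cnt (ticks i)) (u i) (o i) B) :
    Trans (forLoop bound cnt left body) ρ ρ (List.ofFn u).flatten (List.ofFn o).flatten
      (N * (B + 9) + 5) := by
  -- With `m` rounds left, the counter holds `n - m`.
  have key : ∀ m (hm : m ≤ n),
      Trans (.loop (.reg left) (fun _ => false) fun _ => body ;; .push (.reg cnt) (.bit false))
        (update (update ρ left (ticks m)) cnt (ticks (n - m)))
        (update ρ cnt (ticks n))
        (List.ofFn fun i : Fin m => u ⟨n - m + i, by omega⟩).flatten
        (List.ofFn fun i : Fin m => o ⟨n - m + i, by omega⟩).flatten (m * (B + 2) + 1) := by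
    intro m
    induction m with
    | zero =>
      intro _
      have := Trans.loop_nil (ρ := update (update ρ left (ticks 0)) cnt (ticks (n - 0)))
        (r := left) (halt := fun _ => false)
        (body := fun _ => body ;; .push (.reg cnt) (.bit false)) (by simp [hcl.symm, ticks])
      simp only [List.ofFn_zero, List.flatten_nil, zero_mul, zero_add]
      convert this using 1
      simp [ticks, ← hl]
    | succ m ih =>
      intro hm
      have h₁ := (h ⟨n - (m + 1), by omega⟩ m).seq (Trans.push (r := cnt) (t := .bit false))
      have e : n - m = n - (m + 1) + 1 := by omega
      have h₂ := Trans.loop_next (halt := fun _ => false)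
        (body := fun _ => body ;; .push (.reg cnt) (.bit false)) (r := left) (t := .bit false)
        (ρ := update (update ρ left (ticks (m + 1))) cnt (ticks (n - (m + 1)))) (l := ticks m)
        (u := u ⟨n - (m + 1), by omega⟩) (o := o ⟨n - (m + 1), by omega⟩) (a := B + 1)
        (by simp [hcl.symm, ticks_succ]) rfl
        (ρ₁ := update (update ρ left (ticks m)) cnt (ticks (n - m)))
        (by
          simp only [List.append_nil, update_self, update_idem] at h₁
          rw [update_comm hcl.symm, update_idem, update_comm hcl, e, ticks_succ]
          exact h₁)
        (ih (by omega))
      simp only [List.ofFn_succ, List.flatten_cons, Fin.val_zero, add_zero, Fin.val_succ]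
      refine Trans.mono ?_ (a := B + 1 + (m * (B + 2) + 1) + 1) (by ring_nf; omega)
      convert h₂ using 6
      · congr 1; omega
      · congr 1; omega
  have h₁ := Trans.copyTo_reg hbt hlt hbl ht hl
  have h₂ := key n le_rfl
  rw [hb] at h₁
  have e : update (update ρ left (ticks n)) cnt (ticks (n - n)) = update ρ left (ticks n) := by
    rw [Nat.sub_self]
    funext k
    by_cases hk : k = cnt
    · subst hk; simp [hcl, hc, ticks]
    · simp [hk]
  rw [e] at h₂
  have h₃ := h₁.seqS (h₂.seq (Trans.clear (r := cnt)))
  simp only [update_self, length_ticks, update_idem, List.append_nil, Nat.sub_self, zero_add,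
    Fin.eta] at h₃
  have e' : update ρ cnt [] = ρ := by rw [← hc, update_eq_self]
  rw [e'] at h₃
  -- Copying the bound costs `5 n + 3`, the rounds `n (B + 2) + 1`, clearing the counter `2 n + 1`;
  -- together `n (B + 9) + 5`.
  refine h₃.mono ?_
  have : n * (B + 9) ≤ N * (B + 9) := Nat.mul_le_mul_right _ hn
  nlinarith

end PReach

/-! ### The formula -/

namespace PReach

open Function Computability

/-! ### Binary codes and the numbering of the variables. -/

/-- Binary codes, least significant bit first, without superfluous zeros. -/
def Canonical (l : List Bool) : Prop := ∃ n, encodeNat n = l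

theorem encodeNat_posNum (n : PosNum) : encodeNat (n : ℕ) = encodePosNum n := by
  rw [encodeNat, PosNum.of_to_nat, encodeNum]

theorem canonical_encodeNat (n : ℕ) : Canonical (encodeNat n) := ⟨n, rfl⟩

theorem canonical_nil : Canonical [] := ⟨0, rfl⟩

theorem Canonical.exists_posNum {l : List Bool} (h : Canonical l) (hl : l ≠ []) :
    ∃ n : PosNum, encodePosNum n = l := by
  obtain ⟨n, rfl⟩ := h
  rw [encodeNat] at hl ⊢
  cases h : (n : Num) with
  | zero => rw [h] at hl; exact absurd rfl hl
  | pos n => exact ⟨n, rfl⟩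

theorem Canonical.cons_true {l : List Bool} (h : Canonical l) : Canonical (true :: l) := by
  by_cases hl : l = []
  · subst hl; exact ⟨1, encodeNat_posNum 1⟩
  · obtain ⟨n, rfl⟩ := h.exists_posNum hl
    exact ⟨_, encodeNat_posNum (.bit1 n)⟩

/-- A zero in the lowest position doubles the number; only for the code of zero would it be
superfluous. -/
theorem Canonical.cons_false {l : List Bool} (h : Canonical l) (hl : l ≠ []) :
    Canonical (false :: l) := by
  obtain ⟨n, rfl⟩ := h.exists_posNum hl
  exact ⟨_, encodeNat_posNum (.bit0 n)⟩

theorem Canonical.encodeNat_decodeNat {l : List Bool} (h : Canonical l) :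
    encodeNat (decodeNat l) = l := by
  obtain ⟨n, rfl⟩ := h
  rw [decode_encodeNat]

/-- A self-delimiting code of a number, followed by `l`. -/
def block (n : ℕ) (l : List Bool) : List Bool := List.replicate n false ++ true :: l

theorem block_ne_nil (n : ℕ) (l : List Bool) : block n l ≠ [] := by simp [block]

theorem Canonical.block {l : List Bool} (h : Canonical l) (n : ℕ) : Canonical (block n l) := by
  induction n with
  | zero => exact h.cons_true
  | succ n ih => exact ih.cons_false (block_ne_nil n l)

theorem block_inj {n n' : ℕ} {l l' : List Bool} (h : block n l = block n' l') :
    n = n' ∧ l = l' := by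
  induction n generalizing n' with
  | zero =>
    cases n' with
    | zero => exact ⟨rfl, by simpa [block] using h⟩
    | succ n' => simp [block, List.replicate_succ] at h
  | succ n ih =>
    cases n' with
    | zero => simp [block, List.replicate_succ] at h
    | succ n' =>
      obtain ⟨h₁, h₂⟩ := ih (n' := n') (by simpa [block, List.replicate_succ] using h)
      exact ⟨by rw [h₁], h₂⟩

/-- Each of the `n` low zero bits doubles a positive number. -/
theorem two_pow_le_of_encodeNat {m n : ℕ} {l : List Bool} (h : encodeNat m = block n l) :
    2 ^ n ≤ m := by
  have key : ∀ (n : ℕ) (q : PosNum), encodePosNum q = block n l → 2 ^ n ≤ (q : ℕ) := by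
    intro n
    induction n with
    | zero => intro q _; simp
    | succ n ih =>
      intro q hq
      cases q with
      | one => simp [encodePosNum, block, List.replicate_succ] at hq
      | bit1 q => simp [encodePosNum, block, List.replicate_succ] at hq
      | bit0 q =>
        have := ih q (by simpa [encodePosNum, block, List.replicate_succ] using hq)
        rw [PosNum.cast_bit0, pow_succ]
        omega
  rw [encodeNat] at h
  cases hm : (m : Num) with
  | zero => rw [hm] at h; exact absurd h.symm (block_ne_nil n l)
  | pos q =>
    rw [hm] at h
    have := key n q h
    have hc : (((m : Num) : ℕ)) = m := Num.to_of_nat m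
    rw [hm] at hc
    rw [← hc]
    simpa using this

/-- Indices of the auxiliary variables, in the presence of `p` parameters. -/
def varIndex (p tag s : ℕ) (l : List Bool) : ℕ := decodeNat (block p (block tag (block s l)))

/-- The code of an index is literally the string of blocks, so a program can write it by copying
unary registers, without arithmetic. -/
theorem encodeNat_varIndex (p tag s : ℕ) {l : List Bool} (hl : Canonical l) :
    encodeNat (varIndex p tag s l) = block p (block tag (block s l)) :=
  (((hl.block s).block tag).block p).encodeNat_decodeNat

theorem varIndex_inj {p tag s tag' s' : ℕ} {l l' : List Bool} (hl : Canonical l)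
    (hl' : Canonical l') (h : varIndex p tag s l = varIndex p tag' s' l') :
    tag = tag' ∧ s = s' ∧ l = l' := by
  have := congrArg encodeNat h
  rw [encodeNat_varIndex _ _ _ hl, encodeNat_varIndex _ _ _ hl'] at this
  obtain ⟨h₁, h₂⟩ := block_inj (block_inj this).2
  exact ⟨h₁, block_inj h₂⟩

/-- This is the purpose of the first block: `p` low zeros push the index to at least `2 ^ p`, beyond
the parameters, which keep their own indices below `p`. -/
theorem lt_varIndex (p tag s : ℕ) {l : List Bool} (hl : Canonical l) : p < varIndex p tag s l :=
  Nat.lt_two_pow_self.trans_le (two_pow_le_of_encodeNat (encodeNat_varIndex p tag s hl))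

/-- The reachability probability of state `s`. -/
def xVar (p s : ℕ) : PolyExpr ℕ := .var (varIndex p 0 s [])
/-- The rank of state `s`. -/
def rankVar (p s : ℕ) : PolyExpr ℕ := .var (varIndex p 1 s [])
/-- Positive if action `a` is legal in state `s`. -/
def legalVar (p s a : ℕ) : PolyExpr ℕ := .var (varIndex p 2 s (block a []))
/-- The transition probability from state `s` to state `s'` under action `a`. -/
def transVar (p s a s' : ℕ) : PolyExpr ℕ := .var (varIndex p 3 s (block a (block s' [])))
/-- Positive if proposition `q` holds in state `s`. -/
def labelVar (p s q : ℕ) : PolyExpr ℕ := .var (varIndex p 4 s (encodeNat q))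

/-! ### The sentence and its building blocks. -/

def PolyExpr.rename {V W : Type} (f : V → W) : PolyExpr V → PolyExpr W
  | .const q => .const q
  | .var x => .var (f x)
  | .add p q => .add (p.rename f) (q.rename f)
  | .mul p q => .mul (p.rename f) (q.rename f)

theorem encExpr_rename {V W : Type} (f : V → W) (ix : W → ℕ) (e : PolyExpr V) :
    encExpr ix (e.rename f) = encExpr (fun x => ix (f x)) e := by
  induction e <;> simp_all [encExpr, PolyExpr.rename]

def PolyExpr.sub {V : Type} (e e' : PolyExpr V) : PolyExpr V := .add e (.mul (.const (-1)) e')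

def PolyExpr.sum {V : Type} (l : List (PolyExpr V)) : PolyExpr V := l.foldr .add (.const 0)

def RFormula.ge (e e' : PolyExpr ℕ) : RFormula := .nonneg (e.sub e')

def RFormula.gt (e e' : PolyExpr ℕ) : RFormula := .pos (e.sub e')

def RFormula.eq (e e' : PolyExpr ℕ) : RFormula := .and (.ge e e') (.ge e' e)

def RFormula.disj (l : List RFormula) : RFormula := l.foldr .or (.pos (.const 0))

def RFormula.conj (l : List RFormula) (φ : RFormula) : RFormula := l.foldr .and φ

/-- Conditions on the variables that describe the row of the transition table for state `s` and
action `a`. -/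
def rowFormulas {n p : ℕ} (s a : ℕ) : Option (Fin n → PolyExpr (Fin p)) → List RFormula
  | none => [.neg (.pos (legalVar p s a))]
  | some f =>
    .pos (legalVar p s a) ::
      ((List.ofFn fun s' : Fin n => [.eq (transVar p s a s') ((f s').rename Fin.val),
        .nonneg (transVar p s a s')]).flatten ++
      [.eq (.sum (List.ofFn fun s' : Fin n => transVar p s a s')) (.const 1)])

def labelFormula (p s q : ℕ) (b : Bool) : RFormula :=
  if b then .pos (labelVar p s q) else .neg (.pos (labelVar p s q))

def constraintFormula {p : ℕ} (c : Constraint (PolyExpr (Fin p))) : RFormula :=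
  match c.rel with
  | .cmp .lt => .gt (c.rhs.rename Fin.val) (c.lhs.rename Fin.val)
  | .cmp .gt => .gt (c.lhs.rename Fin.val) (c.rhs.rename Fin.val)
  | .cmp .le => .ge (c.rhs.rename Fin.val) (c.lhs.rename Fin.val)
  | .cmp .ge => .ge (c.lhs.rename Fin.val) (c.rhs.rename Fin.val)
  | .eq => .eq (c.lhs.rename Fin.val) (c.rhs.rename Fin.val)

/-- The target condition in state `s`. -/
def targetFormula {k : ℕ} (p s : ℕ) : BoolComb (Fin k) → RFormula
  | .atom q => .pos (labelVar p s q)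
  | .neg φ => .neg (targetFormula p s φ)
  | .and φ ψ => .and (targetFormula p s φ) (targetFormula p s ψ)
  | .or φ ψ => .or (targetFormula p s φ) (targetFormula p s ψ)

/-- Action `a` attains the value of state `s` and, if that value is positive, leads with positive
probability to a state of positive value and lower rank. -/
def actionFormula (n p s a : ℕ) : RFormula :=
  .and (.pos (legalVar p s a))
    (.and
      (.eq (xVar p s) (.sum (List.ofFn fun s' : Fin n => .mul (transVar p s a s') (xVar p s'))))
      (.or (.neg (.pos (xVar p s)))
        (.disj (List.ofFn fun s' : Fin n =>
          .and (.pos (.mul (transVar p s a s') (xVar p s'))) (.gt (rankVar p s) (rankVar p s'))))))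

/-- Selecting a true disjunct in every state amounts to selecting a memoryless deterministic
strategy. -/
def valueFormula {k : ℕ} (n m p s : ℕ) (R : BoolComb (Fin k)) : RFormula :=
  .or (.and (targetFormula p s R) (.eq (xVar p s) (.const 1)))
    (.and (.neg (targetFormula p s R)) (.disj (List.ofFn fun a : Fin m => actionFormula n p s a)))

/-- The threshold condition is violated. -/
def thresholdFormula (p s : ℕ) (d : ℚ) : Cmp → RFormula
  | .lt => .ge (xVar p s) (.const d)
  | .gt => .ge (.const d) (xVar p s)
  | .le => .gt (xVar p s) (.const d)
  | .ge => .gt (.const d) (xVar p s)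

/-- The conjuncts follow the order in which the code of the instance supplies the data. The
conditions on values come late because they need the target, which is the end of the input. -/
def Instance.formula (I : Instance) : RFormula :=
  .neg (.conj
    ((List.ofFn fun s => (List.ofFn fun a => rowFormulas s a (I.trans s a)).flatten).flatten ++
    ((List.ofFn fun s => (List.ofFn fun q =>
        [labelFormula I.numParams s q (I.label s q)]).flatten).flatten ++
    (I.constraints.map constraintFormula ++
    (List.ofFn fun s : Fin I.numStates => [.nonneg (xVar I.numParams s),
        valueFormula I.numStates I.numActions I.numParams s I.target]).flatten)))
    (thresholdFormula I.numParams I.init I.threshold I.cmp))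

/-- The code of a list of conjuncts, each preceded by a conjunction. -/
def encConj (l : List RFormula) : List Token := (l.map fun φ => .and :: encFormula φ).flatten

theorem encFormula_conj (l : List RFormula) (φ : RFormula) :
    encFormula (.conj l φ) = encConj l ++ encFormula φ := by
  induction l with
  | nil => rfl
  | cons ψ l ih => simpa [RFormula.conj, encFormula, encConj] using ih

theorem encConj_append (l l' : List RFormula) : encConj (l ++ l') = encConj l ++ encConj l' := by
  simp [encConj]

theorem encConj_flatten_ofFn {n : ℕ} (f : Fin n → List RFormula) :
    encConj (List.ofFn f).flatten = (List.ofFn fun i => encConj (f i)).flatten := by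
  induction n with
  | zero => simp [encConj]
  | succ n ih => simp [List.ofFn_succ, encConj_append, ih]

theorem encConj_cons (φ : RFormula) (l : List RFormula) :
    encConj (φ :: l) = [.and] ++ (encFormula φ ++ encConj l) := by
  simp [encConj]

theorem encConj_singleton (φ : RFormula) : encConj [φ] = [.and] ++ encFormula φ := by
  simp [encConj]

end PReach

/-! ### The program that writes the formula -/

namespace PReach

open Function Computability

/-- `p` emits the code of the expression `e`, in at most `n` steps. -/
def WritesExpr (p : Prog Stack) (ρ : Reg → List Token) (e : PolyExpr ℕ) (n : ℕ) : Prop :=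
  Trans p ρ ρ [] (encExpr id e) n

/-- `p` emits the code of the formula `φ`, in at most `n` steps. -/
def WritesFormula (p : Prog Stack) (ρ : Reg → List Token) (φ : RFormula) (n : ℕ) : Prop :=
  Trans p ρ ρ [] (encFormula φ) n

section

variable {p q : Prog Stack} {ρ : Reg → List Token} {e e' : PolyExpr ℕ} {φ ψ : RFormula} {a b : ℕ}

def writeConst (c : ℚ) : Prog Stack := writeAll (.const :: encRat c)

theorem WritesExpr.const (c : ℚ) :
    WritesExpr (writeConst c) ρ (.const c) ((encRat c).length + 2) := Trans.writeAll _

/-- Emit a symbol and two further codes. -/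
def write₂ (t : Token) (p q : Prog Stack) : Prog Stack := .push .out t ;; p ;; q

theorem Trans.write₂ {o o' : List Token} {t : Token} (hp : Trans p ρ ρ [] o a)
    (hq : Trans q ρ ρ [] o' b) : Trans (write₂ t p q) ρ ρ [] (t :: (o ++ o')) (a + b + 1) :=
  (Trans.write.seqE (hp.seqE hq)).mono (by omega)

theorem WritesExpr.add (hp : WritesExpr p ρ e a) (hq : WritesExpr q ρ e' b) :
    WritesExpr (write₂ .add p q) ρ (.add e e') (a + b + 1) := Trans.write₂ hp hq

theorem WritesExpr.mul (hp : WritesExpr p ρ e a) (hq : WritesExpr q ρ e' b) :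
    WritesExpr (write₂ .mul p q) ρ (.mul e e') (a + b + 1) := Trans.write₂ hp hq

theorem WritesFormula.and (hp : WritesFormula p ρ φ a) (hq : WritesFormula q ρ ψ b) :
    WritesFormula (write₂ .and p q) ρ (.and φ ψ) (a + b + 1) := Trans.write₂ hp hq

theorem WritesFormula.or (hp : WritesFormula p ρ φ a) (hq : WritesFormula q ρ ψ b) :
    WritesFormula (write₂ .or p q) ρ (.or φ ψ) (a + b + 1) := Trans.write₂ hp hq

/-- Emit a symbol and a further code. -/
def write₁ (t : Token) (p : Prog Stack) : Prog Stack := .push .out t ;; p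

theorem Trans.write₁ {o : List Token} {t : Token} (hp : Trans p ρ ρ [] o a) :
    Trans (write₁ t p) ρ ρ [] (t :: o) (a + 1) :=
  (Trans.write.seqE hp).mono (by omega)

theorem WritesFormula.neg (hp : WritesFormula p ρ φ a) :
    WritesFormula (write₁ .neg p) ρ (.neg φ) (a + 1) := Trans.write₁ hp

theorem WritesFormula.nonneg (hp : WritesExpr p ρ e a) :
    WritesFormula (write₁ .nonneg p) ρ (.nonneg e) (a + 1) := Trans.write₁ hp

theorem WritesFormula.pos (hp : WritesExpr p ρ e a) :
    WritesFormula (write₁ .pos p) ρ (.pos e) (a + 1) := Trans.write₁ hp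

def writeSub (p q : Prog Stack) : Prog Stack := write₂ .add p (write₂ .mul (writeConst (-1)) q)

def negOneCost : ℕ := (encRat (-1)).length + 4

theorem WritesExpr.sub (hp : WritesExpr p ρ e a) (hq : WritesExpr q ρ e' b) :
    WritesExpr (writeSub p q) ρ (e.sub e') (a + b + negOneCost) :=
  (hp.add ((WritesExpr.const (-1)).mul hq)).mono (by simp only [negOneCost]; omega)

def writeEq (p q : Prog Stack) : Prog Stack :=
  write₂ .and (write₁ .nonneg (writeSub p q)) (write₁ .nonneg (writeSub q p))

theorem WritesFormula.eq (hp : WritesExpr p ρ e a) (hq : WritesExpr q ρ e' b) :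
    WritesFormula (writeEq p q) ρ (.eq e e') (2 * a + 2 * b + 2 * negOneCost + 3) :=
  ((WritesFormula.nonneg (hp.sub hq)).and (WritesFormula.nonneg (hq.sub hp))).mono (by omega)

theorem WritesFormula.ge (hp : WritesExpr p ρ e a) (hq : WritesExpr q ρ e' b) :
    WritesFormula (write₁ .nonneg (writeSub p q)) ρ (.ge e e') (a + b + negOneCost + 1) :=
  WritesFormula.nonneg (hp.sub hq)

theorem WritesFormula.gt (hp : WritesExpr p ρ e a) (hq : WritesExpr q ρ e' b) :
    WritesFormula (write₁ .pos (writeSub p q)) ρ (.gt e e') (a + b + negOneCost + 1) :=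
  WritesFormula.pos (hp.sub hq)

end

/-! #### Invariants of the registers -/

/-- The registers hold the sizes of the instance, which are at most `N`, and the scratch register
is empty. -/
structure Env (N n m p k : ℕ) (ρ : Reg → List Token) : Prop where
  states : ρ .states = ticks n
  actions : ρ .actions = ticks m
  params : ρ .params = ticks p
  props : ρ .props = ticks k
  tmp : ρ .tmp = []
  states_le : n ≤ N
  actions_le : m ≤ N
  params_le : p ≤ N
  props_le : k ≤ N

/-- The registers that `Env` leaves free. -/
def Reg.Free : Reg → Prop
  | .states | .actions | .params | .props | .tmp => False
  | _ => True

theorem Env.update {N n m p k : ℕ} {ρ : Reg → List Token} (h : Env N n m p k ρ) {r : Reg}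
    (hr : r.Free) (l : List Token) : Env N n m p k (update ρ r l) := by
  obtain ⟨h₁, h₂, h₃, h₄, h₅, h₆, h₇, h₈, h₉⟩ := h
  refine ⟨?_, ?_, ?_, ?_, ?_, h₆, h₇, h₈, h₉⟩ <;> rw [update_of_ne] <;>
    first | assumption | (rintro rfl; exact hr)

section

variable {N n m p k : ℕ} {ρ : Reg → List Token} {s a s' : ℕ}

/-- The time to emit a variable. -/
def varCost (N : ℕ) : ℕ := 20 * N + 100

/-- Emit a variable whose code has register `r` as its second block. -/
def writeVar (tag : ℕ) (r : Reg) (rest : Prog Stack) : Prog Stack :=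
  .push .out .var ;; emit .params ;; writeAll (.bit true :: ticks tag ++ [.bit true]) ;; emit r ;;
    .push .out (.bit true) ;; rest ;; .push .out .endmark

theorem map_bit_block (n : ℕ) (l : List Bool) :
    (block n l).map Token.bit = ticks n ++ .bit true :: l.map .bit := by
  simp [block, ticks]

theorem WritesExpr.var (h : Env N n m p k ρ) {tag : ℕ} {r : Reg} (hr : r ≠ .tmp)
    (hs : ρ r = ticks s) (hsN : s ≤ N) {rest : Prog Stack} {l : List Bool} (hl : Canonical l)
    {b : ℕ} (hrest : Trans rest ρ ρ [] (l.map .bit) b) :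
    WritesExpr (writeVar tag r rest) ρ (.var (varIndex p tag s l)) (10 * N + tag + b + 20) := by
  have := (Trans.write (t := .var)).seqE ((Trans.emit (ρ := ρ) (r := .params) (by simp) h.tmp).seqE
    ((Trans.writeAll (.bit true :: ticks tag ++ [.bit true])).seqE
    ((Trans.emit hr h.tmp).seqE ((Trans.write (t := .bit true)).seqE
    (hrest.seqE (Trans.write (t := .endmark)))))))
  refine this.congr ?_ (fun _ => rfl) rfl ?_
  · rw [h.params, hs]
    have := h.params_le
    simp only [length_ticks, List.length_cons, List.length_append, List.length_nil]
    omega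
  · rw [h.params, hs]
    simp [encExpr, encNat, encodeNat_varIndex _ _ _ hl, map_bit_block]

/-- Emit a block of a variable. -/
def writeBlock (r : Reg) (rest : Prog Stack) : Prog Stack :=
  emit r ;; .push .out (.bit true) ;; rest

theorem Trans.writeBlock (h : Env N n m p k ρ) {r : Reg} (hr : r ≠ .tmp)
    (hs : ρ r = ticks s) (hsN : s ≤ N) {rest : Prog Stack} {l : List Bool}
    {b : ℕ} (hrest : Trans rest ρ ρ [] (l.map .bit) b) :
    Trans (writeBlock r rest) ρ ρ [] ((block s l).map .bit) (5 * N + b + 4) := by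
  refine ((Trans.emit hr h.tmp).seqE (Trans.write.seqE hrest)).congr ?_ (fun _ => rfl) rfl ?_
  · rw [hs, length_ticks]; omega
  · rw [hs, map_bit_block]; rfl

def writeX (r : Reg) : Prog Stack := writeVar 0 r .skip
def writeRank (r : Reg) : Prog Stack := writeVar 1 r .skip
def writeLegal : Prog Stack := writeVar 2 .state (writeBlock .action .skip)
def writeTrans : Prog Stack := writeVar 3 .state (writeBlock .action (writeBlock .succ .skip))

theorem WritesExpr.x (h : Env N n m p k ρ) {r : Reg} (hr : r ≠ .tmp) (hs : ρ r = ticks s)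
    (hsN : s ≤ N) : WritesExpr (writeX r) ρ (xVar p s) (varCost N) :=
  (WritesExpr.var h hr hs hsN canonical_nil Trans.skip).mono (by simp only [varCost]; omega)

theorem WritesExpr.rank (h : Env N n m p k ρ) {r : Reg} (hr : r ≠ .tmp) (hs : ρ r = ticks s)
    (hsN : s ≤ N) : WritesExpr (writeRank r) ρ (rankVar p s) (varCost N) :=
  (WritesExpr.var h hr hs hsN canonical_nil Trans.skip).mono (by simp only [varCost]; omega)

theorem WritesExpr.legal (h : Env N n m p k ρ) (hs : ρ .state = ticks s) (hsN : s ≤ N)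
    (ha : ρ .action = ticks a) (haN : a ≤ N) :
    WritesExpr writeLegal ρ (legalVar p s a) (varCost N) :=
  (WritesExpr.var h (by simp) hs hsN (canonical_nil.block a)
    (Trans.writeBlock h (by simp) ha haN Trans.skip)).mono (by simp only [varCost]; omega)

theorem WritesExpr.trans (h : Env N n m p k ρ) (hs : ρ .state = ticks s) (hsN : s ≤ N)
    (ha : ρ .action = ticks a) (haN : a ≤ N) (hs' : ρ .succ = ticks s') (hsN' : s' ≤ N) :
    WritesExpr writeTrans ρ (transVar p s a s') (varCost N) :=
  (WritesExpr.var h (by simp) hs hsN ((canonical_nil.block s').block a)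
    (Trans.writeBlock h (by simp) ha haN
      (Trans.writeBlock h (by simp) hs' hsN' Trans.skip))).mono (by simp only [varCost]; omega)

/-! #### Loops over states and actions -/

def forStates (body : Prog Stack) : Prog Stack := forLoop .states .state .stateLeft body
def forActions (body : Prog Stack) : Prog Stack := forLoop .actions .action .actionLeft body
def forSuccs (body : Prog Stack) : Prog Stack := forLoop .states .succ .succLeft body

/-- The time of a loop with at most `N` rounds of at most `B` steps. -/
def loopCost (N B : ℕ) : ℕ := N * (B + 9) + 5

/-- In prefix notation a right-nested sum is a stream of summands, each preceded by `add`, and a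
closing constant. A loop can emit it without knowing how many rounds remain. -/
theorem encExpr_sum {n : ℕ} (f : Fin n → PolyExpr ℕ) :
    encExpr id (.sum (List.ofFn f)) =
      (List.ofFn fun i => .add :: encExpr id (f i)).flatten ++ encExpr (V := ℕ) id (.const 0) := by
  induction n with
  | zero => simp [PolyExpr.sum]
  | succ n ih =>
    have := ih fun i => f i.succ
    simp only [PolyExpr.sum, List.ofFn_succ, List.foldr_cons, List.flatten_cons, encExpr] at this ⊢
    rw [this]; simp

theorem encFormula_disj {n : ℕ} (f : Fin n → RFormula) :
    encFormula (.disj (List.ofFn f)) =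
      (List.ofFn fun i => .or :: encFormula (f i)).flatten ++ encFormula (.pos (.const 0)) := by
  induction n with
  | zero => simp [RFormula.disj]
  | succ n ih =>
    have := ih fun i => f i.succ
    simp only [RFormula.disj, List.ofFn_succ, List.foldr_cons, List.flatten_cons, encFormula]
      at this ⊢
    rw [this]; simp

/-- The body is described only through the registers on which it relies, which hides the state of
the loop counter. -/
theorem Trans.forSuccs (h : Env N n m p k ρ) (h₁ : ρ .succ = []) (h₂ : ρ .succLeft = [])
    {body : Prog Stack} {B : ℕ} {u o : Fin n → List Token}
    (hb : ∀ (i : Fin n) (ρ' : Reg → List Token), Env N n m p k ρ' → ρ' .state = ρ .state →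
      ρ' .action = ρ .action → ρ' .lhs = ρ .lhs → ρ' .succ = ticks i →
      Trans body ρ' ρ' (u i) (o i) B) :
    Trans (forSuccs body) ρ ρ (List.ofFn u).flatten (List.ofFn o).flatten (loopCost N B) :=
  Trans.forLoop (by simp) (by simp) (by simp) (by simp) h.states_le h.tmp h.states h₁ h₂
    fun i j => hb i _ ((h.update (by trivial) _).update (by trivial) _) (by simp) (by simp)
      (by simp)
      (by simp)

theorem Trans.forActions (h : Env N n m p k ρ) (h₁ : ρ .action = []) (h₂ : ρ .actionLeft = [])
    {body : Prog Stack} {B : ℕ} {u o : Fin m → List Token}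
    (hb : ∀ (i : Fin m) (ρ' : Reg → List Token), Env N n m p k ρ' → ρ' .state = ρ .state →
      ρ' .lhs = ρ .lhs → ρ' .succ = ρ .succ → ρ' .succLeft = ρ .succLeft →
      ρ' .action = ticks i → Trans body ρ' ρ' (u i) (o i) B) :
    Trans (forActions body) ρ ρ (List.ofFn u).flatten (List.ofFn o).flatten (loopCost N B) :=
  Trans.forLoop (by simp) (by simp) (by simp) (by simp) h.actions_le h.tmp h.actions h₁ h₂
    fun i j => hb i _ ((h.update (by trivial) _).update (by trivial) _) (by simp) (by simp)
      (by simp)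
      (by simp) (by simp)

def writeSum (body : Prog Stack) : Prog Stack :=
  forSuccs (write₁ .add body) ;; writeConst 0

def sumCost (N B : ℕ) : ℕ := loopCost N (B + 1) + (encRat 0).length + 2

theorem WritesExpr.sum (h : Env N n m p k ρ) (h₁ : ρ .succ = []) (h₂ : ρ .succLeft = [])
    {body : Prog Stack} {B : ℕ} {f : Fin n → PolyExpr ℕ}
    (hb : ∀ (i : Fin n) (ρ' : Reg → List Token), Env N n m p k ρ' → ρ' .state = ρ .state →
      ρ' .action = ρ .action → ρ' .succ = ticks i → WritesExpr body ρ' (f i) B) :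
    WritesExpr (writeSum body) ρ (.sum (List.ofFn f)) (sumCost N B) := by
  have := (Trans.forSuccs h h₁ h₂ (u := fun _ => [])
    (fun i ρ' e e₁ e₂ _ e₃ => Trans.write₁ (t := .add) (hb i ρ' e e₁ e₂ e₃))).seq
      (WritesExpr.const (ρ := ρ) 0)
  refine this.congr (by simp only [sumCost]; omega) (fun _ => rfl) (by simp) ?_
  rw [encExpr_sum]

def writeSuccDisj (body : Prog Stack) : Prog Stack :=
  forSuccs (write₁ .or body) ;; write₁ .pos (writeConst 0)

theorem WritesFormula.succDisj (h : Env N n m p k ρ) (h₁ : ρ .succ = []) (h₂ : ρ .succLeft = [])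
    {body : Prog Stack} {B : ℕ} {f : Fin n → RFormula}
    (hb : ∀ (i : Fin n) (ρ' : Reg → List Token), Env N n m p k ρ' → ρ' .state = ρ .state →
      ρ' .action = ρ .action → ρ' .succ = ticks i → WritesFormula body ρ' (f i) B) :
    WritesFormula (writeSuccDisj body) ρ (.disj (List.ofFn f)) (sumCost N B + 1) := by
  have := (Trans.forSuccs h h₁ h₂ (u := fun _ => [])
    (fun i ρ' e e₁ e₂ _ e₃ => Trans.write₁ (t := .or) (hb i ρ' e e₁ e₂ e₃))).seq
      (WritesFormula.pos (WritesExpr.const (ρ := ρ) 0))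
  refine this.congr (by simp only [sumCost]; omega) (fun _ => rfl) (by simp) ?_
  rw [encFormula_disj]

def writeActionDisj (body : Prog Stack) : Prog Stack :=
  forActions (write₁ .or body) ;; write₁ .pos (writeConst 0)

theorem WritesFormula.actionDisj (h : Env N n m p k ρ) (h₁ : ρ .action = [])
    (h₂ : ρ .actionLeft = []) {body : Prog Stack} {B : ℕ} {f : Fin m → RFormula}
    (hb : ∀ (i : Fin m) (ρ' : Reg → List Token), Env N n m p k ρ' → ρ' .state = ρ .state →
      ρ' .succ = ρ .succ → ρ' .succLeft = ρ .succLeft →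
      ρ' .action = ticks i → WritesFormula body ρ' (f i) B) :
    WritesFormula (writeActionDisj body) ρ (.disj (List.ofFn f)) (sumCost N B + 1) := by
  have := (Trans.forActions h h₁ h₂ (u := fun _ => [])
    (fun i ρ' e e₁ _ e₂ e₃ e₄ => Trans.write₁ (t := .or) (hb i ρ' e e₁ e₂ e₃ e₄))).seq
      (WritesFormula.pos (WritesExpr.const (ρ := ρ) 0))
  refine this.congr (by simp only [sumCost]; omega) (fun _ => rfl) (by simp) ?_
  rw [encFormula_disj]

/-! #### The condition on the value of a state -/

def writeAction : Prog Stack :=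
  write₂ .and (write₁ .pos writeLegal)
    (write₂ .and
      (writeEq (writeX .state) (writeSum (write₂ .mul writeTrans (writeX .succ))))
      (write₂ .or (write₁ .neg (write₁ .pos (writeX .state)))
        (writeSuccDisj (write₂ .and (write₁ .pos (write₂ .mul writeTrans (writeX .succ)))
          (write₁ .pos (writeSub (writeRank .state) (writeRank .succ)))))))

def actionCost (N : ℕ) : ℕ :=
  4 * varCost N + 2 * sumCost N (2 * varCost N + 1) + 2 * negOneCost +
    sumCost N (4 * varCost N + negOneCost + 4) + 10

theorem WritesFormula.action (h : Env N n m p k ρ) (hs : ρ .state = ticks s) (hsN : s ≤ N)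
    (ha : ρ .action = ticks a) (haN : a ≤ N) (h₁ : ρ .succ = []) (h₂ : ρ .succLeft = []) :
    WritesFormula writeAction ρ (actionFormula n p s a) (actionCost N) := by
  have hx := WritesExpr.x h (r := .state) (by simp) hs hsN
  have hmul : ∀ (i : Fin n) (ρ' : Reg → List Token), Env N n m p k ρ' → ρ' .state = ρ .state →
      ρ' .action = ρ .action → ρ' .succ = ticks i →
      WritesExpr (write₂ .mul writeTrans (writeX .succ)) ρ' (.mul (transVar p s a i) (xVar p i))
        (varCost N + varCost N + 1) := fun i ρ' e e₁ e₂ e₃ =>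
    have hi : (i : ℕ) ≤ N := i.2.le.trans h.states_le
    (WritesExpr.trans e (e₁.trans hs) hsN (e₂.trans ha) haN e₃ hi).mul
      (WritesExpr.x e (by simp) e₃ hi)
  refine ((WritesFormula.pos (WritesExpr.legal h hs hsN ha haN)).and
    ((WritesFormula.eq hx (WritesExpr.sum h h₁ h₂ hmul)).and
      ((WritesFormula.neg (WritesFormula.pos hx)).or
        (WritesFormula.succDisj h h₁ h₂ fun i ρ' e e₁ e₂ e₃ =>
          have hi : (i : ℕ) ≤ N := i.2.le.trans h.states_le
          ((WritesFormula.pos (hmul i ρ' e e₁ e₂ e₃)).and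
            (WritesFormula.gt (WritesExpr.rank e (by simp) (e₁.trans hs) hsN)
              (WritesExpr.rank e (by simp) e₃ hi))).mono
                (b := 4 * varCost N + negOneCost + 4) (by omega))))).mono ?_
  rw [actionCost, show 2 * varCost N + 1 = varCost N + varCost N + 1 by omega]
  omega

/-- Emit the target condition for the current state. -/
def writeTarget : Prog Stack :=
  (.loop (.reg .target) (fun _ => false) fun t =>
    (if t = .atom then .push .out .pos ;; .push .out .var ;; emit .params ;;
        writeAll (.bit true :: ticks 4 ++ [.bit true]) ;; emit .state ;; .push .out (.bit true)
      else .push .out t) ;; .push (.reg .lhs) t) ;; pour .lhs .target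

/-- The effect of `writeTarget` on single symbols. -/
def targetSubst (p s : ℕ) (t : Token) : List Token :=
  if t = .atom then .pos :: .var :: (ticks p ++ .bit true :: (ticks 4 ++
    .bit true :: (ticks s ++ [.bit true]))) else [t]

/-- Translating the target is a substitution of single tokens, and this is why `labelVar` ends in
the binary code of the proposition rather than in a block: `atom` is replaced by the beginning of a
variable, and the bits and the end mark that follow it are copied unchanged. -/
theorem encFormula_targetFormula {k : ℕ} (p s : ℕ) (R : BoolComb (Fin k)) :
    encFormula (targetFormula p s R) = ((encBoolComb R).map (targetSubst p s)).flatten := by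
  induction R with
  | atom q =>
    simp only [targetFormula, labelVar, encFormula, encExpr, encNat, id, encBoolComb,
      encodeNat_varIndex _ _ _ (canonical_encodeNat _), map_bit_block]
    have : ∀ l : List Bool, (List.map (targetSubst p s) (l.map Token.bit)).flatten =
        l.map Token.bit := by
      intro l
      induction l <;> simp_all [targetSubst]
    simp only [List.map_cons, List.map_append, List.flatten_cons, List.flatten_append, this]
    simp [targetSubst]
  | neg φ ih => simp [targetFormula, encFormula, encBoolComb, targetSubst, ih]
  | and φ ψ ih₁ ih₂ => simp [targetFormula, encFormula, encBoolComb, targetSubst, ih₁, ih₂]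
  | or φ ψ ih₁ ih₂ => simp [targetFormula, encFormula, encBoolComb, targetSubst, ih₁, ih₂]

def targetCost (N : ℕ) : ℕ := N * (10 * N + 40) + 2

theorem WritesFormula.target (h : Env N n m p k ρ) (hs : ρ .state = ticks s) (hsN : s ≤ N)
    (hl : ρ .lhs = []) {R : BoolComb (Fin k)} (hR : ρ .target = encBoolComb R)
    (hRN : (encBoolComb R).length ≤ N) :
    WritesFormula writeTarget ρ (targetFormula p s R) (targetCost N) := by
  -- Here `l` is the part of the target still to be translated and `l'` the reversed part already
  -- saved in `lhs`.
  have key : ∀ (l l' : List Token) (ρ : Reg → List Token), Env N n m p k ρ → ρ .state = ticks s →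
      ρ .target = l → ρ .lhs = l' →
      Trans (.loop (.reg .target) (fun _ => false) fun t =>
        (if t = .atom then .push .out .pos ;; .push .out .var ;; emit .params ;;
          writeAll (.bit true :: ticks 4 ++ [.bit true]) ;; emit .state ;; .push .out (.bit true)
        else .push .out t) ;; .push (.reg .lhs) t) ρ
        (update (update ρ .target []) .lhs (l.reverse ++ l')) []
        ((l.map (targetSubst p s)).flatten) (l.length * (10 * N + 30) + 1) := by
    intro l
    induction l with
    | nil =>
      intro l' ρ _ _ hl hl'
      refine (Trans.loop_nil hl).congr (by simp) (fun k => ?_) rfl rfl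
      by_cases hk : k = .lhs
      · subst hk; simp [hl']
      · by_cases hk' : k = .target
        · subst hk'; simp [hl]
        · simp [hk, hk']
    | cons t l ih =>
      intro l' ρ h hs hl hl'
      have h' : Env N n m p k (update ρ .target l) := h.update (by trivial) _
      have h₁ : Trans (if t = .atom then .push .out .pos ;; .push .out .var ;; emit .params ;;
          writeAll (.bit true :: ticks 4 ++ [.bit true]) ;; emit .state ;; .push .out (.bit true)
        else .push .out t) (update ρ .target l) (update ρ .target l) [] (targetSubst p s t)
        (10 * N + 20) := by
        by_cases ht : t = .atom
        · rw [if_pos ht]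
          refine (Trans.write.seqE (Trans.write.seqE ((Trans.emit (by simp) h'.tmp).seqE
            ((Trans.writeAll _).seqE ((Trans.emit (by simp) h'.tmp).seqE
              Trans.write))))).congr ?_ (fun _ => rfl) rfl ?_
          · have := h.params_le
            simp [hs, h.params, ticks]
            omega
          · simp [targetSubst, ht, hs, h.params]
        · rw [if_neg ht]
          exact Trans.write.congr (by omega) (fun _ => rfl) rfl (by simp [targetSubst, ht])
      have h₂ := h₁.seqE (Trans.push (r := .lhs) (t := t))
      have h₃ := Trans.loop_next hl rfl h₂
        (ih (t :: l') _ (h'.update (by trivial) _) (by simpa using hs) (by simp) (by simp [hl']))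
      refine h₃.congr ?_ (fun k => ?_) rfl (by simp)
      · simp only [List.length_cons]; ring_nf; omega
      · by_cases hk : k = .lhs
        · subst hk; simp
        · by_cases hk' : k = .target
          · subst hk'; simp
          · simp [hk, hk']
  have h₁ := (key _ _ ρ h hs hR hl).seqE (Trans.pour (r := .lhs) (r' := .target) (by simp)
    rfl rfl)
  refine h₁.congr ?_ (fun k => ?_) rfl ?_
  · rw [targetCost]
    have := Nat.mul_le_mul_right (10 * N + 30) hRN
    simp only [List.append_nil, List.length_reverse, update_self]
    nlinarith
  · by_cases hk : k = .lhs
    · subst hk; simp [hl]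
    · by_cases hk' : k = .target
      · subst hk'; simp [hR]
      · simp [hk, hk']
  · rw [encFormula_targetFormula]; simp

def writeValue : Prog Stack :=
  write₂ .or (write₂ .and writeTarget (writeEq (writeX .state) (writeConst 1)))
    (write₂ .and (write₁ .neg writeTarget) (writeActionDisj writeAction))

def valueCost (N : ℕ) : ℕ :=
  2 * targetCost N + 2 * varCost N + 2 * negOneCost + 2 * (encRat 1).length +
    sumCost N (actionCost N) + 20

theorem WritesFormula.value (h : Env N n m p k ρ) (hs : ρ .state = ticks s) (hsN : s ≤ N)
    (hl : ρ .lhs = []) {R : BoolComb (Fin k)} (hR : ρ .target = encBoolComb R)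
    (hRN : (encBoolComb R).length ≤ N) (ha : ρ .action = []) (ha' : ρ .actionLeft = [])
    (h₁ : ρ .succ = []) (h₂ : ρ .succLeft = []) :
    WritesFormula writeValue ρ (valueFormula n m p s R) (valueCost N) := by
  have hT := WritesFormula.target h hs hsN hl hR hRN
  refine ((hT.and (WritesFormula.eq (WritesExpr.x h (by simp) hs hsN) (WritesExpr.const 1))).or
    ((WritesFormula.neg hT).and (WritesFormula.actionDisj h ha ha' fun i ρ' e e₁ e₂ e₃ e₄ =>
      WritesFormula.action e (e₁.trans hs) hsN e₄ (i.2.le.trans h.actions_le) (e₂.trans h₁)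
        (e₃.trans h₂)))).mono ?_
  rw [valueCost]; omega

end

end PReach

/-! ### Reading the instance -/

namespace PReach

open Function Computability

/-- Read the input up to a symbol with `halt` and push it on register `r`. -/
def readUntil (halt : Token → Bool) (r : Reg) : Prog Stack :=
  .loop .inp halt fun t => .push (.reg r) t

theorem trans_readUntil {halt : Token → Bool} {r : Reg} {l : List Token} {t : Token}
    (hl : ∀ t ∈ l, halt t = false) (ht : halt t = true) {ρ : Reg → List Token} :
    Trans (readUntil halt r) ρ (update ρ r (l.reverse ++ ρ r)) (l ++ [t]) []
      (2 * l.length + 1) := by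
  unfold readUntil
  induction l generalizing ρ with
  | nil => exact (Trans.read_loop_halt ht).congr le_rfl (by simp) rfl rfl
  | cons t' l ih =>
    refine (Trans.read_loop_next (hl t' (by simp)) Trans.push
      (ih fun t ht => hl t (by simp [ht]))).congr (by simp; omega) (fun k => ?_) rfl rfl
    simp

/-- Read the input up to a symbol with `halt` into register `r`. -/
def readInto (halt : Token → Bool) (r : Reg) : Prog Stack := readUntil halt .tmp ;; pour .tmp r

theorem trans_readInto {halt : Token → Bool} {r : Reg} (hr : r ≠ .tmp) {l : List Token} {t : Token}
    (hl : ∀ t ∈ l, halt t = false) (ht : halt t = true) {ρ : Reg → List Token} (h : ρ .tmp = [])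
    (h' : ρ r = []) :
    Trans (readInto halt r) ρ (update ρ r l) (l ++ [t]) [] (4 * l.length + 2) := by
  refine ((trans_readUntil hl ht).seqR (Trans.pour hr.symm rfl rfl)).congr ?_ (fun k => ?_)
    (by simp) rfl
  · simp [h]; omega
  · by_cases hk : k = r
    · subst hk; simp [hr, h, h']
    · by_cases hk' : k = .tmp
      · subst hk'; simp [hr.symm, h]
      · simp [hk, hk']

def isSemi (t : Token) : Bool := t = .semi
def isEndmark (t : Token) : Bool := t = .endmark

theorem isSemi_encNat (n : ℕ) : ∀ t ∈ encNat n, isSemi t = false := by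
  intro t ht
  simp only [encNat, List.mem_append, List.mem_map, List.mem_singleton] at ht
  rcases ht with ⟨b, _, rfl⟩ | rfl <;> rfl

theorem isSemi_encRat (q : ℚ) : ∀ t ∈ encRat q, isSemi t = false := by
  intro t ht
  simp only [encRat, List.mem_cons, List.mem_append] at ht
  rcases ht with rfl | ht | ht
  · simp [isSemi]
  · exact isSemi_encNat _ t ht
  · exact isSemi_encNat _ t ht

/-- An expression can be read up to the next `semi` without parsing it. The token `endmark` could
not serve as delimiter, since it closes every number inside. -/
theorem isSemi_encExpr {V : Type} (ix : V → ℕ) (e : PolyExpr V) :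
    ∀ t ∈ encExpr ix e, isSemi t = false := by
  induction e with
  | const q =>
    intro t ht
    rcases List.mem_cons.1 ht with rfl | ht
    · rfl
    · exact isSemi_encRat q t ht
  | var x =>
    intro t ht
    rcases List.mem_cons.1 ht with rfl | ht
    · rfl
    · exact isSemi_encNat _ t ht
  | add p q ihp ihq =>
    intro t ht
    simp only [encExpr, List.mem_cons, List.mem_append] at ht
    rcases ht with rfl | ht | ht
    exacts [rfl, ihp t ht, ihq t ht]
  | mul p q ihp ihq =>
    intro t ht
    simp only [encExpr, List.mem_cons, List.mem_append] at ht
    rcases ht with rfl | ht | ht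
    exacts [rfl, ihp t ht, ihq t ht]

section

variable {N n m p k : ℕ} {ρ : Reg → List Token} {s a : ℕ}

theorem trans_readExpr {r : Reg} (hr : r ≠ .tmp) (e : PolyExpr (Fin p))
    (heN : (encExpr Fin.val e).length ≤ N) (h : ρ .tmp = []) (h' : ρ r = []) :
    Trans (readInto isSemi r) ρ (Function.update ρ r (encExpr Fin.val e))
      (encExpr Fin.val e ++ [.semi]) [] (4 * N + 2) :=
  (trans_readInto hr (isSemi_encExpr _ e) rfl h h').mono (by omega)

theorem WritesExpr.register {r : Reg} (hr : r ≠ .tmp) (e : PolyExpr (Fin p))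
    (heN : (encExpr Fin.val e).length ≤ N) (h : ρ .tmp = []) (h' : ρ r = encExpr Fin.val e) :
    WritesExpr (emit r) ρ (e.rename Fin.val) (5 * N + 3) := by
  refine (Trans.emit hr h).congr (by rw [h']; omega) (fun _ => rfl) rfl ?_
  rw [encExpr_rename, h']; rfl

/-! #### Transition table -/

theorem length_le_flatten_ofFn {α : Type} {n : ℕ} (f : Fin n → List α) (i : Fin n) :
    (f i).length ≤ (List.ofFn f).flatten.length :=
  (List.sublist_flatten_of_mem ((List.mem_ofFn' f _).2 ⟨i, rfl⟩)).length_le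

/-- The entry is stored in a register because the equation for it consists of two inequalities and
mentions it twice. -/
def copyEntry : Prog Stack :=
  readInto isSemi .lhs ;; .push .out .and ;; writeEq writeTrans (emit .lhs) ;; .push .out .and ;;
    write₁ .nonneg writeTrans ;; clear .lhs

def copyRow : Prog Stack :=
  .cases .inp fun o => if o = some .legal then
      .push .out .and ;; write₁ .pos writeLegal ;; forSuccs copyEntry ;; .push .out .and ;;
        writeEq (writeSum writeTrans) (writeConst 1)
    else .push .out .and ;; write₁ .neg (write₁ .pos writeLegal)

def entryCost (N : ℕ) : ℕ := 16 * N + 3 * varCost N + 2 * negOneCost + 20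

theorem trans_copyEntry (h : Env N n m p k ρ) (hs : ρ .state = ticks s) (hsN : s ≤ N)
    (ha : ρ .action = ticks a) (haN : a ≤ N) (hl : ρ .lhs = []) {s' : ℕ}
    (hs' : ρ .succ = ticks s') (hsN' : s' ≤ N) (e : PolyExpr (Fin p))
    (heN : (encExpr Fin.val e).length ≤ N) :
    Trans copyEntry ρ ρ (encExpr Fin.val e ++ [.semi])
      (encConj [.eq (transVar p s a s') (e.rename Fin.val), .nonneg (transVar p s a s')])
      (entryCost N) := by
  have h' := h.update (r := .lhs) trivial (encExpr Fin.val e)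
  have ht : WritesExpr writeTrans (update ρ .lhs (encExpr Fin.val e)) (transVar p s a s')
      (varCost N) :=
    WritesExpr.trans h' (by simpa using hs) hsN (by simpa using ha) haN (by simpa using hs') hsN'
  refine ((trans_readExpr (by simp) e heN h.tmp hl).seqR (Trans.write.seqE
    ((WritesFormula.eq ht (WritesExpr.register (by simp) e heN h'.tmp (by simp))).seqE
    (Trans.write.seqE ((WritesFormula.nonneg ht).seqE (Trans.clear (r := .lhs))))))).congr
      ?_ (fun k => ?_) (by simp) ?_
  · simp only [update_self, entryCost]; omega
  · by_cases hk : k = .lhs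
    · subst hk; simp [hl]
    · simp [hk]
  · simp [encConj]

def rowCost (N : ℕ) : ℕ :=
  varCost N + loopCost N (entryCost N) + 2 * sumCost N (varCost N) + 2 * (encRat 1).length +
    2 * negOneCost + 20

theorem trans_copyRow (h : Env N n m p k ρ) (hs : ρ .state = ticks s) (hsN : s ≤ N)
    (ha : ρ .action = ticks a) (haN : a ≤ N) (hl : ρ .lhs = []) (h₁ : ρ .succ = [])
    (h₂ : ρ .succLeft = []) (row : Option (Fin n → PolyExpr (Fin p)))
    (hrN : (encRow row).length ≤ N) :
    Trans copyRow ρ ρ (encRow row) (encConj (rowFormulas s a row)) (rowCost N) := by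
  have hL := WritesFormula.pos (WritesExpr.legal h hs hsN ha haN)
  cases row with
  | none =>
    refine (Trans.read ?_).mono (a := varCost N + 3 + 1) (by simp only [rowCost]; omega)
    rw [if_neg (by simp)]
    refine (Trans.write.seqE (WritesFormula.neg hL)).congr (by omega) (fun _ => rfl) rfl ?_
    simp [rowFormulas, encConj]
  | some f =>
    have hN : ∀ i, (encExpr Fin.val (f i)).length ≤ N := by
      intro i
      have := length_le_flatten_ofFn (fun i => encExpr Fin.val (f i) ++ [.semi]) i
      simp only [encRow, encFn, List.length_cons, List.length_append, List.length_nil] at this hrN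
      omega
    -- One step is set aside for reading the leading token; the truncated subtraction is exact since
    -- `rowCost N` is positive.
    refine (Trans.read ?_).mono (a := rowCost N - 1 + 1) (by simp only [rowCost]; omega)
    rw [if_pos rfl]
    refine (Trans.write.seqE (hL.seqE ((Trans.forSuccs h h₁ h₂ (B := entryCost N)
      (u := fun i => encExpr Fin.val (f i) ++ [.semi])
      (o := fun i => encConj [.eq (transVar p s a i) ((f i).rename Fin.val),
        .nonneg (transVar p s a i)])
      fun i ρ' e e₁ e₂ e₃ e₄ => trans_copyEntry e (e₁.trans hs) hsN (e₂.trans ha) haN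
        (e₃.trans hl) e₄ (i.2.le.trans h.states_le) (f i) (hN i)).seq
      (Trans.write.seqE (WritesFormula.eq (WritesExpr.sum h h₁ h₂ fun i ρ' e e₁ e₂ e₃ =>
        WritesExpr.trans e (e₁.trans hs) hsN (e₂.trans ha) haN e₃ (i.2.le.trans h.states_le))
        (WritesExpr.const 1)))))).congr ?_ (fun _ => rfl) (by simp [encFn]) ?_
    · simp only [rowCost]; omega
    · rw [rowFormulas, encConj_cons, encConj_append, encConj_flatten_ofFn, encConj_singleton]

theorem trans_forStates (h : Env N n m p k ρ) (h₁ : ρ .state = []) (h₂ : ρ .stateLeft = [])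
    {body : Prog Stack} {B : ℕ} {u o : Fin n → List Token}
    (hb : ∀ (i : Fin n) (ρ' : Reg → List Token), Env N n m p k ρ' →
      (∀ r, r ≠ .state → r ≠ .stateLeft → ρ' r = ρ r) → ρ' .state = ticks i →
      Trans body ρ' ρ' (u i) (o i) B) :
    Trans (forStates body) ρ ρ (List.ofFn u).flatten (List.ofFn o).flatten (loopCost N B) :=
  Trans.forLoop (by simp) (by simp) (by simp) (by simp) h.states_le h.tmp h.states h₁ h₂
    fun i j => hb i _ ((h.update (by trivial) _).update (by trivial) _)
      (fun r hr hr' => by simp [hr, hr']) (by simp)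

/-- The registers that hold neither sizes nor data of the instance are empty. -/
structure Idle (ρ : Reg → List Token) : Prop where
  state : ρ .state = []
  action : ρ .action = []
  succ : ρ .succ = []
  stateLeft : ρ .stateLeft = []
  actionLeft : ρ .actionLeft = []
  succLeft : ρ .succLeft = []
  bin : ρ .bin = []
  lhs : ρ .lhs = []
  rhs : ρ .rhs = []
  result : ρ .result = []

theorem trans_copyRows (h : Env N n m p k ρ) (h' : Idle ρ)
    (T : Fin n → Fin m → Option (Fin n → PolyExpr (Fin p)))
    (hN : (encFn (encFn encRow) T).length ≤ N) :
    Trans (forStates (forActions copyRow)) ρ ρ (encFn (encFn encRow) T)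
      (encConj (List.ofFn fun s => (List.ofFn fun a => rowFormulas s a (T s a)).flatten).flatten)
      (loopCost N (loopCost N (rowCost N))) := by
  simp only [encConj_flatten_ofFn]
  refine trans_forStates h h'.state h'.stateLeft fun s ρ' e e₁ e₂ => ?_
  refine Trans.forActions e (by simpa [h'.action] using e₁ .action)
    (by simpa [h'.actionLeft] using e₁ .actionLeft) fun a ρ'' e' e₃ e₄ e₅ e₆ e₇ => ?_
  refine trans_copyRow e' (e₃.trans e₂) (s.2.le.trans h.states_le) e₇ (a.2.le.trans h.actions_le)
    (e₄.trans (by simpa [h'.lhs] using e₁ .lhs)) (e₅.trans (by simpa [h'.succ] using e₁ .succ))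
    (e₆.trans (by simpa [h'.succLeft] using e₁ .succLeft)) _ ?_
  exact ((length_le_flatten_ofFn (fun a => encRow (T s a)) a).trans
    (length_le_flatten_ofFn (fun s => encFn encRow (T s)) s)).trans hN

/-! #### Labels -/

/-- The successor function on binary codes. -/
def incBits : List Bool → List Bool
  | [] => [true]
  | false :: l => true :: l
  | true :: l => false :: incBits l

theorem encodePosNum_succ (q : PosNum) : encodePosNum q.succ = incBits (encodePosNum q) := by
  induction q with
  | one => rfl
  | bit0 q _ => rfl
  | bit1 q ih => simpa [PosNum.succ, encodePosNum, incBits] using ih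

theorem encodeNat_succ (n : ℕ) : encodeNat (n + 1) = incBits (encodeNat n) := by
  rw [encodeNat, encodeNat, Nat.cast_succ, Num.add_one]
  cases (n : Num) with
  | zero => rfl
  | pos q => exact encodePosNum_succ q

theorem length_incBits (l : List Bool) : (incBits l).length ≤ l.length + 1 := by
  induction l with
  | nil => simp [incBits]
  | cons b l ih => cases b <;> simp [incBits]; omega

theorem length_encodeNat_le (n : ℕ) : (encodeNat n).length ≤ n := by
  induction n with
  | zero => exact le_rfl
  | succ n ih => rw [encodeNat_succ]; exact (length_incBits _).trans (by omega)

def incLoop : Prog Stack :=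
  .loop (.reg .bin) (fun t => t ≠ .bit true) fun _ => .push (.reg .tmp) (.bit false)

/-- Increment the binary number in register `bin`. -/
def increment : Prog Stack := incLoop ;; .push (.reg .bin) (.bit true) ;; pour .tmp .bin

/-- Here `j` is the number of ones at the low end and `r` is what follows the first zero, or empty
if there is none. The loop turns those ones into zeros on the scratch register, which already holds
`c` of them, and pops the zero that stops the carry. -/
theorem trans_incLoop (l : List Bool) : ∃ j r, incBits l = List.replicate j false ++ true :: r ∧
    j ≤ l.length ∧ ∀ (ρ : Reg → List Token) (c : ℕ), ρ .bin = l.map .bit → ρ .tmp = ticks c →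
      Trans incLoop ρ (update (update ρ .tmp (ticks (j + c))) .bin (r.map .bit)) [] []
        (2 * l.length + 1) := by
  induction l with
  | nil =>
    refine ⟨0, [], rfl, le_rfl, fun ρ c hb ht => ?_⟩
    refine (Trans.loop_nil hb).congr le_rfl (fun k => ?_) rfl rfl
    by_cases hk : k = .bin
    · subst hk; simp [hb]
    · by_cases hk' : k = .tmp
      · subst hk'; simp [ht]
      · simp [hk, hk']
  | cons b l ih =>
    cases b with
    | false =>
      refine ⟨0, l, rfl, by simp, fun ρ c hb ht => ?_⟩
      refine (Trans.loop_halt hb (by simp)).congr (by simp) (fun k => ?_) rfl rfl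
      by_cases hk : k = .bin
      · subst hk; simp
      · by_cases hk' : k = .tmp
        · subst hk'; simp [ht]
        · simp [hk, hk']
    | true =>
      obtain ⟨j, r, h₁, h₂, h₃⟩ := ih
      refine ⟨j + 1, r, by simp [incBits, h₁, List.replicate_succ], by simpa using h₂,
        fun ρ c hb ht => ?_⟩
      refine (Trans.loop_next hb (by simp) (Trans.push (r := .tmp) (t := .bit false))
        (h₃ _ (c + 1) (by simp) (by simp [ht, ticks_succ]))).congr (by simp; omega)
        (fun k => ?_) rfl rfl
      by_cases hk : k = .bin
      · subst hk; simp
      · by_cases hk' : k = .tmp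
        · subst hk'; simp [show j + 1 + c = j + (c + 1) by omega]
        · simp [hk, hk']

theorem trans_increment {l : List Bool} (hb : ρ .bin = l.map .bit) (ht : ρ .tmp = []) :
    Trans increment ρ (update ρ .bin ((incBits l).map .bit)) [] [] (4 * l.length + 3) := by
  obtain ⟨j, r, h₁, h₂, h₃⟩ := trans_incLoop l
  refine ((h₃ ρ 0 hb ht).seqS (Trans.push.seqS (Trans.pour (by simp) rfl rfl))).congr ?_
    (fun k => ?_) rfl rfl
  · simp; omega
  · by_cases hk : k = .bin
    · subst hk; simp [h₁, ticks]
    · by_cases hk' : k = .tmp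
      · subst hk'; simp [ht]
      · simp [hk, hk']

/-- Put the binary code of the number in register `action` into register `bin`. -/
def toBinary : Prog Stack :=
  copyTo (.reg .succLeft) .action ;; .loop (.reg .succLeft) (fun _ => false) fun _ => increment

/-- Unary is converted to binary by counting: `q` increments from the empty code of zero. The
register `succLeft`, idle while labels are read, counts the rounds. -/
theorem trans_toBinary {q : ℕ} (ha : ρ .action = ticks q) (hq : q ≤ N) (ht : ρ .tmp = [])
    (hb : ρ .bin = []) (hl : ρ .succLeft = []) :
    Trans toBinary ρ (update ρ .bin ((encodeNat q).map .bit)) [] []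
      (N * (4 * N + 4) + 5 * N + 4) := by
  have key : ∀ (j i : ℕ) (ρ : Reg → List Token), i + j ≤ N → ρ .tmp = [] →
      ρ .bin = (encodeNat i).map .bit → ρ .succLeft = ticks j →
      Trans (.loop (.reg .succLeft) (fun _ => false) fun _ => increment) ρ
        (update (update ρ .succLeft []) .bin ((encodeNat (i + j)).map .bit)) [] []
        (j * (4 * N + 4) + 1) := by
    intro j
    induction j with
    | zero =>
      intro i ρ hi ht hb hl
      refine (Trans.loop_nil hl).congr (by simp) (fun k => ?_) rfl rfl
      by_cases hk : k = .bin
      · subst hk; simp [hb]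
      · by_cases hk' : k = .succLeft
        · subst hk'; simp [hl, ticks]
        · simp [hk, hk']
    | succ j ih =>
      intro i ρ hi ht hb hl
      refine (Trans.loop_next (l := ticks j) hl rfl (trans_increment (by simpa using hb)
        (by simpa using ht))
        (ih (i + 1) _ (by omega) (by simpa using ht) (by simp [encodeNat_succ]) (by simp))).congr
        ?_ (fun k => ?_) rfl rfl
      · have := length_encodeNat_le i
        rw [add_mul, one_mul]
        omega
      · by_cases hk : k = .bin
        · subst hk; simp [show i + (j + 1) = i + 1 + j by omega]
        · by_cases hk' : k = .succLeft
          · subst hk'; simp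
          · simp [hk, hk']
  refine ((Trans.copyTo_reg (by simp) (by simp) (by simp) ht hl).seqS
    (key q 0 _ (by omega) (by simpa using ht) (by rw [update_of_ne (by simp), hb]; rfl)
      (by simpa using ha))).congr ?_
    (fun k => ?_) rfl rfl
  · rw [ha, length_ticks]
    have := Nat.mul_le_mul_right (4 * N + 4) hq
    omega
  · by_cases hk : k = .bin
    · subst hk; simp
    · by_cases hk' : k = .succLeft
      · subst hk'; simp [hl]
      · simp [hk, hk']

def writeLabelVar : Prog Stack := toBinary ;; writeVar 4 .state (emit .bin) ;; clear .bin

def labelVarCost (N : ℕ) : ℕ := N * (4 * N + 4) + 22 * N + 40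

theorem WritesExpr.label {q : ℕ} (h : Env N n m p k ρ) (hs : ρ .state = ticks s) (hsN : s ≤ N)
    (ha : ρ .action = ticks q) (hq : q ≤ N) (hb : ρ .bin = []) (hl : ρ .succLeft = []) :
    WritesExpr writeLabelVar ρ (labelVar p s q) (labelVarCost N) := by
  have h' := h.update (r := .bin) trivial ((encodeNat q).map .bit)
  have hlen := length_encodeNat_le q
  have he : Trans (emit .bin) (update ρ .bin ((encodeNat q).map .bit)) _ []
      ((encodeNat q).map .bit) (5 * N + 3) :=
    (Trans.emit (by simp) h'.tmp).congr (by simp; omega) (fun _ => rfl) rfl (by simp)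
  refine ((trans_toBinary ha hq h.tmp hb hl).seqS
    ((WritesExpr.var h' (r := .state) (tag := 4) (by simp) (by simpa using hs) hsN
      (canonical_encodeNat q) he).seqE Trans.clear)).congr ?_ (fun k => ?_) rfl ?_
  · simp only [update_self, List.length_map, labelVarCost]; omega
  · by_cases hk : k = .bin
    · subst hk; simp [hb]
    · simp [hk]
  · simp [labelVar]

def copyLabel : Prog Stack :=
  .cases .inp fun o => .push .out .and ;; if o = some (.bit true) then write₁ .pos writeLabelVar
    else write₁ .neg (write₁ .pos writeLabelVar)

theorem trans_copyLabel {q : ℕ} (h : Env N n m p k ρ) (hs : ρ .state = ticks s) (hsN : s ≤ N)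
    (ha : ρ .action = ticks q) (hq : q ≤ N) (hb : ρ .bin = []) (hl : ρ .succLeft = [])
    (b : Bool) : Trans copyLabel ρ ρ [.bit b] (encConj [labelFormula p s q b])
      (labelVarCost N + 4) := by
  have hL := WritesFormula.pos (WritesExpr.label h hs hsN ha hq hb hl)
  refine (Trans.read (a := labelVarCost N + 3) ?_).mono (by omega)
  rw [encConj_singleton]
  cases b with
  | true =>
    rw [if_pos rfl]
    exact (Trans.write.seqE hL).mono (by omega)
  | false =>
    rw [if_neg (by simp)]
    exact (Trans.write.seqE (WritesFormula.neg hL)).mono (by omega)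

/-- Propositions are counted in the registers for actions, which are free during this pass;
`toBinary` takes its argument from there. -/
def forProps (body : Prog Stack) : Prog Stack := forLoop .props .action .actionLeft body

theorem trans_copyLabels (h : Env N n m p k ρ) (h' : Idle ρ) (L : Fin n → Fin k → Bool) :
    Trans (forStates (forProps copyLabel)) ρ ρ (encFn (encFn fun t => [Token.bit t]) L)
      (encConj (List.ofFn fun s => (List.ofFn fun q =>
        [labelFormula p s q (L s q)]).flatten).flatten)
      (loopCost N (loopCost N (labelVarCost N + 4))) := by
  simp only [encConj_flatten_ofFn]
  refine trans_forStates h h'.state h'.stateLeft fun s ρ' e e₁ e₂ => ?_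
  refine Trans.forLoop (by simp) (by simp) (by simp) (by simp) e.props_le e.tmp e.props
    (by simpa [h'.action] using e₁ .action) (by simpa [h'.actionLeft] using e₁ .actionLeft)
    fun q j => ?_
  refine trans_copyLabel ((e.update (by trivial) _).update (by trivial) _) (by simpa using e₂)
    (s.2.le.trans h.states_le) (by simp) (q.2.le.trans h.props_le)
    (by simpa [h'.bin] using e₁ .bin) (by simpa [h'.succLeft] using e₁ .succLeft) _

/-! #### Constraints -/

def writeRel : Option Token → Prog Stack
  | some .lt => write₁ .pos (writeSub (emit .rhs) (emit .lhs))
  | some .gt => write₁ .pos (writeSub (emit .lhs) (emit .rhs))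
  | some .le => write₁ .nonneg (writeSub (emit .rhs) (emit .lhs))
  | some .ge => write₁ .nonneg (writeSub (emit .lhs) (emit .rhs))
  -- Among codes of relations, only `eq` is left for the default case.
  | _ => writeEq (emit .lhs) (emit .rhs)

def copyConstraint : Prog Stack :=
  .cases .inp fun o => readInto isSemi .lhs ;; readInto isSemi .rhs ;; .push .out .and ;;
    writeRel o ;; clear .lhs ;; clear .rhs

def constraintCost (N : ℕ) : ℕ := 32 * N + 2 * negOneCost + 30

theorem trans_copyConstraint (h : ρ .tmp = []) (h₁ : ρ .lhs = []) (h₂ : ρ .rhs = [])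
    (c : Constraint (PolyExpr (Fin p))) (hN : (encConstraint Fin.val c).length ≤ N) :
    Trans copyConstraint ρ ρ (encConstraint Fin.val c) (encConj [constraintFormula c])
      (constraintCost N) := by
  obtain ⟨A, rel, B⟩ := c
  have hA : (encExpr Fin.val A).length ≤ N := by
    simp [encConstraint] at hN; omega
  have hB : (encExpr Fin.val B).length ≤ N := by
    simp [encConstraint] at hN; omega
  set ρ' := update (update ρ .lhs (encExpr Fin.val A)) .rhs (encExpr Fin.val B) with hρ'
  have eA : WritesExpr (emit .lhs) ρ' (A.rename Fin.val) (5 * N + 3) :=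
    WritesExpr.register (by simp) A hA (by simpa [hρ'] using h) (by simp [hρ'])
  have eB : WritesExpr (emit .rhs) ρ' (B.rename Fin.val) (5 * N + 3) :=
    WritesExpr.register (by simp) B hB (by simpa [hρ'] using h) (by simp [hρ'])
  have hR : WritesFormula (writeRel (some (encRel rel))) ρ' (constraintFormula ⟨A, rel, B⟩)
      (2 * (5 * N + 3) + 2 * (5 * N + 3) + 2 * negOneCost + 3) := by
    rcases rel with (_ | _ | _ | _) | _
    · exact (WritesFormula.gt eB eA).mono (by omega)
    · exact (WritesFormula.gt eA eB).mono (by omega)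
    · exact (WritesFormula.ge eB eA).mono (by omega)
    · exact (WritesFormula.ge eA eB).mono (by omega)
    · exact WritesFormula.eq eA eB
  have := (trans_readExpr (ρ := ρ) (r := .lhs) (by simp) A hA h h₁).seqR
    ((trans_readExpr (by simp) B hB (by simpa using h) (by simpa using h₂)).seqR
    ((Trans.write (t := .and)).seqE (hR.seqE ((Trans.clear (r := .lhs)).seqS
      (Trans.clear (r := .rhs))))))
  refine (Trans.read this).congr ?_ (fun k => ?_) (by simp [encConstraint]) (by simp [encConj])
  · simp [hρ', constraintCost]; omega
  · by_cases hk : k = .rhs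
    · subst hk; simp [h₂]
    · by_cases hk' : k = .lhs
      · subst hk'; simp [h₁]
      · simp [hρ', hk, hk']

/-- The loop itself consumes the `item` in front of each constraint and stops at the `endmark` that
closes the list. -/
def copyConstraints : Prog Stack := .loop .inp isEndmark fun _ => copyConstraint

theorem trans_copyConstraints (h : ρ .tmp = []) (h₁ : ρ .lhs = []) (h₂ : ρ .rhs = [])
    (cs : List (Constraint (PolyExpr (Fin p))))
    (hN : (encList (encConstraint Fin.val) cs).length ≤ N) :
    Trans copyConstraints ρ ρ (encList (encConstraint Fin.val) cs)
      (encConj (cs.map constraintFormula)) (N * (constraintCost N + 1)) := by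
  have key : Trans copyConstraints ρ ρ (encList (encConstraint Fin.val) cs)
      (encConj (cs.map constraintFormula)) (cs.length * (constraintCost N + 1) + 1) ∧
      -- The `item` tokens and the final `endmark` alone make the code longer than the number of
      -- rounds.
      cs.length + 1 ≤ (encList (encConstraint Fin.val) cs).length := by
    induction cs with
    | nil => exact ⟨(Trans.read_loop_halt rfl).mono (by simp), by simp [encList]⟩
    | cons c cs ih =>
      simp only [encList, List.length_cons, List.length_append] at hN
      obtain ⟨ih₁, ih₂⟩ := ih (by omega)
      refine ⟨?_, by simp only [encList, List.length_cons, List.length_append]; omega⟩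
      refine (Trans.read_loop_next rfl
        (trans_copyConstraint (N := N) h h₁ h₂ c (by omega)) ih₁).congr ?_
        (fun _ => rfl) rfl ?_
      · rw [List.length_cons, Nat.succ_mul]; omega
      · simp [encConj]
  refine key.1.mono ?_
  have h₃ : cs.length + 1 ≤ N := key.2.trans hN
  calc _ ≤ (cs.length + 1) * (constraintCost N + 1) := by rw [Nat.succ_mul]; omega
    _ ≤ _ := Nat.mul_le_mul_right _ h₃

end

end PReach

/-! ### The reduction is computable in polynomial time -/

namespace PReach

open Function Computability

/-! #### Header of the instance -/

def readUnary (r : Reg) : Prog Stack := .loop .inp isEndmark fun _ => .push (.reg r) (.bit false)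

theorem trans_readUnary {r : Reg} {ρ : Reg → List Token} {n N : ℕ} (hn : n ≤ N) (h : ρ r = []) :
    Trans (readUnary r) ρ (update ρ r (ticks n)) (encUnary n) [] (2 * N + 1) := by
  have key : ∀ (n j : ℕ) (ρ : Reg → List Token), ρ r = ticks j →
      Trans (readUnary r) ρ (update ρ r (ticks (n + j))) (encUnary n) [] (2 * n + 1) := by
    intro n
    induction n with
    | zero =>
      intro j ρ h
      refine (Trans.read_loop_halt rfl).congr le_rfl (fun k => ?_) rfl rfl
      simp [← h]
    | succ n ih =>
      intro j ρ h
      refine (Trans.read_loop_next (t := .tick) (halt := isEndmark)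
        (body := fun _ => .push (.reg r) (.bit false)) rfl Trans.push
        (ih (j + 1) _ (by simp [h, ticks_succ]))).congr (by omega) (fun k => ?_) rfl rfl
      simp [show n + 1 + j = n + (j + 1) by omega]
  exact (key n 0 ρ h).mono (by omega)

theorem isEndmark_bits (l : List Bool) : ∀ t ∈ l.map Token.bit, isEndmark t = false := by
  intro t ht
  obtain ⟨b, _, rfl⟩ := List.mem_map.1 ht
  rfl

/-- This discards the memory bound, on which the answer does not depend. In particular its binary
encoding does no harm. -/
def skipNat : Prog Stack := .loop .inp isEndmark fun _ => .skip

theorem trans_skipNat {ρ : Reg → List Token} (n : ℕ) :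
    Trans skipNat ρ ρ (encNat n) [] (2 * (encNat n).length) := by
  rw [encNat]
  induction encodeNat n with
  | nil => exact (Trans.read_loop_halt rfl).mono (by simp)
  | cons b l ih =>
    exact (Trans.read_loop_next (t := .bit b) (halt := isEndmark) (body := fun _ => .skip) rfl
      Trans.skip ih).mono (by simp; omega)

def readToken (r : Reg) : Prog Stack :=
  .cases .inp fun o => match o with
    | none => .skip
    | some t => .push (.reg r) t

theorem trans_readToken {r : Reg} {ρ : Reg → List Token} (t : Token) :
    Trans (readToken r) ρ (update ρ r (t :: ρ r)) [t] [] 2 := Trans.read Trans.push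

/-- Read a number on top of the scratch register. -/
def readNat : Prog Stack := readUntil isEndmark .tmp ;; .push (.reg .tmp) .endmark

theorem trans_readNat {ρ : Reg → List Token} (n : ℕ) :
    Trans readNat ρ (update ρ .tmp ((encNat n).reverse ++ ρ .tmp)) (encNat n) []
      (2 * (encNat n).length) := by
  refine ((trans_readUntil (isEndmark_bits (encodeNat n)) (t := .endmark) rfl).seqR
    Trans.push).congr ?_ (fun k => ?_) ?_ rfl
  · simp [encNat]; omega
  · simp [encNat]
  · simp [encNat]

/-- The sign, numerator and denominator pile up in reverse on the scratch register, so that one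
final `pour` restores their order. -/
def readRat : Prog Stack := readToken .tmp ;; readNat ;; readNat ;; pour .tmp .threshold

theorem trans_readRat {ρ : Reg → List Token} {N : ℕ} (q : ℚ) (hN : (encRat q).length ≤ N)
    (h : ρ .tmp = []) (h' : ρ .threshold = []) :
    Trans readRat ρ (update ρ .threshold (encRat q)) (encRat q) [] (4 * N + 1) := by
  refine ((trans_readToken (.bit (decide (q < 0)))).seqR ((trans_readNat q.num.natAbs).seqR
    ((trans_readNat q.den).seqR (Trans.pour (by simp) rfl rfl)))).congr ?_ (fun k => ?_) ?_ rfl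
  · simp [encRat, h] at hN ⊢; omega
  · by_cases hk : k = .threshold
    · subst hk; simp [encRat, h, h']
    · by_cases hk' : k = .tmp
      · subst hk'; simp [h]
      · simp [hk, hk']
  · simp [encRat]

def readHeader : Prog Stack :=
  readUnary .states ;; readUnary .actions ;; readUnary .params ;; readUnary .props ;;
    readUnary .init ;; skipNat ;; readToken .cmp ;; readRat

/-- The registers after the header, with `R` for the target. -/
def Instance.regs (I : Instance) (R : List Token) : Reg → List Token
  | .states => ticks I.numStates
  | .actions => ticks I.numActions
  | .params => ticks I.numParams
  | .props => ticks I.numProps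
  | .init => ticks I.init
  | .cmp => [encCmp I.cmp]
  | .threshold => encRat I.threshold
  | .target => R
  | _ => []

theorem length_encUnary (n : ℕ) : (encUnary n).length = n + 1 := by simp [encUnary]

/-- The length of the input. -/
def Instance.size (I : Instance) : ℕ := (encInstance I).length

theorem trans_readHeader (I : Instance) :
    Trans readHeader (fun _ => []) (I.regs [])
      (encUnary I.numStates ++ (encUnary I.numActions ++ (encUnary I.numParams ++
        (encUnary I.numProps ++ (encUnary I.init ++ (encNat I.bound ++ ([encCmp I.cmp] ++
          encRat I.threshold))))))) [] (20 * I.size + 20) := by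
  have hN : I.size = (encInstance I).length := rfl
  simp only [encInstance, List.length_append, length_encUnary] at hN
  refine ((trans_readUnary (N := I.size) (by omega) rfl).seqR
    ((trans_readUnary (N := I.size) (by omega) (by simp)).seqR
    ((trans_readUnary (N := I.size) (by omega) (by simp)).seqR
    ((trans_readUnary (N := I.size) (by omega) (by simp)).seqR
    ((trans_readUnary (N := I.size) (by omega) (by simp)).seqR
    ((trans_skipNat _).seqR ((trans_readToken _).seqR
      (trans_readRat (N := I.size) I.threshold (by omega) (by simp) (by simp))))))))).congr ?_
    (fun k => ?_) rfl rfl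
  · omega
  · cases k <;> simp [Instance.regs]

theorem Instance.env (I : Instance) (R : List Token) :
    Env I.size I.numStates I.numActions I.numParams I.numProps (I.regs R) := by
  have hN : I.size = (encInstance I).length := rfl
  simp only [encInstance, List.length_append, length_encUnary] at hN
  exact ⟨rfl, rfl, rfl, rfl, rfl, by omega, by omega, by omega, by omega⟩

theorem Instance.idle (I : Instance) (R : List Token) : Idle (I.regs R) :=
  ⟨rfl, rfl, rfl, rfl, rfl, rfl, rfl, rfl, rfl, rfl⟩

/-- The part of the program that reads everything but the target. -/
def copyTables : Prog Stack :=
  readHeader ;; .push .out .neg ;; forStates (forActions copyRow) ;;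
    forStates (forProps copyLabel) ;; copyConstraints

def tablesCost (N : ℕ) : ℕ :=
  20 * N + 21 + loopCost N (loopCost N (rowCost N)) +
    loopCost N (loopCost N (labelVarCost N + 4)) + N * (constraintCost N + 1)

/-- What `copyTables` reads. -/
def Instance.tables (I : Instance) : List Token :=
  (encUnary I.numStates ++ (encUnary I.numActions ++ (encUnary I.numParams ++
    (encUnary I.numProps ++ (encUnary I.init ++ (encNat I.bound ++ ([encCmp I.cmp] ++
      encRat I.threshold))))))) ++ (encFn (encFn encRow) I.trans ++
    (encFn (encFn fun t => [Token.bit t]) I.label ++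
      encList (encConstraint Fin.val) I.constraints))

theorem encInstance_eq (I : Instance) : encInstance I = I.tables ++ encBoolComb I.target := by
  simp [encInstance, Instance.tables]

theorem trans_copyTables (I : Instance) :
    Trans copyTables (fun _ => []) (I.regs []) I.tables
      ([.neg] ++ (encConj (List.ofFn fun s => (List.ofFn fun a =>
          rowFormulas s a (I.trans s a)).flatten).flatten ++
        (encConj (List.ofFn fun s => (List.ofFn fun q =>
          [labelFormula I.numParams s q (I.label s q)]).flatten).flatten ++
        encConj (I.constraints.map constraintFormula)))) (tablesCost I.size) := by
  have hN : I.size = (encInstance I).length := rfl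
  rw [encInstance_eq] at hN
  simp only [Instance.tables, List.length_append] at hN
  refine ((trans_readHeader I).seqR (Trans.write.seqE
    ((trans_copyRows (I.env []) (I.idle []) I.trans (by omega)).seq
    ((trans_copyLabels (I.env []) (I.idle []) I.label).seq
    (trans_copyConstraints rfl rfl rfl I.constraints (N := I.size) (by omega)))))).congr ?_
    (fun _ => rfl) ?_ ?_
  · simp only [tablesCost]; omega
  · simp [Instance.tables]
  · simp

/-! #### Target, values and threshold -/

/-- The target is the last item and has no end marker, so reading stops only when the input is
exhausted. For this reason its behaviour is stated with `Runs`: `Trans` would have to allow an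
arbitrary continuation of the input. -/
def readTarget : Prog Stack := readUntil (fun _ => false) .tmp ;; pour .tmp .target

theorem runs_readTarget (I : Instance) (w l : List Token) (hl : l.length ≤ I.size) :
    Runs readTarget (store l w (I.regs [])) (store [] w (I.regs l)) (4 * I.size + 2) := by
  have key : ∀ (l : List Token) (ρ : Reg → List Token),
      Runs (readUntil (fun _ => false) .tmp) (store l w ρ)
        (store [] w (update ρ .tmp (l.reverse ++ ρ .tmp))) (2 * l.length + 1) := by
    intro l
    unfold readUntil
    induction l with
    | nil => intro ρ; simpa using Runs.loop_nil rfl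
    | cons t l ih =>
      intro ρ
      have := Runs.loop_next (S := store (t :: l) w ρ) (k := Stack.inp) (halt := fun _ => false)
        (body := fun t => .push (.reg .tmp) t) rfl rfl Runs.push (by
          simpa using ih (update ρ .tmp (t :: ρ .tmp)))
      exact (by simpa using this : Runs (.loop Stack.inp _ _) _ _ _).mono
        (by simp; omega)
  have h₂ := Trans.pour (r := .tmp) (r' := .target) (by simp)
    (ρ := update (I.regs []) .tmp (l.reverse ++ [])) rfl rfl
  have h := ((key l (I.regs [])).seq (h₂ [] w)).mono (b := 4 * I.size + 2)
    (by simp; omega)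
  have e : I.regs l = update (update (update (I.regs []) .tmp (l.reverse ++ [])) .tmp []) .target
      ((update (I.regs []) .tmp (l.reverse ++ []) .tmp).reverse ++
        update (I.regs []) .tmp (l.reverse ++ []) .target) := by
    funext k
    cases k <;> simp [Instance.regs]
  rw [e]
  exact h

def writeThreshold : Prog Stack :=
  .cases (.reg .cmp) fun o =>
    if o = some .lt then write₁ .nonneg (writeSub (writeX .init) (write₁ .const (emit .threshold)))
    else if o = some .gt then
      write₁ .nonneg (writeSub (write₁ .const (emit .threshold)) (writeX .init))
    else if o = some .le then
      write₁ .pos (writeSub (writeX .init) (write₁ .const (emit .threshold)))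
    else write₁ .pos (writeSub (write₁ .const (emit .threshold)) (writeX .init))

theorem trans_writeThreshold (I : Instance) (R : List Token) :
    Trans writeThreshold (I.regs R) (update (I.regs R) .cmp []) []
      (encFormula (thresholdFormula I.numParams I.init I.threshold I.cmp))
      (varCost I.size + 5 * I.size + negOneCost + 6) := by
  have hN : I.size = (encInstance I).length := rfl
  simp only [encInstance, List.length_append, length_encUnary] at hN
  have henv := (I.env R).update (r := .cmp) trivial []
  have hx : WritesExpr (writeX .init) (update (I.regs R) .cmp []) (xVar I.numParams I.init)
      (varCost I.size) := WritesExpr.x henv (by simp) (by simp [Instance.regs]) (by omega)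
  have hd : WritesExpr (write₁ .const (emit .threshold)) (update (I.regs R) .cmp [])
      (.const I.threshold) (5 * I.size + 4) := by
    refine (Trans.write₁ (Trans.emit (by simp) henv.tmp)).congr ?_ (fun _ => rfl) rfl ?_
    · simp [Instance.regs]; omega
    · simp [Instance.regs, encExpr]
  refine (Trans.cases (t := encCmp I.cmp) (l := []) rfl
    (a := varCost I.size + 5 * I.size + negOneCost + 5) ?_).mono (by omega)
  cases I.cmp
  · exact (WritesFormula.ge hx hd).mono (by omega)
  · exact (WritesFormula.ge hd hx).mono (by omega)
  · exact (WritesFormula.gt hx hd).mono (by omega)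
  · exact (WritesFormula.gt hd hx).mono (by omega)

/-- In a halting configuration only the output stack may be non-empty. The register `cmp` is missing
because `writeThreshold` has already popped it. -/
def cleanUp : Prog Stack :=
  clear .states ;; clear .actions ;; clear .params ;; clear .props ;; clear .init ;;
    clear .threshold ;; clear .target

def writeValues : Prog Stack :=
  forStates (.push .out .and ;; write₁ .nonneg (writeX .state) ;; .push .out .and ;;
    writeValue) ;; writeThreshold ;; cleanUp

def valuesCost (N : ℕ) : ℕ :=
  loopCost N (varCost N + valueCost N + 3) + varCost N + negOneCost + 25 * N + 20

theorem trans_writeValues (I : Instance) :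
    Trans writeValues (I.regs (encBoolComb I.target)) (fun _ => []) []
      (encConj (List.ofFn fun s : Fin I.numStates => [.nonneg (xVar I.numParams s),
        valueFormula I.numStates I.numActions I.numParams s I.target]).flatten ++
      encFormula (thresholdFormula I.numParams I.init I.threshold I.cmp)) (valuesCost I.size) := by
  have hN : I.size = (encInstance I).length := rfl
  simp only [encInstance, List.length_append, length_encUnary] at hN
  have hidle := I.idle (encBoolComb I.target)
  have hloop := Trans.mono (trans_forStates (I.env (encBoolComb I.target)) (u := fun _ => [])
    (o := fun s => encConj [.nonneg (xVar I.numParams s),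
      valueFormula I.numStates I.numActions I.numParams s I.target])
    (B := varCost I.size + valueCost I.size + 3)
    (body := .push .out .and ;; write₁ .nonneg (writeX .state) ;; .push .out .and ;; writeValue)
    rfl rfl fun s ρ e e₁ e₂ => by
      have hs : (s : ℕ) ≤ I.size := s.2.le.trans e.states_le
      refine (Trans.write.seqE ((WritesFormula.nonneg (WritesExpr.x e (by simp) e₂ hs)).seqE
        (Trans.write.seqE (WritesFormula.value e e₂ hs (by simpa [hidle.lhs] using e₁ .lhs)
          (e₁ .target (by simp) (by simp)) (by omega) (by simpa [hidle.action] using e₁ .action)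
          (by simpa [hidle.actionLeft] using e₁ .actionLeft)
          (by simpa [hidle.succ] using e₁ .succ)
          (by simpa [hidle.succLeft] using e₁ .succLeft))))).congr (by omega) (fun _ => rfl) rfl ?_
      simp [encConj]) le_rfl
  refine (hloop.seq ((trans_writeThreshold I _).seqE ((Trans.clear (r := .states)).seqS
    ((Trans.clear (r := .actions)).seqS ((Trans.clear (r := .params)).seqS
    ((Trans.clear (r := .props)).seqS ((Trans.clear (r := .init)).seqS
    ((Trans.clear (r := .threshold)).seqS (Trans.clear (r := .target)))))))))).congr ?_
    (fun k => ?_) (by simp) ?_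
  · simp [Instance.regs, valuesCost]; omega
  · cases k <;> simp [Instance.regs]
  · simp [encConj_flatten_ofFn]

/-! #### The complete program -/

def moveOutput : Prog Stack := .loop .out (fun _ => false) fun t => .push (.reg .result) t

theorem runs_moveOutput (w : List Token) :
    Runs moveOutput (store [] w fun _ => []) (update (fun _ => []) (.reg .result) w.reverse)
      (2 * w.length + 1) := by
  have key : ∀ (w : List Token) (ρ : Reg → List Token),
      Runs (.loop .out (fun _ => false) fun t => .push (.reg .result) t) (store [] w ρ)
        (store [] [] (update ρ .result (w.reverse ++ ρ .result)))
        (2 * w.length + 1) := by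
    intro w
    induction w with
    | nil => intro ρ; simpa using Runs.loop_nil rfl
    | cons t w ih =>
      intro ρ
      have := Runs.loop_next (S := store [] (t :: w) ρ) (k := Stack.out) (halt := fun _ => false)
        (body := fun t => .push (.reg .result) t) rfl rfl Runs.push (by
          simpa using ih (update ρ .result (t :: ρ .result)))
      exact (by simpa using this : Runs (.loop Stack.out _ _) _ _ _).mono (by simp; omega)
  have h := key w fun _ => []
  have : store [] [] (fun _ => []) = fun _ => [] := by funext k; cases k <;> rfl
  rw [← this, update_store_reg]
  simp only [List.append_nil] at h
  exact h

/-- Each step pushes at most one symbol. Applied to the output stack, this bounds the length of the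
formula by the time spent writing it. -/
theorem Runs.length_le {K : Type} [DecidableEq K] {p : Prog K} {S S' : K → List Token} {n : ℕ}
    (h : Runs p S S' n) (k : K) : (S' k).length ≤ (S k).length + n := by
  have upd : ∀ (S : K → List Token) (k' : K) (l : List Token), l.length ≤ (S k').length →
      (update S k' l k).length ≤ (S k).length := by
    intro S k' l hl
    by_cases hk : k = k'
    · subst hk; simpa using hl
    · simp [hk]
  induction h with
  | skip => omega
  | @push S k' t =>
    by_cases hk : k = k'
    · subst hk; simp
    · simp [hk]
  | seq _ _ ih₁ ih₂ => omega
  | @cases k' f S S' a _ ih =>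
    have := upd S k' (S k').tail (by simp)
    omega
  | loop_nil _ => omega
  | @loop_halt k' _ _ S t r hS _ =>
    have := upd S k' r (by simp [hS])
    omega
  | @loop_next k' _ _ S _ _ t r _ _ hS _ _ _ ih₁ ih₂ =>
    have := upd S k' r (by simp [hS])
    omega
  | mono _ hab ih => omega

def reduction : Prog Stack := (copyTables ;; readTarget ;; writeValues) ;; moveOutput

def reductionCost (N : ℕ) : ℕ := 3 * (tablesCost N + 4 * N + valuesCost N) + 10

theorem runs_reduction (I : Instance) :
    Runs reduction (update (fun _ => []) .inp (encInstance I))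
      (update (fun _ => []) (.reg .result) (encFormula I.formula)) (reductionCost I.size) := by
  have hN : I.size = (encInstance I).length := rfl
  have hin : update (fun _ => []) Stack.inp (encInstance I) =
      store (I.tables ++ encBoolComb I.target) [] fun _ => [] := by
    have : store [] [] (fun _ => []) = fun _ => [] := by funext k; cases k <;> rfl
    rw [← this, update_store_inp, encInstance_eq]
  have h₁ := trans_copyTables I (encBoolComb I.target) []
  have h₃ := fun w => trans_writeValues I [] w
  have h₂ := fun w => runs_readTarget I w (encBoolComb I.target) (by
    rw [hN, encInstance_eq, List.length_append]; omega)
  obtain ⟨w, hw, h⟩ : ∃ w, w.reverse = encFormula I.formula ∧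
      Runs (copyTables ;; readTarget ;; writeValues)
        (store (I.tables ++ encBoolComb I.target) [] fun _ => []) (store [] w fun _ => [])
        (tablesCost I.size + (4 * I.size + 2 + valuesCost I.size)) := by
    refine ⟨_, ?_, h₁.seq ((h₂ _).seq (h₃ _))⟩
    simp only [List.append_nil, List.reverse_append, List.reverse_reverse, Instance.formula,
      encFormula, encFormula_conj, encConj_append]
    simp
  have hlen := h.length_le .out
  rw [hin, ← hw]
  -- Moving the output takes two steps per symbol, and there are at most as many symbols as steps so
  -- far; hence the factor 3 in `reductionCost`.
  refine (h.seq (runs_moveOutput w)).mono ?_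
  simp only [store_out, List.length_nil] at hlen
  simp only [reductionCost]
  omega

/-! ### The time bounds are polynomials. -/

/-- Functions that are given by polynomials. -/
def IsPoly (f : ℕ → ℕ) : Prop := ∃ P : Polynomial ℕ, ∀ n, P.eval n = f n

theorem IsPoly.const (c : ℕ) : IsPoly fun _ => c := ⟨Polynomial.C c, by simp⟩

theorem IsPoly.id : IsPoly fun n => n := ⟨Polynomial.X, by simp⟩

theorem IsPoly.add {f g : ℕ → ℕ} (hf : IsPoly f) (hg : IsPoly g) : IsPoly fun n => f n + g n := by
  obtain ⟨P, hP⟩ := hf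
  obtain ⟨Q, hQ⟩ := hg
  exact ⟨P + Q, by simp [hP, hQ]⟩

theorem IsPoly.mul {f g : ℕ → ℕ} (hf : IsPoly f) (hg : IsPoly g) : IsPoly fun n => f n * g n := by
  obtain ⟨P, hP⟩ := hf
  obtain ⟨Q, hQ⟩ := hg
  exact ⟨P * Q, by simp [hP, hQ]⟩

theorem IsPoly.const_mul {f : ℕ → ℕ} (c : ℕ) (hf : IsPoly f) : IsPoly fun n => c * f n :=
  (IsPoly.const c).mul hf

theorem IsPoly.add_const {f : ℕ → ℕ} (hf : IsPoly f) (c : ℕ) : IsPoly fun n => f n + c :=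
  hf.add (IsPoly.const c)

theorem IsPoly.loopCost {f : ℕ → ℕ} (hf : IsPoly f) : IsPoly fun n => loopCost n (f n) :=
  (IsPoly.id.mul (hf.add_const 9)).add_const 5

theorem IsPoly.sumCost {f : ℕ → ℕ} (hf : IsPoly f) : IsPoly fun n => sumCost n (f n) :=
  ((hf.add_const 1).loopCost.add_const _).add_const 2

theorem isPoly_varCost : IsPoly varCost := (IsPoly.id.const_mul 20).add_const 100

theorem isPoly_entryCost : IsPoly entryCost :=
  (((IsPoly.id.const_mul 16).add (isPoly_varCost.const_mul 3)).add_const _).add_const 20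

theorem isPoly_rowCost : IsPoly rowCost :=
  ((((isPoly_varCost.add isPoly_entryCost.loopCost).add
    (isPoly_varCost.sumCost.const_mul 2)).add_const _).add_const _).add_const 20

theorem isPoly_labelVarCost : IsPoly labelVarCost :=
  ((IsPoly.id.mul ((IsPoly.id.const_mul 4).add_const 4)).add (IsPoly.id.const_mul 22)).add_const 40

theorem isPoly_constraintCost : IsPoly constraintCost :=
  ((IsPoly.id.const_mul 32).add_const _).add_const 30

theorem isPoly_tablesCost : IsPoly tablesCost :=
  ((((IsPoly.id.const_mul 20).add_const 21).add isPoly_rowCost.loopCost.loopCost).add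
    (isPoly_labelVarCost.add_const 4).loopCost.loopCost).add
    (IsPoly.id.mul (isPoly_constraintCost.add_const 1))

theorem isPoly_actionCost : IsPoly actionCost :=
  ((((isPoly_varCost.const_mul 4).add
    (((isPoly_varCost.const_mul 2).add_const 1).sumCost.const_mul 2)).add_const _).add
    (((isPoly_varCost.const_mul 4).add_const _).add_const 4).sumCost).add_const 10

theorem isPoly_targetCost : IsPoly targetCost :=
  (IsPoly.id.mul ((IsPoly.id.const_mul 10).add_const 40)).add_const 2

theorem isPoly_valueCost : IsPoly valueCost :=
  (((((isPoly_targetCost.const_mul 2).add (isPoly_varCost.const_mul 2)).add_const _).add_const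
    _).add isPoly_actionCost.sumCost).add_const 20

theorem isPoly_valuesCost : IsPoly valuesCost :=
  (((((isPoly_varCost.add isPoly_valueCost).add_const 3).loopCost.add isPoly_varCost).add_const
    _).add (IsPoly.id.const_mul 25)).add_const 20

theorem isPoly_reductionCost : IsPoly reductionCost :=
  (((isPoly_tablesCost.add (IsPoly.id.const_mul 4)).add isPoly_valuesCost).const_mul 3).add_const 10

theorem computableInPolyTime_formula :
    Nonempty (Turing.TM2ComputableInPolyTime encInstance encFormula Instance.formula) := by
  obtain ⟨P, hP⟩ := isPoly_reductionCost
  exact reduction.computableInPolyTime .inp (.reg .result) P fun I => by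
    rw [hP]
    exact runs_reduction I

end PReach

/-! ### Hitting probabilities of Markov chains -/

namespace PReach

open MeasureTheory ProbabilityTheory Filter Topology
open scoped ENNReal

section Chain

variable {X : Type} [MeasurableSpace X] [DiscreteMeasurableSpace X]

open Classical in
/-- The probability of visiting `T` within `n` steps. -/
noncomputable def hitWithin (κ : Kernel X X) (T : Set X) : ℕ → X → ℝ≥0∞
  | 0, x => if x ∈ T then 1 else 0
  | n + 1, x => if x ∈ T then 1 else ∫⁻ y, hitWithin κ T n y ∂κ x

/-- The law of the Markov chain with initial distribution `μ₀` and transition kernel `κ`. -/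
noncomputable abbrev chainLaw (μ₀ : Measure X) (κ : Kernel X X) [IsMarkovKernel κ] :
    Measure (ℕ → X) :=
  Kernel.trajMeasure (X := fun _ => X) μ₀ fun n => κ.comap
    (fun h : (i : Finset.Iic n) → X => h ⟨n, Finset.mem_Iic.2 le_rfl⟩) (measurable_pi_apply _)

theorem map_zero_chainLaw {X : Type} [MeasurableSpace X] (μ₀ : Measure X) (κ : Kernel X X)
    [IsMarkovKernel κ] : (chainLaw μ₀ κ).map (fun ω => ω 0) = μ₀ := by
  have h : (fun ω : ℕ → X => ω 0) =
      (fun h : (i : Finset.Iic 0) → X => h ⟨0, Finset.mem_Iic.2 le_rfl⟩) ∘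
        Preorder.frestrictLe (π := fun _ => X) 0 := rfl
  have hm : Measurable fun h : (i : Finset.Iic 0) → X => h ⟨0, Finset.mem_Iic.2 le_rfl⟩ :=
    measurable_pi_apply _
  rw [h, ← Measure.map_map hm (Preorder.measurable_frestrictLe 0), chainLaw,
    Kernel.trajMeasure, Measure.map_comp _ _ (Preorder.measurable_frestrictLe 0),
    Kernel.traj_map_frestrictLe, Kernel.partialTraj_self, Measure.id_comp,
    Measure.map_map hm (by fun_prop)]
  exact Measure.map_id

variable (μ₀ : Measure X) [IsProbabilityMeasure μ₀] (κ : Kernel X X) [IsMarkovKernel κ]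

/-- The Markov property. -/
theorem lintegral_chainLaw_succ (j : ℕ) {g : (Finset.Iic j → X) → ℝ≥0∞} (hg : Measurable g)
    (f : X → ℝ≥0∞) :
    ∫⁻ ω, g (Preorder.frestrictLe (π := fun _ => X) j ω) * f (ω (j + 1)) ∂chainLaw μ₀ κ =
      ∫⁻ ω, g (Preorder.frestrictLe (π := fun _ => X) j ω) * ∫⁻ y, f y ∂κ (ω j)
        ∂chainLaw μ₀ κ := by
  have hf : Measurable f := Measurable.of_discrete
  have hm : Measurable fun p : (Finset.Iic j → X) × X => g p.1 * f p.2 := by fun_prop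
  -- The joint law of the past up to `j` and the next position is the law of the past composed with
  -- the step kernel; the next position can then be integrated out first.
  have key := Kernel.map_frestrictLe_trajMeasure_compProd_eq_map_trajMeasure (X := fun _ => X)
    (μ₀ := μ₀) (κ := fun n => κ.comap
      (fun h : (i : Finset.Iic n) → X => h ⟨n, Finset.mem_Iic.2 le_rfl⟩) (measurable_pi_apply _))
    (a := j)
  have h₁ := lintegral_map (μ := chainLaw μ₀ κ) hm
    (g := fun ω => (Preorder.frestrictLe (π := fun _ => X) j ω, ω (j + 1))) (by fun_prop)
  rw [← h₁]
  erw [← key]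
  rw [Measure.lintegral_compProd hm, lintegral_map (by fun_prop) (by fun_prop)]
  refine lintegral_congr fun ω => ?_
  simp only [Kernel.comap_apply]
  rw [lintegral_const_mul _ hf]
  rfl

/-- The recursion for `hitWithin` looks forward from the start, whereas the Markov property shifts
the present. Hence the induction on the horizon `m` runs over all times `j` at once, restricted to
paths that have avoided `T` before `j`. -/
theorem lintegral_indicator_hitWithin (T : Set X) (m j : ℕ) :
    ∫⁻ ω, {ω : ℕ → X | ∀ i < j, ω i ∉ T}.indicator (fun ω => hitWithin κ T m (ω j)) ω
        ∂chainLaw μ₀ κ =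
      chainLaw μ₀ κ {ω | (∀ i < j, ω i ∉ T) ∧ ∃ i, j ≤ i ∧ i ≤ j + m ∧ ω i ∈ T} := by
  classical
  have hT : MeasurableSet T := MeasurableSet.of_discrete
  have hev : ∀ i, MeasurableSet {ω : ℕ → X | ω i ∈ T} := fun i => measurable_pi_apply i hT
  have hA : ∀ j, MeasurableSet {ω : ℕ → X | ∀ i < j, ω i ∉ T} := by
    intro j
    simp only [Set.ofPred_forall]
    exact MeasurableSet.iInter fun i => MeasurableSet.iInter fun _ => (hev i).compl
  induction m generalizing j with
  | zero =>
    rw [← lintegral_indicator_one ((hA j).inter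
      (MeasurableSet.iUnion fun i =>
        MeasurableSet.iUnion fun _ : j ≤ i ∧ i ≤ j + 0 => hev i) |>.congr
          (by ext ω; simp [and_assoc]))]
    refine lintegral_congr fun ω => ?_
    by_cases h : ∀ i < j, ω i ∉ T
    · by_cases h' : ω j ∈ T
      · rw [Set.indicator_of_mem (by exact h), Set.indicator_of_mem
          (by exact ⟨h, j, le_rfl, le_rfl, h'⟩)]
        simp [hitWithin, h']
      · rw [Set.indicator_of_mem (by exact h), Set.indicator_of_notMem]
        · simp [hitWithin, h']
        · rintro ⟨_, i, h₁, h₂, h₃⟩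
          obtain rfl : i = j := by omega
          exact h' h₃
    · rw [Set.indicator_of_notMem (by exact h), Set.indicator_of_notMem (fun h' => h h'.1)]
  | succ m ih =>
    have hB : MeasurableSet {h : Finset.Iic j → X | ∀ i, h i ∉ T} := by
      simp only [Set.ofPred_forall]
      exact MeasurableSet.iInter fun i => (measurable_pi_apply i hT).compl
    -- The integrand is split according to whether `T` is first visited at time `j` or is still
    -- avoided then. The second part is a function of the past times a one-step average, ready for
    -- the Markov property.
    have e₁ : ∀ ω : ℕ → X, {ω : ℕ → X | ∀ i < j, ω i ∉ T}.indicator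
        (fun ω => hitWithin κ T (m + 1) (ω j)) ω =
        ({ω : ℕ → X | ∀ i < j, ω i ∉ T} ∩ {ω | ω j ∈ T}).indicator 1 ω +
          {h : Finset.Iic j → X | ∀ i, h i ∉ T}.indicator 1
            (Preorder.frestrictLe (π := fun _ => X) j ω) * ∫⁻ y, hitWithin κ T m y ∂κ (ω j) := by
      intro ω
      have hiff : (Preorder.frestrictLe (π := fun _ => X) j ω ∈
          {h : Finset.Iic j → X | ∀ i, h i ∉ T}) ↔ ∀ i ≤ j, ω i ∉ T :=
        ⟨fun h i hi => h ⟨i, Finset.mem_Iic.2 hi⟩, fun h i => h i (Finset.mem_Iic.1 i.2)⟩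
      by_cases h : ∀ i < j, ω i ∉ T
      · by_cases h' : ω j ∈ T
        · rw [Set.indicator_of_mem (by exact h), Set.indicator_of_mem (by exact ⟨h, h'⟩),
            Set.indicator_of_notMem (fun hh => (hiff.1 hh) j le_rfl h')]
          simp [hitWithin, h']
        · rw [Set.indicator_of_mem (by exact h), Set.indicator_of_notMem (fun hh => h' hh.2),
            Set.indicator_of_mem (hiff.2 fun i hi => (Nat.lt_or_eq_of_le hi).elim (h i)
              fun hij => hij ▸ h')]
          simp [hitWithin, h']
      · rw [Set.indicator_of_notMem (by exact h), Set.indicator_of_notMem (fun hh => h hh.1),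
          Set.indicator_of_notMem (fun hh => h fun i hi => hiff.1 hh i hi.le)]
        simp
    have e₂ : ∀ ω : ℕ → X, {h : Finset.Iic j → X | ∀ i, h i ∉ T}.indicator 1
            (Preorder.frestrictLe (π := fun _ => X) j ω) * hitWithin κ T m (ω (j + 1)) =
          {ω : ℕ → X | ∀ i < j + 1, ω i ∉ T}.indicator
            (fun ω => hitWithin κ T m (ω (j + 1))) ω := by
      intro ω
      by_cases h : ∀ i < j + 1, ω i ∉ T
      · rw [Set.indicator_of_mem
          (by exact fun i => h i (Nat.lt_succ_of_le (Finset.mem_Iic.1 i.2))),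
          Set.indicator_of_mem (by exact h)]
        simp
      · have h' : Preorder.frestrictLe (π := fun _ => X) j ω ∉
            {h : Finset.Iic j → X | ∀ i, h i ∉ T} :=
          fun hh => h fun i hi => hh ⟨i, Finset.mem_Iic.2 (Nat.lt_succ_iff.1 hi)⟩
        rw [Set.indicator_of_notMem h', zero_mul, Set.indicator_of_notMem (by exact h)]
    have hC : MeasurableSet ({ω : ℕ → X | ∀ i < j, ω i ∉ T} ∩ {ω | ω j ∈ T}) := (hA j).inter (hev j)
    rw [lintegral_congr e₁, lintegral_add_left (measurable_one.indicator hC),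
      ← lintegral_chainLaw_succ μ₀ κ j (measurable_one.indicator hB), lintegral_congr e₂, ih,
      lintegral_indicator_one hC, ← measure_union' _ hC]
    · congr 1
      ext ω
      simp only [Set.mem_union, Set.mem_inter_iff, Set.mem_ofPred_eq]
      constructor
      · rintro (⟨h, h'⟩ | ⟨h, i, h₁, h₂, h₃⟩)
        · exact ⟨h, j, le_rfl, by omega, h'⟩
        · exact ⟨fun i hi => h i (by omega), i, by omega, by omega, h₃⟩
      · rintro ⟨h, i, h₁, h₂, h₃⟩
        by_cases h' : ω j ∈ T
        · exact Or.inl ⟨h, h'⟩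
        · refine Or.inr ⟨fun i hi => (Nat.lt_or_eq_of_le (Nat.lt_succ_iff.1 hi)).elim (h i)
            fun hij => hij ▸ h', i, ?_, by omega, h₃⟩
          rcases Nat.lt_or_eq_of_le h₁ with h₁ | rfl
          · exact h₁
          · exact absurd h₃ h'
    · rw [Set.disjoint_left]
      rintro ω ⟨_, h⟩ ⟨h', _⟩
      exact h' j (by omega) h

theorem chainLaw_exists_le (T : Set X) (n : ℕ) :
    chainLaw μ₀ κ {ω | ∃ i ≤ n, ω i ∈ T} = ∫⁻ x, hitWithin κ T n x ∂μ₀ := by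
  have h := lintegral_indicator_hitWithin μ₀ κ T n 0
  simp only [not_lt_zero, IsEmpty.forall_iff, implies_true, Set.ofPred_true, Set.indicator_univ,
    zero_le, zero_add, true_and] at h
  rw [← h]
  conv_rhs => rw [← map_zero_chainLaw μ₀ κ]
  rw [lintegral_map Measurable.of_discrete (measurable_pi_apply 0)]

end Chain

end PReach

/-! ### Reachability probabilities of schedulers -/

namespace PReach

open MeasureTheory ProbabilityTheory Filter Topology
open scoped ENNReal

section Average

variable {α β : Type} [Fintype α] [Fintype β]

/-- The mean of `f` under the distribution `p`. -/
noncomputable def avg (p : PMF α) (f : α → ℝ) : ℝ := ∑ a, (p a).toReal * f a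

theorem avg_mono (p : PMF α) {f g : α → ℝ} (h : ∀ a, f a ≤ g a) : avg p f ≤ avg p g :=
  Finset.sum_le_sum fun a _ => mul_le_mul_of_nonneg_left (h a) ENNReal.toReal_nonneg

theorem sum_toReal (p : PMF α) : ∑ a, (p a).toReal = 1 := by
  have h := p.tsum_coe
  rw [tsum_fintype] at h
  rw [← ENNReal.toReal_sum fun a _ => p.apply_ne_top a, h, ENNReal.toReal_one]

theorem avg_const (p : PMF α) (c : ℝ) : avg p (fun _ => c) = c := by
  rw [avg, ← Finset.sum_mul, sum_toReal, one_mul]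

theorem avg_nonneg (p : PMF α) {f : α → ℝ} (h : ∀ a, 0 ≤ f a) : 0 ≤ avg p f :=
  (avg_const p 0).symm.trans_le (avg_mono p h)

theorem avg_sub (p : PMF α) (f g : α → ℝ) : avg p (fun a => f a - g a) = avg p f - avg p g := by
  simp only [avg, mul_sub, Finset.sum_sub_distrib]

theorem avg_const_mul (p : PMF α) (c : ℝ) (f : α → ℝ) :
    avg p (fun a => c * f a) = c * avg p f := by
  simp only [avg, Finset.mul_sum, mul_left_comm]

theorem avg_pure (a : α) (f : α → ℝ) : avg (PMF.pure a) f = f a := by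
  classical
  rw [avg, Finset.sum_eq_single a]
  · simp
  · intro b _ hb; simp [PMF.pure_apply, hb]
  · simp

theorem avg_bind (p : PMF α) (k : α → PMF β) (f : β → ℝ) :
    avg (p.bind k) f = avg p fun a => avg (k a) f := by
  simp only [avg, PMF.bind_apply, tsum_fintype, Finset.mul_sum]
  rw [Finset.sum_comm]
  refine Finset.sum_congr rfl fun b _ => ?_
  rw [ENNReal.toReal_sum fun a _ => ENNReal.mul_ne_top (p.apply_ne_top a) ((k a).apply_ne_top b),
    Finset.sum_mul]
  simp only [ENNReal.toReal_mul, mul_assoc]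

theorem avg_map (p : PMF α) (g : α → β) (f : β → ℝ) : avg (p.map g) f = avg p (f ∘ g) := by
  rw [PMF.map, avg_bind]
  simp only [Function.comp_apply, avg_pure]
  rfl

theorem tendsto_avg (p : PMF α) {f : ℕ → α → ℝ} {g : α → ℝ}
    (h : ∀ a, Tendsto (fun n => f n a) atTop (𝓝 (g a))) :
    Tendsto (fun n => avg p (f n)) atTop (𝓝 (avg p g)) :=
  tendsto_finsetSum _ fun a _ => (h a).const_mul _

theorem lintegral_ofReal_eq_avg [MeasurableSpace α] [MeasurableSingletonClass α] (p : PMF α)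
    {f : α → ℝ} (h : ∀ a, 0 ≤ f a) :
    ∫⁻ a, ENNReal.ofReal (f a) ∂p.toMeasure = ENNReal.ofReal (avg p f) := by
  rw [lintegral_fintype, avg,
    ENNReal.ofReal_sum_of_nonneg fun a _ => mul_nonneg ENNReal.toReal_nonneg (h a)]
  refine Finset.sum_congr rfl fun a _ => ?_
  rw [PMF.toMeasure_apply_singleton _ _ (measurableSet_singleton a),
    ENNReal.ofReal_mul ENNReal.toReal_nonneg, ENNReal.ofReal_toReal (p.apply_ne_top a), mul_comm]

/-- At a maximum of `f`, averaging forces all points of positive probability to be maxima. -/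
theorem eq_of_le_avg (p : PMF α) {f : α → ℝ} {c : ℝ} (hf : ∀ a, f a ≤ c) (hc : c ≤ avg p f) {a : α}
    (ha : 0 < (p a).toReal) : f a = c := by
  have h : avg p (fun a => c - f a) ≤ 0 := by
    rw [avg_sub, avg_const]; linarith
  have h' := (Finset.single_le_sum (f := fun a => (p a).toReal * (c - f a))
    (fun a _ => mul_nonneg ENNReal.toReal_nonneg (sub_nonneg.2 (hf a))) (Finset.mem_univ a)).trans h
  by_contra hne
  have := mul_pos ha (sub_pos.2 (lt_of_le_of_ne (hf a) hne))
  linarith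

end Average

namespace Scheduler

variable {S A P : Type} [Fintype S] {M : MDP S A P} {b : ℕ} (σ : Scheduler M b) (R : BoolComb P)

theorem avg_step (x : S × Fin b) (f : S × Fin b → ℝ) :
    avg (σ.step x) f = avg (σ.act x.2 x.1) fun a => avg (M.trans x.1 a) fun s' =>
      avg (σ.update x.2 x.1) fun q' => f (s', q') := by
  simp only [step, avg_bind, avg_map]
  rfl

open Classical in
/-- The probability of visiting the target within `n` steps, from a state and a mode. -/
noncomputable def hit : ℕ → S × Fin b → ℝ
  | 0, x => if R.Holds (M.label x.1) then 1 else 0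
  | n + 1, x => if R.Holds (M.label x.1) then 1 else avg (σ.step x) (hit n)

theorem hit_of_holds (n : ℕ) {x : S × Fin b} (h : R.Holds (M.label x.1)) : σ.hit R n x = 1 := by
  cases n <;> simp [hit, h]

theorem hit_zero_of_not {x : S × Fin b} (h : ¬ R.Holds (M.label x.1)) : σ.hit R 0 x = 0 := by
  simp [hit, h]

theorem hit_succ_of_not (n : ℕ) {x : S × Fin b} (h : ¬ R.Holds (M.label x.1)) :
    σ.hit R (n + 1) x = avg (σ.step x) (σ.hit R n) := by
  simp [hit, h]

theorem hit_nonneg (n : ℕ) (x : S × Fin b) : 0 ≤ σ.hit R n x := by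
  by_cases h : R.Holds (M.label x.1)
  · rw [σ.hit_of_holds R n h]; exact zero_le_one
  · induction n generalizing x with
    | zero => rw [σ.hit_zero_of_not R h]
    | succ n ih =>
      rw [σ.hit_succ_of_not R n h]
      refine avg_nonneg _ fun y => ?_
      by_cases h' : R.Holds (M.label y.1)
      · rw [σ.hit_of_holds R n h']; exact zero_le_one
      · exact ih y h'

/-- A function that dominates one step of the chain dominates the hitting probabilities. -/
theorem hit_le {g : S × Fin b → ℝ} (h₀ : ∀ x, 0 ≤ g x)
    (h₁ : ∀ x, R.Holds (M.label x.1) → 1 ≤ g x)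
    (h₂ : ∀ x, ¬ R.Holds (M.label x.1) → avg (σ.step x) g ≤ g x) (n : ℕ) (x : S × Fin b) :
    σ.hit R n x ≤ g x := by
  induction n generalizing x with
  | zero =>
    by_cases h : R.Holds (M.label x.1)
    · rw [σ.hit_of_holds R 0 h]; exact h₁ x h
    · rw [σ.hit_zero_of_not R h]; exact h₀ x
  | succ n ih =>
    by_cases h : R.Holds (M.label x.1)
    · rw [σ.hit_of_holds R _ h]; exact h₁ x h
    · rw [σ.hit_succ_of_not R n h]; exact (avg_mono _ ih).trans (h₂ x h)

theorem hit_le_one (n : ℕ) (x : S × Fin b) : σ.hit R n x ≤ 1 :=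
  σ.hit_le R (fun _ => zero_le_one) (fun _ _ => le_rfl) (fun _ _ => (avg_const _ 1).le) n x

theorem monotone_hit (x : S × Fin b) : Monotone fun n => σ.hit R n x := by
  refine monotone_nat_of_le_succ fun n => ?_
  induction n generalizing x with
  | zero =>
    by_cases h : R.Holds (M.label x.1)
    · rw [σ.hit_of_holds R _ h, σ.hit_of_holds R _ h]
    · rw [σ.hit_zero_of_not R h]; exact σ.hit_nonneg R _ x
  | succ n ih =>
    by_cases h : R.Holds (M.label x.1)
    · rw [σ.hit_of_holds R _ h, σ.hit_of_holds R _ h]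
    · rw [σ.hit_succ_of_not R _ h, σ.hit_succ_of_not R _ h]; exact avg_mono _ ih

/-- The probability of ever visiting the target, from a state and a mode. -/
noncomputable def hitProb (x : S × Fin b) : ℝ := ⨆ n, σ.hit R n x

theorem tendsto_hit (x : S × Fin b) :
    Tendsto (fun n => σ.hit R n x) atTop (𝓝 (σ.hitProb R x)) :=
  tendsto_atTop_ciSup (σ.monotone_hit R x) ⟨1, by rintro _ ⟨n, rfl⟩; exact σ.hit_le_one R n x⟩

theorem hitProb_nonneg (x : S × Fin b) : 0 ≤ σ.hitProb R x :=
  ge_of_tendsto' (σ.tendsto_hit R x) fun n => σ.hit_nonneg R n x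

theorem hitProb_of_holds {x : S × Fin b} (h : R.Holds (M.label x.1)) : σ.hitProb R x = 1 := by
  simp [hitProb, σ.hit_of_holds R _ h]

/-- The recursion for finite horizons passes to the limit because averages are finite sums. -/
theorem hitProb_of_not {x : S × Fin b} (h : ¬ R.Holds (M.label x.1)) :
    σ.hitProb R x = avg (σ.step x) (σ.hitProb R) := by
  have h' := (tendsto_add_atTop_iff_nat 1).2 (σ.tendsto_hit R x)
  simp only [σ.hit_succ_of_not R _ h] at h'
  exact tendsto_nhds_unique h' (tendsto_avg _ (σ.tendsto_hit R))

theorem hitProb_le {g : S × Fin b → ℝ} (h₀ : ∀ x, 0 ≤ g x)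
    (h₁ : ∀ x, R.Holds (M.label x.1) → 1 ≤ g x)
    (h₂ : ∀ x, ¬ R.Holds (M.label x.1) → avg (σ.step x) g ≤ g x) (x : S × Fin b) :
    σ.hitProb R x ≤ g x :=
  le_of_tendsto' (σ.tendsto_hit R x) fun n => σ.hit_le R h₀ h₁ h₂ n x

variable [MeasurableSpace S] [MeasurableSingletonClass S]

theorem hitWithin_stepKernel (n : ℕ) (x : S × Fin b) :
    hitWithin σ.stepKernel {x | R.Holds (M.label x.1)} n x = ENNReal.ofReal (σ.hit R n x) := by
  induction n generalizing x with
  | zero =>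
    by_cases h : R.Holds (M.label x.1) <;> simp [hitWithin, hit, h]
  | succ n ih =>
    by_cases h : R.Holds (M.label x.1)
    · simp [hitWithin, hit, h]
    · simp only [hitWithin, ih]
      rw [if_neg (by exact h), σ.hit_succ_of_not R n h,
        ← lintegral_ofReal_eq_avg _ fun y => σ.hit_nonneg R n y]
      rfl

/-- The event of reaching the target is the increasing union of the events of reaching it within `n`
steps. Continuity of the measure from below and convergence of the finite-horizon recursion compute
the same limit. -/
theorem reachProb_eq (s₀ : S) :
    σ.reachProb s₀ R = avg (σ.start s₀) fun q => σ.hitProb R (s₀, q) := by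
  set T : Set (S × Fin b) := {x | R.Holds (M.label x.1)} with hT
  let E : ℕ → Set (ℕ → S × Fin b) := fun n => {ω | ∃ i ≤ n, ω i ∈ T}
  have hE : ∀ n, σ.chainMeasure s₀ (E n) =
      ENNReal.ofReal (avg (σ.start s₀) fun q => σ.hit R n (s₀, q)) := by
    intro n
    refine (chainLaw_exists_le _ σ.stepKernel T n).trans ?_
    simp only [hT, hitWithin_stepKernel]
    rw [lintegral_ofReal_eq_avg _ (σ.hit_nonneg R n), avg_map]
    rfl
  have hU : ⋃ n, E n = {ω | ∃ k, R.Holds (M.label (ω k).1)} := by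
    ext ω
    simp only [Set.mem_iUnion]
    exact ⟨fun ⟨n, i, _, h⟩ => ⟨i, h⟩, fun ⟨k, h⟩ => ⟨k, k, le_rfl, h⟩⟩
  have hlim : Tendsto (fun n => σ.chainMeasure s₀ (E n)) atTop
      (𝓝 (σ.chainMeasure s₀ (⋃ n, E n))) :=
    tendsto_measure_iUnion_atTop fun m n hmn ω ⟨i, hi, h⟩ => ⟨i, hi.trans hmn, h⟩
  have hlim' : Tendsto (fun n => σ.chainMeasure s₀ (E n)) atTop
      (𝓝 (ENNReal.ofReal (avg (σ.start s₀) fun q => σ.hitProb R (s₀, q)))) := by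
    simp only [hE]
    exact (ENNReal.continuous_ofReal.tendsto _).comp
      (tendsto_avg _ fun q => σ.tendsto_hit R (s₀, q))
  have hm : MeasurableSet {π : ℕ → S | ∃ k, R.Holds (M.label (π k))} := by
    have : {π : ℕ → S | ∃ k, R.Holds (M.label (π k))} =
        ⋃ k, (fun π : ℕ → S => π k) ⁻¹' {s | R.Holds (M.label s)} := by
      ext π; simp
    rw [this]
    exact MeasurableSet.iUnion fun k => measurable_pi_apply k MeasurableSet.of_discrete
  have hpre : σ.playMeasure s₀ {π | ∃ k, R.Holds (M.label (π k))} =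
      σ.chainMeasure s₀ (⋃ n, E n) := by
    rw [playMeasure, Measure.map_apply (by fun_prop) hm, hU]
    rfl
  rw [reachProb, measureReal_def, hpre, tendsto_nhds_unique hlim hlim', ENNReal.toReal_ofReal]
  exact avg_nonneg _ fun q => σ.hitProb_nonneg R _

end Scheduler

end PReach

/-! ### Certificates for reachability probabilities -/

namespace PReach

open Filter Topology

section Certificate

variable {S A P : Type} [Fintype S] (M : MDP S A P) (R : BoolComb P)

/-- `x` is the vector of reachability probabilities under some choice of an action in each state;
the ranks `r` show that the target is approached wherever `x` is positive. -/
def IsCert (x r : S → ℝ) : Prop :=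
  ∀ s, 0 ≤ x s ∧ ((R.Holds (M.label s) ∧ x s = 1) ∨ (¬ R.Holds (M.label s) ∧
    ∃ a : M.legal s, x s = avg (M.trans s a) x ∧
      (¬ 0 < x s ∨ ∃ s', 0 < (M.trans s a s').toReal * x s' ∧ r s' < r s)))

variable {M R}

/-- The certificate names an action in each state; playing it in a single mode realises `x`. The
point is that ranks leave only one solution of the linear equations. -/
theorem IsCert.exists_scheduler {x r : S → ℝ} (h : IsCert M R x r) [MeasurableSpace S]
    [MeasurableSingletonClass S] {b : ℕ} (hb : 0 < b) (s₀ : S) :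
    ∃ σ : Scheduler M b, σ.reachProb s₀ R = x s₀ := by
  have hα : ∀ s, ∃ a : M.legal s, ¬ R.Holds (M.label s) → x s = avg (M.trans s a) x ∧
      (¬ 0 < x s ∨ ∃ s', 0 < (M.trans s a s').toReal * x s' ∧ r s' < r s) := by
    intro s
    rcases (h s).2 with ⟨hs, _⟩ | ⟨_, a, ha⟩
    · exact ⟨⟨_, (M.legal_nonempty s).choose_spec⟩, fun hs' => absurd hs hs'⟩
    · exact ⟨a, fun _ => ha⟩
  choose α hα using hα
  let q₀ : Fin b := ⟨0, hb⟩
  let σ : Scheduler M b := ⟨fun _ => PMF.pure q₀, fun _ s => PMF.pure (α s), fun _ _ => PMF.pure q₀⟩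
  have hstep : ∀ (z : S × Fin b) (f : S × Fin b → ℝ),
      avg (σ.step z) f = avg (M.trans z.1 (α z.1)) fun s' => f (s', q₀) := by
    intro z f
    rw [σ.avg_step]
    simp only [σ, avg_pure]
  let y : S → ℝ := fun s => σ.hitProb R (s, q₀)
  have hy : ∀ s, ¬ R.Holds (M.label s) → y s = avg (M.trans s (α s)) y := fun s hs => by
    simp only [y]
    rw [σ.hitProb_of_not R hs, hstep]
  -- True probabilities form the least solution of the equations of the strategy, and `x` is some
  -- solution.
  have hyx : ∀ s, y s ≤ x s := fun s =>
    σ.hitProb_le R (g := fun z => x z.1) (fun z => (h z.1).1)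
      (fun z hz => (((h z.1).2.resolve_right fun h' => h'.1 hz).2).ge)
      (fun z hz => by rw [hstep]; exact ((hα z.1 hz).1).ge) (s, q₀)
  refine ⟨σ, ?_⟩
  rw [σ.reachProb_eq]
  simp only [σ, avg_pure]
  refine (hyx s₀).antisymm ?_
  by_contra! hlt
  have : Nonempty S := ⟨s₀⟩
  obtain ⟨m, hm⟩ := Finite.exists_max fun s => x s - y s
  have hpos : 0 < x m - y m := (sub_pos.2 hlt).trans_le (hm s₀)
  -- Among the states where `x - y` is maximal, take one of least rank. There `x` is positive since
  -- `y ≥ 0`, so the certificate provides a successor of lower rank.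
  obtain ⟨s, hs, hmin⟩ := Set.exists_min_image {s | x s - y s = x m - y m} r (Set.toFinite _)
    ⟨m, rfl⟩
  replace hs : x s - y s = x m - y m := hs
  have hsR : ¬ R.Holds (M.label s) := by
    intro hR
    have h₁ := ((h s).2.resolve_right fun h' => h'.1 hR).2
    have h₂ : y s = 1 := σ.hitProb_of_holds R hR
    linarith
  obtain ⟨h₁, h₂⟩ := hα s hsR
  have hys : 0 ≤ y s := σ.hitProb_nonneg R _
  obtain ⟨s', hs', hr⟩ := h₂.resolve_left (not_not.2 (by linarith))
  have ht : 0 < (M.trans s (α s) s').toReal :=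
    pos_of_mul_pos_left hs' (h s').1
  -- Off the target both `x` and `y` are averages over successors, hence so is `x - y`, and its
  -- maximality at `s` passes to every successor of positive probability.
  have heq := eq_of_le_avg (M.trans s (α s)) hm
    (by rw [avg_sub, ← h₁, ← hy s hsR, hs]) ht
  exact absurd (hmin s' heq) (not_le.2 hr)

/-! ### Least dominating functions. -/

variable (M R)

/-- Non-negative, at least one on the target, and decreasing under `B` elsewhere. -/
structure Dominates (B : (S → ℝ) → S → ℝ) (g : S → ℝ) : Prop where
  nonneg : ∀ s, 0 ≤ g s
  one_le : ∀ s, R.Holds (M.label s) → 1 ≤ g s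
  le : ∀ s, ¬ R.Holds (M.label s) → B g s ≤ g s

variable {M R}

/-- The least function that dominates a monotone operator is a fixed point. -/
theorem exists_least_dominates {S A P : Type} {M : MDP S A P} {R : BoolComb P}
    {B : (S → ℝ) → S → ℝ} (hB : Monotone B) (hB₁ : ∀ s, B 1 s ≤ 1) (hB₀ : ∀ g, 0 ≤ g → 0 ≤ B g) :
    ∃ x, Dominates M R B x ∧ (∀ g, Dominates M R B g → x ≤ g) ∧
      (∀ s, R.Holds (M.label s) → x s = 1) ∧ ∀ s, ¬ R.Holds (M.label s) → x s = B x s := by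
  classical
  let F : Type := {g // Dominates M R B g}
  -- The constant 1 dominates, so the pointwise infimum runs over a non-empty family.
  have : Nonempty F := ⟨1, fun _ => zero_le_one, fun _ _ => le_rfl, fun s _ => hB₁ s⟩
  let x : S → ℝ := fun s => ⨅ g : F, g.1 s
  have hle : ∀ g, Dominates M R B g → x ≤ g := fun g hg s =>
    ciInf_le (f := fun g : F => g.1 s) ⟨0, by rintro _ ⟨g, rfl⟩; exact g.2.nonneg s⟩ ⟨g, hg⟩
  have hx : Dominates M R B x :=
    ⟨fun s => le_ciInf fun g => g.2.nonneg s, fun s hs => le_ciInf fun g => g.2.one_le s hs,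
      fun s hs => le_ciInf fun g => (hB (hle g.1 g.2) s).trans (g.2.le s hs)⟩
  have hupd : ∀ s c, c ≤ x s → Function.update x s c ≤ x := fun s c hc t => by
    by_cases h : t = s
    · subst h; simpa using hc
    · simp [Function.update_of_ne h]
  -- The remaining inequalities say that the constraints on `x` are tight. Lowering `x` at one state
  -- to the value demanded there keeps domination, by monotonicity of `B`, so minimality of `x`
  -- applies.
  refine ⟨x, hx, hle, fun s hs => le_antisymm ?_ (hx.one_le s hs),
    fun s hs => le_antisymm ?_ (hx.le s hs)⟩
  · have h : Dominates M R B (Function.update x s 1) := by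
      have hu := hupd s 1 (hx.one_le s hs)
      refine ⟨fun t => ?_, fun t ht => ?_, fun t ht => ?_⟩ <;> by_cases hts : t = s
      · subst hts; simp
      · rw [Function.update_of_ne hts]; exact hx.nonneg t
      · subst hts; simp
      · rw [Function.update_of_ne hts]; exact hx.one_le t ht
      · subst hts; exact absurd hs ht
      · rw [Function.update_of_ne hts]; exact (hB hu t).trans (hx.le t ht)
    simpa using hle _ h s
  · have h : Dominates M R B (Function.update x s (B x s)) := by
      have hu := hupd s (B x s) (hx.le s hs)
      refine ⟨fun t => ?_, fun t ht => ?_, fun t ht => ?_⟩ <;> by_cases hts : t = s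
      · subst hts; simpa using hB₀ x hx.nonneg t
      · rw [Function.update_of_ne hts]; exact hx.nonneg t
      · subst hts; exact absurd ht hs
      · rw [Function.update_of_ne hts]; exact hx.one_le t ht
      · subst hts; rw [Function.update_self]; exact hB hu t
      · rw [Function.update_of_ne hts]; exact (hB hu t).trans (hx.le t ht)
    simpa using hle _ h s

/-! ### Ranks from paths along value-attaining actions. -/

variable (M R)

/-- The target can be reached from a state in `n` steps by actions that attain the value `x`. -/
inductive Reaches (x : S → ℝ) : ℕ → S → Prop
  | zero {s : S} : R.Holds (M.label s) → Reaches x 0 s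
  | succ {n : ℕ} {s s' : S} (a : M.legal s) : x s = avg (M.trans s a) x →
      0 < (M.trans s a s').toReal → Reaches x n s' → Reaches x (n + 1) s

variable {M R}

/-- Positivity travels backwards along the path: an attaining action gives positive weight to a
state of positive value. -/
theorem Reaches.pos {x : S → ℝ} (h₀ : ∀ s, 0 ≤ x s) (h₁ : ∀ s, R.Holds (M.label s) → x s = 1)
    {n : ℕ} {s : S} (h : Reaches M R x n s) : 0 < x s := by
  induction h with
  | zero h => rw [h₁ _ h]; exact one_pos
  | @succ n s s' a h ht _ ih =>
    rw [h]
    exact (mul_pos ht ih).trans_le (Finset.single_le_sum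
      (f := fun t => (M.trans s a t).toReal * x t)
      (fun t _ => mul_nonneg ENNReal.toReal_nonneg (h₀ t)) (Finset.mem_univ s'))

/-- The rank is the length of a shortest path; the first action of such a path leads to a state with
a shorter one. -/
theorem exists_isCert {x : S → ℝ} (h₀ : ∀ s, 0 ≤ x s) (h₁ : ∀ s, R.Holds (M.label s) → x s = 1)
    (h₂ : ∀ s, ¬ R.Holds (M.label s) → ∃ a : M.legal s, x s = avg (M.trans s a) x)
    (h₃ : ∀ s, 0 < x s → ∃ n, Reaches M R x n s) : ∃ r, IsCert M R x r := by
  -- States without a path get the default rank 0. By `h₃` their value is not positive, so nothing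
  -- is required of their rank.
  refine ⟨fun s => (sInf {n | Reaches M R x n s} : ℕ), fun s => ⟨h₀ s, ?_⟩⟩
  by_cases hs : R.Holds (M.label s)
  · exact Or.inl ⟨hs, h₁ s hs⟩
  refine Or.inr ⟨hs, ?_⟩
  by_cases hx : 0 < x s
  · have hn : Reaches M R x (sInf {n | Reaches M R x n s}) s := Nat.sInf_mem (h₃ s hx)
    generalize hk : sInf {n | Reaches M R x n s} = k at hn
    cases hn with
    | zero h => exact absurd h hs
    | @succ n _ s' a h ht h' =>
      refine ⟨a, h, Or.inr ⟨s', mul_pos ht (h'.pos h₀ h₁), ?_⟩⟩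
      have : sInf {n | Reaches M R x n s'} ≤ n := Nat.sInf_le h'
      simp only [hk]
      exact_mod_cast Nat.lt_succ_of_le this
  · obtain ⟨a, ha⟩ := h₂ s hs
    exact ⟨a, ha, Or.inl hx⟩

/-- An attaining action in a state without a path leads only to states without a path. Scaling `x`
on all those states therefore scales the average exactly; this is used with `c = 1 - ε` and `c = 0`.
-/
theorem avg_eq_of_not_reaches {x y : S → ℝ} {c : ℝ} {s : S} (hs : ¬ ∃ n, Reaches M R x n s)
    {a : M.legal s} (ha : x s = avg (M.trans s a) x)
    (hy : ∀ s', (¬ ∃ n, Reaches M R x n s') → y s' = c * x s') :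
    avg (M.trans s a) y = c * x s := by
  rw [ha, ← avg_const_mul]
  refine Finset.sum_congr rfl fun s' _ => ?_
  rcases (ENNReal.toReal_nonneg (a := M.trans s a s')).eq_or_lt with h | h
  · rw [← h, zero_mul, zero_mul]
  · rw [hy s' fun ⟨n, hn⟩ => hs ⟨n + 1, .succ a ha h hn⟩]

/-! ### Bellman operators and certificates for optimal values. -/

variable (M)

instance (s : S) : Nonempty (M.legal s) := (M.legal_nonempty s).to_subtype

/-- The largest expected value of `g` after one step. -/
noncomputable def maxStep (g : S → ℝ) (s : S) : ℝ := ⨆ a : M.legal s, avg (M.trans s a) g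

/-- The least expected value of `g` after one step. -/
noncomputable def minStep (g : S → ℝ) (s : S) : ℝ := ⨅ a : M.legal s, avg (M.trans s a) g

variable {M}

theorem exists_maxStep_eq (g : S → ℝ) (s : S) : ∃ a, maxStep M g s = avg (M.trans s a) g :=
  (exists_eq_ciSup_of_finite (f := fun a : M.legal s => avg (M.trans s a) g)).imp fun _ h => h.symm

theorem exists_minStep_eq (g : S → ℝ) (s : S) : ∃ a, minStep M g s = avg (M.trans s a) g :=
  (exists_eq_ciInf_of_finite (f := fun a : M.legal s => avg (M.trans s a) g)).imp fun _ h => h.symm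

theorem le_maxStep (g : S → ℝ) {s : S} (a : M.legal s) : avg (M.trans s a) g ≤ maxStep M g s :=
  le_ciSup (f := fun a : M.legal s => avg (M.trans s a) g) (Set.finite_range _).bddAbove a

theorem minStep_le (g : S → ℝ) {s : S} (a : M.legal s) : minStep M g s ≤ avg (M.trans s a) g :=
  ciInf_le (f := fun a : M.legal s => avg (M.trans s a) g) (Set.finite_range _).bddBelow a

theorem monotone_maxStep : Monotone (maxStep M) := fun g g' h s => by
  obtain ⟨a, ha⟩ := exists_maxStep_eq (M := M) g s
  rw [ha]
  exact (avg_mono _ h).trans (le_maxStep g' a)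

theorem monotone_minStep : Monotone (minStep M) := fun g g' h s => by
  obtain ⟨a, ha⟩ := exists_minStep_eq (M := M) g' s
  rw [ha]
  exact (minStep_le g a).trans (avg_mono _ h)

/-- An arbitrary maximising choice may cycle without progress, so it has to be shown that states of
positive value have a path along maximising actions. Otherwise `x` could be shrunk by a factor `1 -
ε` on the states without a path and still dominate, against minimality. -/
theorem exists_isCert_max (M : MDP S A P) (R : BoolComb P) :
    ∃ x r, IsCert M R x r ∧ Dominates M R (maxStep M) x := by
  obtain ⟨x, hx, hleast, h₁, h₂⟩ := exists_least_dominates (M := M) (R := R) monotone_maxStep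
    (fun s => by
      obtain ⟨a, ha⟩ := exists_maxStep_eq (M := M) 1 s
      exact (ha.trans (avg_const _ 1)).le)
    (fun g hg s => by
      obtain ⟨a, ha⟩ := exists_maxStep_eq (M := M) g s
      exact (avg_nonneg _ hg).trans_eq ha.symm)
  obtain ⟨r, hr⟩ := exists_isCert (M := M) (R := R) hx.nonneg h₁
    (fun s hs => by
      obtain ⟨a, ha⟩ := exists_maxStep_eq (M := M) x s
      exact ⟨a, (h₂ s hs).trans ha⟩)
    (by
      classical
      -- Actions that do not attain the value have strict slack; there are finitely many, so one
      -- small `ε > 0` fits into all the gaps.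
      have hev : ∀ᶠ ε : ℝ in 𝓝[>] 0, ε < 1 ∧ ∀ (s : S) (a : M.legal s),
          avg (M.trans s a) x < x s → avg (M.trans s a) x ≤ (1 - ε) * x s := by
        refine (eventually_nhdsWithin_of_eventually_nhds (eventually_lt_nhds one_pos)).and
          (eventually_all.2 fun s => eventually_all.2 fun a => ?_)
        by_cases h : avg (M.trans s a) x < x s
        · have hc : Tendsto (fun ε : ℝ => (1 - ε) * x s) (𝓝 0) (𝓝 (x s)) := by
            have : Continuous fun ε : ℝ => (1 - ε) * x s := by fun_prop
            simpa using this.tendsto 0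
          exact eventually_nhdsWithin_of_eventually_nhds
            ((hc.eventually (lt_mem_nhds h)).mono fun ε hε _ => hε.le)
        · exact Eventually.of_forall fun ε h' => absurd h' h
      obtain ⟨ε, ⟨hε₁, hε⟩, hε₀⟩ := (hev.and self_mem_nhdsWithin).exists
      replace hε₀ : 0 < ε := hε₀
      let y : S → ℝ := fun s => if ∃ n, Reaches M R x n s then x s else (1 - ε) * x s
      have hyx : y ≤ x := fun s => by
        by_cases h : ∃ n, Reaches M R x n s
        · simp only [y, if_pos h, le_refl]
        · simp only [y, if_neg h]
          nlinarith [hx.nonneg s]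
      have hy : Dominates M R (maxStep M) y := by
        refine ⟨fun s => ?_, fun s hs => ?_, fun s hs => ?_⟩
        · by_cases h : ∃ n, Reaches M R x n s
          · simp only [y, if_pos h, hx.nonneg s]
          · simp only [y, if_neg h]
            exact mul_nonneg (by linarith) (hx.nonneg s)
        · simp only [y, if_pos (⟨0, .zero hs⟩ : ∃ n, Reaches M R x n s)]
          exact hx.one_le s hs
        · by_cases h : ∃ n, Reaches M R x n s
          · simp only [y, if_pos h]
            exact (monotone_maxStep hyx s).trans (hx.le s hs)
          · obtain ⟨a, ha⟩ := exists_maxStep_eq (M := M) y s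
            have hys : y s = (1 - ε) * x s := by simp only [y, if_neg h]
            rw [ha, hys]
            -- If `a` attains the value of `x`, the average scales exactly by `1 - ε`; otherwise the
            -- slack absorbs the factor.
            rcases ((le_maxStep x a).trans (hx.le s hs)).eq_or_lt with h' | h'
            · exact (avg_eq_of_not_reaches h h'.symm fun s' hs' => by
                simp only [y, if_neg hs']).le
            · exact (avg_mono _ hyx).trans (hε s a h')
      intro s hs
      by_contra h
      have hys : y s = (1 - ε) * x s := by simp only [y, if_neg h]
      have := hleast y hy s
      nlinarith)
  exact ⟨x, r, hr, hx⟩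

/-- For the minimum no slack is needed: after setting `x` to 0 on the states without a path, a
single minimising action, which stays among those states, already bounds the least average by 0. -/
theorem exists_isCert_min (M : MDP S A P) (R : BoolComb P) :
    ∃ x r, IsCert M R x r ∧ ∀ g, Dominates M R (minStep M) g → x ≤ g := by
  obtain ⟨x, hx, hleast, h₁, h₂⟩ := exists_least_dominates (M := M) (R := R) monotone_minStep
    (fun s => by
      obtain ⟨a, ha⟩ := exists_minStep_eq (M := M) 1 s
      exact (ha.trans (avg_const _ 1)).le)
    (fun g hg s => by
      obtain ⟨a, ha⟩ := exists_minStep_eq (M := M) g s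
      exact (avg_nonneg _ hg).trans_eq ha.symm)
  have h₃ : ∀ s, ¬ R.Holds (M.label s) → ∃ a : M.legal s, x s = avg (M.trans s a) x :=
    fun s hs => by
      obtain ⟨a, ha⟩ := exists_minStep_eq (M := M) x s
      exact ⟨a, (h₂ s hs).trans ha⟩
  obtain ⟨r, hr⟩ := exists_isCert (M := M) (R := R) hx.nonneg h₁ h₃
    (by
      classical
      let y : S → ℝ := fun s => if ∃ n, Reaches M R x n s then x s else 0
      have hyx : y ≤ x := fun s => by
        by_cases h : ∃ n, Reaches M R x n s
        · simp only [y, if_pos h, le_refl]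
        · simp only [y, if_neg h, hx.nonneg s]
      have hy : Dominates M R (minStep M) y := by
        refine ⟨fun s => ?_, fun s hs => ?_, fun s hs => ?_⟩
        · by_cases h : ∃ n, Reaches M R x n s
          · simp only [y, if_pos h, hx.nonneg s]
          · simp only [y, if_neg h, le_refl]
        · simp only [y, if_pos (⟨0, .zero hs⟩ : ∃ n, Reaches M R x n s)]
          exact hx.one_le s hs
        · by_cases h : ∃ n, Reaches M R x n s
          · simp only [y, if_pos h]
            exact (monotone_minStep hyx s).trans (hx.le s hs)
          · obtain ⟨a, ha⟩ := h₃ s hs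
            have hys : y s = 0 * x s := by simp only [y, if_neg h, zero_mul]
            rw [hys]
            exact (minStep_le y a).trans_eq (avg_eq_of_not_reaches h ha fun s' hs' => by
              simp only [y, if_neg hs', zero_mul])
      intro s hs
      by_contra h
      have hys : y s = 0 := by simp only [y, if_neg h]
      exact absurd ((hleast y hy s).trans_eq hys) (not_le.2 hs))
  exact ⟨x, r, hr, hleast⟩

/-! ### Arbitrary strategies lie between the optimal values. -/

variable [MeasurableSpace S] [MeasurableSingletonClass S] {b : ℕ}

/-- Read as a function of state and mode that ignores the mode, `x` decreases on average under every
randomised choice, since a mean over actions is at most the maximum. -/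
theorem Dominates.reachProb_le {x : S → ℝ} (hx : Dominates M R (maxStep M) x)
    (σ : Scheduler M b) (s₀ : S) : σ.reachProb s₀ R ≤ x s₀ := by
  rw [σ.reachProb_eq, ← avg_const (σ.start s₀) (x s₀)]
  refine avg_mono _ fun q => ?_
  refine σ.hitProb_le R (g := fun z => x z.1) (fun z => hx.nonneg _) (fun z hz => hx.one_le _ hz)
    (fun z hz => ?_) (s₀, q)
  rw [σ.avg_step, ← avg_const (σ.act z.2 z.1) (x z.1)]
  refine avg_mono _ fun a => ?_
  simp only [avg_const]
  exact (le_maxStep x a).trans (hx.le _ hz)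

/-- Memory is eliminated by taking the worst mode in each state: the minimum over modes of the
hitting probability dominates `minStep`. -/
theorem exists_dominates_le_reachProb (hb : 0 < b) (σ : Scheduler M b) (s₀ : S) :
    ∃ g, Dominates M R (minStep M) g ∧ g s₀ ≤ σ.reachProb s₀ R := by
  have : Nonempty (Fin b) := ⟨⟨0, hb⟩⟩
  let g : S → ℝ := fun s => ⨅ q, σ.hitProb R (s, q)
  have hg : ∀ s q, g s ≤ σ.hitProb R (s, q) := fun s q =>
    ciInf_le (f := fun q => σ.hitProb R (s, q)) (Set.finite_range _).bddBelow q
  refine ⟨g, ⟨fun s => le_ciInf fun q => σ.hitProb_nonneg R _,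
    fun s hs => le_ciInf fun q => (σ.hitProb_of_holds R (x := (s, q)) hs).ge, fun s hs => ?_⟩, ?_⟩
  · refine le_ciInf fun q => ?_
    rw [σ.hitProb_of_not R (x := (s, q)) hs, σ.avg_step, ← avg_const (σ.act q s) (minStep M g s)]
    refine avg_mono _ fun a => (minStep_le g a).trans (avg_mono _ fun s' => ?_)
    rw [← avg_const (σ.update q s) (g s')]
    exact avg_mono _ fun q' => hg s' q'
  · rw [σ.reachProb_eq, ← avg_const (σ.start s₀) (g s₀)]
    exact avg_mono _ fun q => hg s₀ q

/-- A violated upper bound is also violated by the maximal value, and a violated lower bound by the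
minimal one. The right-hand side does not mention `b`. -/
theorem exists_scheduler_iff_exists_isCert (hb : 0 < b) (s₀ : S) (c : Cmp) (d : ℝ) :
    (∃ σ : Scheduler M b, ¬ c.Holds (σ.reachProb s₀ R) d) ↔
      ∃ x r, IsCert M R x r ∧ ¬ c.Holds (x s₀) d := by
  constructor
  · rintro ⟨σ, hσ⟩
    obtain ⟨x, r, hx, hmax⟩ := exists_isCert_max M R
    obtain ⟨y, r', hy, hmin⟩ := exists_isCert_min M R
    obtain ⟨g, hg, hgσ⟩ := exists_dominates_le_reachProb (R := R) hb σ s₀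
    have h₁ := hmax.reachProb_le σ s₀
    have h₂ := (hmin g hg s₀).trans hgσ
    cases c <;> simp only [Cmp.Holds, not_lt, not_le, gt_iff_lt, ge_iff_le] at hσ ⊢
    · exact ⟨x, r, hx, hσ.trans h₁⟩
    · exact ⟨y, r', hy, h₂.trans hσ⟩
    · exact ⟨x, r, hx, hσ.trans_le h₁⟩
    · exact ⟨y, r', hy, h₂.trans_lt hσ⟩
  · rintro ⟨x, r, hx, h⟩
    obtain ⟨σ, hσ⟩ := hx.exists_scheduler hb s₀
    exact ⟨σ, hσ ▸ h⟩

end Certificate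

end PReach

/-! ### Correctness of the formula -/

namespace PReach

open MvPolynomial (aeval)
open Computability

section Evaluation

variable {V W : Type} (v : V → ℝ)

theorem aeval_const (q : ℚ) : aeval v (PolyExpr.const q : PolyExpr V).toPoly = (q : ℝ) := by
  simp [PolyExpr.toPoly]

theorem aeval_var (x : V) : aeval v (PolyExpr.var x).toPoly = v x := by
  simp [PolyExpr.toPoly]

theorem aeval_mul (e e' : PolyExpr V) :
    aeval v (PolyExpr.mul e e').toPoly = aeval v e.toPoly * aeval v e'.toPoly := by
  simp [PolyExpr.toPoly]

theorem aeval_sub (e e' : PolyExpr V) :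
    aeval v (e.sub e').toPoly = aeval v e.toPoly - aeval v e'.toPoly := by
  simp [PolyExpr.sub, PolyExpr.toPoly, sub_eq_add_neg]

theorem aeval_sum_ofFn {n : ℕ} (f : Fin n → PolyExpr V) :
    aeval v (PolyExpr.sum (List.ofFn f)).toPoly = ∑ i, aeval v (f i).toPoly := by
  induction n with
  | zero => simp [PolyExpr.sum, PolyExpr.toPoly]
  | succ n ih =>
    rw [List.ofFn_succ, Fin.sum_univ_succ, ← ih]
    simp [PolyExpr.sum, PolyExpr.toPoly]

theorem aeval_rename (f : W → V) (e : PolyExpr W) :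
    aeval v (e.rename f).toPoly = aeval (v ∘ f) e.toPoly := by
  induction e <;> simp_all [PolyExpr.rename, PolyExpr.toPoly]

end Evaluation

namespace RFormula

variable (v : ℕ → ℝ)

theorem holds_ge (e e' : PolyExpr ℕ) :
    (RFormula.ge e e').Holds v ↔ aeval v e'.toPoly ≤ aeval v e.toPoly := by
  simp [RFormula.ge, RFormula.Holds, aeval_sub]

theorem holds_gt (e e' : PolyExpr ℕ) :
    (RFormula.gt e e').Holds v ↔ aeval v e'.toPoly < aeval v e.toPoly := by
  simp [RFormula.gt, RFormula.Holds, aeval_sub]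

theorem holds_eq (e e' : PolyExpr ℕ) :
    (RFormula.eq e e').Holds v ↔ aeval v e.toPoly = aeval v e'.toPoly := by
  simp only [RFormula.eq, RFormula.Holds, holds_ge]
  exact ⟨fun h => le_antisymm h.2 h.1, fun h => ⟨h.ge, h.le⟩⟩

theorem holds_disj_ofFn {n : ℕ} (f : Fin n → RFormula) :
    (RFormula.disj (List.ofFn f)).Holds v ↔ ∃ i, (f i).Holds v := by
  induction n with
  | zero => simp [RFormula.disj, RFormula.Holds, aeval_const]
  | succ n ih =>
    rw [Fin.exists_fin_succ, ← ih, List.ofFn_succ]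
    rfl

theorem holds_conj (l : List RFormula) (φ : RFormula) :
    (RFormula.conj l φ).Holds v ↔ (∀ ψ ∈ l, ψ.Holds v) ∧ φ.Holds v := by
  induction l with
  | nil => simp [RFormula.conj]
  | cons ψ l ih =>
    rw [List.forall_mem_cons, and_assoc, ← ih]
    rfl

end RFormula

theorem forall_mem_flatten_ofFn {α : Type} {n : ℕ} (f : Fin n → List α) (Q : α → Prop) :
    (∀ y ∈ (List.ofFn f).flatten, Q y) ↔ ∀ i, ∀ y ∈ f i, Q y := by
  simp only [List.mem_flatten, List.mem_ofFn]
  exact ⟨fun h i y hy => h y ⟨_, ⟨i, rfl⟩, hy⟩, by rintro h y ⟨_, ⟨i, rfl⟩, hy⟩; exact h i y hy⟩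

/-- The variables of the formula for an instance with `n` states, `m` actions, `p` parameters and
`k` propositions. -/
inductive Var (n m p k : ℕ) : Type
  | param (j : Fin p)
  | value (s : Fin n)
  | rank (s : Fin n)
  | legal (s : Fin n) (a : Fin m)
  | trans (s : Fin n) (a : Fin m) (s' : Fin n)
  | label (s : Fin n) (q : Fin k)

namespace Var

variable {n m p k : ℕ}

/-- The index of a variable. -/
def index : Var n m p k → ℕ
  | .param j => j
  | .value s => varIndex p 0 s []
  | .rank s => varIndex p 1 s []
  | .legal s a => varIndex p 2 s (block a [])
  | .trans s a s' => varIndex p 3 s (block a (block s' []))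
  | .label s q => varIndex p 4 s (encodeNat q)

/-- Parameters lie below `p` and all other indices above; the latter are told apart by the tag block
and then by their self-delimiting arguments. -/
theorem index_injective : Function.Injective (index (n := n) (m := m) (p := p) (k := k)) := by
  have hn := canonical_nil
  have hlt : ∀ (j : Fin p) (tag s : ℕ) {l : List Bool}, Canonical l →
      (j : ℕ) ≠ varIndex p tag s l :=
    fun j tag s l hl => (j.2.trans (lt_varIndex p tag s hl)).ne
  have hparam : ∀ (j : Fin p) (y : Var n m p k), (j : ℕ) = index y → y = .param j := by
    intro j y h
    cases y with
    | param j' => rw [Fin.ext h]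
    | value s => exact absurd h (hlt _ _ _ hn)
    | rank s => exact absurd h (hlt _ _ _ hn)
    | legal s a => exact absurd h (hlt _ _ _ (hn.block a))
    | trans s a s' => exact absurd h (hlt _ _ _ ((hn.block s').block a))
    | label s q => exact absurd h (hlt _ _ _ (canonical_encodeNat q))
  intro y y' h
  cases y with
  | param j => exact (hparam j y' h).symm
  | value s =>
    cases y' with
    | param j => exact hparam j (.value s) h.symm
    | value t => rw [Fin.ext (varIndex_inj hn hn h).2.1]
    | rank t => exact absurd (varIndex_inj hn hn h).1 (by decide)
    | legal t a => exact absurd (varIndex_inj hn (hn.block a) h).1 (by decide)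
    | trans t a t' => exact absurd (varIndex_inj hn ((hn.block t').block a) h).1 (by decide)
    | label t q => exact absurd (varIndex_inj hn (canonical_encodeNat q) h).1 (by decide)
  | rank s =>
    cases y' with
    | param j => exact hparam j (.rank s) h.symm
    | value t => exact absurd (varIndex_inj hn hn h).1 (by decide)
    | rank t => rw [Fin.ext (varIndex_inj hn hn h).2.1]
    | legal t a => exact absurd (varIndex_inj hn (hn.block a) h).1 (by decide)
    | trans t a t' => exact absurd (varIndex_inj hn ((hn.block t').block a) h).1 (by decide)
    | label t q => exact absurd (varIndex_inj hn (canonical_encodeNat q) h).1 (by decide)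
  | legal s a =>
    have hl := hn.block a
    cases y' with
    | param j => exact hparam j (.legal s a) h.symm
    | value t => exact absurd (varIndex_inj hl hn h).1 (by decide)
    | rank t => exact absurd (varIndex_inj hl hn h).1 (by decide)
    | legal t a' =>
      obtain ⟨_, h₁, h₂⟩ := varIndex_inj hl (hn.block a') h
      rw [Fin.ext h₁, Fin.ext (block_inj h₂).1]
    | trans t a t' => exact absurd (varIndex_inj hl ((hn.block t').block a) h).1 (by decide)
    | label t q => exact absurd (varIndex_inj hl (canonical_encodeNat q) h).1 (by decide)
  | trans s a s' =>
    have hl := (hn.block s').block a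
    cases y' with
    | param j => exact hparam j (.trans s a s') h.symm
    | value t => exact absurd (varIndex_inj hl hn h).1 (by decide)
    | rank t => exact absurd (varIndex_inj hl hn h).1 (by decide)
    | legal t a' => exact absurd (varIndex_inj hl (hn.block a') h).1 (by decide)
    | trans t a' t' =>
      obtain ⟨_, h₁, h₂⟩ := varIndex_inj hl ((hn.block t').block a') h
      obtain ⟨h₃, h₄⟩ := block_inj h₂
      rw [Fin.ext h₁, Fin.ext h₃, Fin.ext (block_inj h₄).1]
    | label t q => exact absurd (varIndex_inj hl (canonical_encodeNat q) h).1 (by decide)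
  | label s q =>
    have hl := canonical_encodeNat q
    cases y' with
    | param j => exact hparam j (.label s q) h.symm
    | value t => exact absurd (varIndex_inj hl hn h).1 (by decide)
    | rank t => exact absurd (varIndex_inj hl hn h).1 (by decide)
    | legal t a => exact absurd (varIndex_inj hl (hn.block a) h).1 (by decide)
    | trans t a t' => exact absurd (varIndex_inj hl ((hn.block t').block a) h).1 (by decide)
    | label t q' =>
      obtain ⟨_, h₁, h₂⟩ := varIndex_inj hl (canonical_encodeNat q') h
      rw [Fin.ext h₁, Fin.ext (encodingNatBool.encode_injective h₂)]

end Var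

namespace Instance

variable (I : Instance)

/-- The conditions that the formula of an instance negates. -/
structure Model (u : Var I.numStates I.numActions I.numParams I.numProps → ℝ) : Prop where
  row_some : ∀ s a f, I.trans s a = some f → 0 < u (.legal s a) ∧
    (∀ s', u (.trans s a s') = aeval (fun j => u (.param j)) (f s').toPoly ∧
      0 ≤ u (.trans s a s')) ∧ ∑ s', u (.trans s a s') = 1
  row_none : ∀ s a, I.trans s a = none → ¬ 0 < u (.legal s a)
  label : ∀ s q, 0 < u (.label s q) ↔ I.label s q = true
  constraints : ∀ c ∈ I.constraints, c.rel.Holds (aeval (fun j => u (.param j)) c.lhs.toPoly)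
    (aeval (fun j => u (.param j)) c.rhs.toPoly)
  value : ∀ s, 0 ≤ u (.value s) ∧
    ((I.target.Holds {q | 0 < u (.label s q)} ∧ u (.value s) = 1) ∨
      (¬ I.target.Holds {q | 0 < u (.label s q)} ∧ ∃ a, 0 < u (.legal s a) ∧
        u (.value s) = ∑ s', u (.trans s a s') * u (.value s') ∧
        (¬ 0 < u (.value s) ∨
          ∃ s', 0 < u (.trans s a s') * u (.value s') ∧ u (.rank s') < u (.rank s))))
  threshold : ¬ I.cmp.Holds (u (.value I.init)) I.threshold

/-! ### Meaning of the parts of the formula. -/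

theorem holds_targetFormula {p k : ℕ} (v : ℕ → ℝ) (s : ℕ) (R : BoolComb (Fin k)) :
    (targetFormula p s R).Holds v ↔
      R.Holds {q : Fin k | 0 < v (varIndex p 4 s (encodeNat q))} := by
  induction R with
  | atom q => simp [targetFormula, RFormula.Holds, BoolComb.Holds, labelVar, aeval_var]
  | neg φ ih => simp only [targetFormula, RFormula.Holds, BoolComb.Holds, ih]
  | and φ ψ ih ih' => simp only [targetFormula, RFormula.Holds, BoolComb.Holds, ih, ih']
  | or φ ψ ih ih' => simp only [targetFormula, RFormula.Holds, BoolComb.Holds, ih, ih']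

theorem holds_constraintFormula {p : ℕ} (v : ℕ → ℝ) (c : Constraint (PolyExpr (Fin p))) :
    (constraintFormula c).Holds v ↔ c.rel.Holds (aeval (fun j : Fin p => v j) c.lhs.toPoly)
      (aeval (fun j : Fin p => v j) c.rhs.toPoly) := by
  obtain ⟨l, (_ | _ | _ | _) | _, r⟩ := c <;>
    simp only [constraintFormula, RFormula.holds_gt, RFormula.holds_ge, RFormula.holds_eq,
      aeval_rename] <;> rfl

theorem holds_thresholdFormula (p s : ℕ) (d : ℚ) (c : Cmp) (v : ℕ → ℝ) :
    (thresholdFormula p s d c).Holds v ↔ ¬ c.Holds (v (varIndex p 0 s [])) d := by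
  cases c <;> simp [thresholdFormula, RFormula.holds_gt, RFormula.holds_ge, xVar, aeval_var,
    aeval_const, Cmp.Holds]

theorem holds_valueFormula {k : ℕ} (n m p s : ℕ) (R : BoolComb (Fin k)) (v : ℕ → ℝ) :
    (valueFormula n m p s R).Holds v ↔
      (R.Holds {q : Fin k | 0 < v (varIndex p 4 s (encodeNat q))} ∧ v (varIndex p 0 s []) = 1) ∨
      (¬ R.Holds {q : Fin k | 0 < v (varIndex p 4 s (encodeNat q))} ∧
        ∃ a : Fin m, 0 < v (varIndex p 2 s (block a [])) ∧
        v (varIndex p 0 s []) = ∑ s' : Fin n,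
          v (varIndex p 3 s (block a (block s' []))) * v (varIndex p 0 s' []) ∧
        (¬ 0 < v (varIndex p 0 s []) ∨
          ∃ s' : Fin n, 0 < v (varIndex p 3 s (block a (block s' []))) * v (varIndex p 0 s' []) ∧
            v (varIndex p 1 s' []) < v (varIndex p 1 s []))) := by
  simp only [valueFormula, actionFormula, RFormula.Holds, RFormula.holds_eq, RFormula.holds_gt,
    RFormula.holds_disj_ofFn, holds_targetFormula, aeval_sum_ofFn, aeval_mul, aeval_const,
    aeval_var, xVar, rankVar, legalVar, transVar, Rat.cast_one, gt_iff_lt]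

theorem holds_rowFormulas_some {n p : ℕ} (s a : ℕ) (f : Fin n → PolyExpr (Fin p)) (v : ℕ → ℝ) :
    (∀ φ ∈ rowFormulas s a (some f), φ.Holds v) ↔ 0 < v (varIndex p 2 s (block a [])) ∧
      (∀ s' : Fin n, v (varIndex p 3 s (block a (block s' []))) =
        aeval (fun j : Fin p => v j) (f s').toPoly ∧
          0 ≤ v (varIndex p 3 s (block a (block s' [])))) ∧
      ∑ s' : Fin n, v (varIndex p 3 s (block a (block s' []))) = 1 := by
  simp only [rowFormulas, List.forall_mem_cons, List.forall_mem_append, forall_mem_flatten_ofFn,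
    List.not_mem_nil, IsEmpty.forall_iff, implies_true, and_true, RFormula.Holds,
    RFormula.holds_eq, aeval_sum_ofFn, aeval_const, aeval_var, aeval_rename, legalVar,
    transVar, Rat.cast_one, gt_iff_lt, ge_iff_le]
  rfl

theorem holds_rowFormulas_none {n p : ℕ} (s a : ℕ) (v : ℕ → ℝ) :
    (∀ φ ∈ rowFormulas (n := n) (p := p) s a none, φ.Holds v) ↔
      ¬ 0 < v (varIndex p 2 s (block a [])) := by
  simp [rowFormulas, RFormula.Holds, legalVar, aeval_var]

theorem holds_labelFormula (p s q : ℕ) (b : Bool) (v : ℕ → ℝ) :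
    (labelFormula p s q b).Holds v ↔ (0 < v (varIndex p 4 s (encodeNat q)) ↔ b = true) := by
  cases b <;> simp [labelFormula, RFormula.Holds, labelVar, aeval_var]

theorem not_holds_formula (v : ℕ → ℝ) :
    ¬ I.formula.Holds v ↔ I.Model fun y => v y.index := by
  simp only [formula, RFormula.Holds, not_not, RFormula.holds_conj, List.forall_mem_append,
    forall_mem_flatten_ofFn, List.forall_mem_map, List.forall_mem_cons, List.not_mem_nil,
    IsEmpty.forall_iff, implies_true,
    and_true, holds_labelFormula, holds_constraintFormula, holds_thresholdFormula,
    holds_valueFormula, aeval_var, xVar, ge_iff_le]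
  constructor
  · rintro ⟨⟨h₁, h₂, h₃, h₄⟩, h₅⟩
    exact ⟨fun s a f hf => (holds_rowFormulas_some s a f v).1 (hf ▸ h₁ s a),
      fun s a h => (holds_rowFormulas_none s a v).1 (h ▸ h₁ s a), h₂, h₃, h₄, h₅⟩
  · rintro ⟨h₁, h₁', h₂, h₃, h₄, h₅⟩
    refine ⟨⟨fun s a => ?_, h₂, h₃, h₄⟩, h₅⟩
    cases h : I.trans s a with
    | none => exact (holds_rowFormulas_none s a v).2 (h₁' s a h)
    | some f => exact (holds_rowFormulas_some s a f v).2 (h₁ s a f h)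

theorem not_universallyTrue_formula : ¬ I.formula.UniversallyTrue ↔ ∃ u, I.Model u := by
  rw [RFormula.UniversallyTrue, not_forall]
  simp only [not_holds_formula]
  -- Since `Var.index` is injective, an assignment to the structured variables extends to all
  -- indices; the value 0 elsewhere is immaterial.
  refine ⟨fun ⟨v, hv⟩ => ⟨_, hv⟩, fun ⟨u, hu⟩ => ⟨Function.extend Var.index u 0, ?_⟩⟩
  simpa only [Var.index_injective.extend_apply] using hu

/-! ### Models correspond to valuations with certificates. -/

theorem toReal_inst_trans {S A X P : Type} [Fintype S] (M : PMDP S A X P) (w : X → ℝ)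
    (h : M.WellDefined w) (s : S) (a : M.legal s) (s' : S) :
    ((M.inst w h).trans s a s').toReal = aeval w (M.trans s a s') :=
  ENNReal.toReal_ofReal (h.nonneg s a s')

theorem toPMDP_trans {s : Fin I.numStates} (a : I.toPMDP.legal s)
    {f : Fin I.numStates → PolyExpr (Fin I.numParams)} (hf : I.trans s a = some f)
    (s' : Fin I.numStates) : I.toPMDP.trans s a s' = (f s').toPoly := by
  have h : (I.trans s a).get (Finset.mem_filter.1 a.2).2 = f := Option.get_of_eq_some _ hf
  exact congrArg (fun g => (g s').toPoly) h

theorem exists_trans_eq {s : Fin I.numStates} (a : I.toPMDP.legal s) :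
    ∃ f, I.trans s a = some f :=
  Option.isSome_iff_exists.1 (Finset.mem_filter.1 a.2).2

theorem mem_legal_of_trans_eq {s : Fin I.numStates} {a : Fin I.numActions}
    {f : Fin I.numStates → PolyExpr (Fin I.numParams)} (hf : I.trans s a = some f) :
    a ∈ I.toPMDP.legal s :=
  Finset.mem_filter.2 ⟨Finset.mem_univ a, by simp [hf]⟩

/-- The transition variables are fixed by the parameters, and only the signs of the legality and
label variables matter, which the tables prescribe. What remains free is a valuation together with a
certificate. -/
theorem exists_model_iff : (∃ u, I.Model u) ↔
    ∃ (w : Fin I.numParams → ℝ) (h : I.toPMDP.WellDefined w) (x r : Fin I.numStates → ℝ),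
      IsCert (I.toPMDP.inst w h) I.target x r ∧ ¬ I.cmp.Holds (x I.init) I.threshold := by
  constructor
  · rintro ⟨u, hu⟩
    have htrans : ∀ s (a : I.toPMDP.legal s) s',
        aeval (fun j => u (.param j)) (I.toPMDP.trans s a s') = u (.trans s a s') := by
      intro s a s'
      obtain ⟨f, hf⟩ := I.exists_trans_eq a
      rw [I.toPMDP_trans a hf, ((hu.row_some s a f hf).2.1 s').1]
    have hw : I.toPMDP.WellDefined fun j => u (.param j) := by
      refine ⟨fun s a s' => ?_, fun s a => ?_, fun c hc => ?_⟩
      · obtain ⟨f, hf⟩ := I.exists_trans_eq a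
        rw [htrans]
        exact ((hu.row_some s a f hf).2.1 s').2
      · obtain ⟨f, hf⟩ := I.exists_trans_eq a
        simp only [htrans]
        exact (hu.row_some s a f hf).2.2
      · obtain ⟨c', hc', rfl⟩ := List.mem_map.1 hc
        exact hu.constraints c' hc'
    refine ⟨_, hw, fun s => u (.value s), fun s => u (.rank s), fun s => ?_, hu.threshold⟩
    have hlabel : {q | 0 < u (.label s q)} = I.toPMDP.label s :=
      Set.ext fun q => hu.label s q
    have hs := hu.value s
    rw [hlabel] at hs
    refine hs.imp_right (Or.imp_right (And.imp_right ?_))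
    rintro ⟨a, ha, h₁, h₂⟩
    -- Positivity of the legality variable makes the selected action legal, because illegal ones are
    -- forced to be non-positive.
    obtain ⟨f, hf⟩ := Option.ne_none_iff_exists'.1 fun h => hu.row_none s a h ha
    refine ⟨⟨a, I.mem_legal_of_trans_eq hf⟩, ?_⟩
    have ht : ∀ s', ((I.toPMDP.inst _ hw).trans s ⟨a, I.mem_legal_of_trans_eq hf⟩ s').toReal =
        u (.trans s a s') := fun s' => (toReal_inst_trans _ _ hw _ _ _).trans (htrans _ _ _)
    simp only [avg, ht]
    exact ⟨h₁, h₂⟩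
  · rintro ⟨w, h, x, r, hx, hd⟩
    let u : Var I.numStates I.numActions I.numParams I.numProps → ℝ
      | .param j => w j
      | .value s => x s
      | .rank s => r s
      | .legal s a => if (I.trans s a).isSome then 1 else 0
      | .trans s a s' => (I.trans s a).elim 0 fun f => aeval w (f s').toPoly
      | .label s q => if I.label s q then 1 else 0
    have htrans : ∀ s (a : I.toPMDP.legal s) s',
        aeval w (I.toPMDP.trans s a s') = u (.trans s a s') := by
      intro s a s'
      obtain ⟨f, hf⟩ := I.exists_trans_eq a
      rw [I.toPMDP_trans a hf]
      simp [u, hf]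
    have hlabel : ∀ s q, 0 < u (.label s q) ↔ I.label s q = true := by
      intro s q
      by_cases hq : I.label s q = true <;> simp [u, hq]
    have hsome : ∀ s a f, I.trans s a = some f → 0 < u (.legal s a) := by
      intro s a f hf
      simp [u, hf]
    refine ⟨u, fun s a f hf => ⟨hsome s a f hf, fun s' => ⟨by simp [u, hf], ?_⟩, ?_⟩,
      fun s a ha => by simp [u, ha], hlabel, fun c hc => ?_, fun s => ?_, hd⟩
    · rw [← htrans s ⟨a, I.mem_legal_of_trans_eq hf⟩ s']
      exact h.nonneg _ _ _
    · rw [← h.sum_eq_one s ⟨a, I.mem_legal_of_trans_eq hf⟩]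
      exact Finset.sum_congr rfl fun s' _ => (htrans s ⟨a, _⟩ s').symm
    · exact h.constraints _ (List.mem_map.2 ⟨c, hc, rfl⟩)
    · have hl : {q | 0 < u (.label s q)} = I.toPMDP.label s := Set.ext fun q => hlabel s q
      rw [hl]
      refine (hx s).imp_right (Or.imp_right (And.imp_right ?_))
      rintro ⟨a, h₁, h₂⟩
      obtain ⟨f, hf⟩ := I.exists_trans_eq a
      have ht : ∀ s', ((I.toPMDP.inst w h).trans s a s').toReal = u (.trans s a s') :=
        fun s' => (toReal_inst_trans _ _ h _ _ _).trans (htrans _ _ _)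
      simp only [avg, ht] at h₁ h₂
      exact ⟨a, hsome s a f hf, h₁, h₂⟩

theorem mem_universalReachability_iff :
    I ∈ universalReachability ↔ I.formula.UniversallyTrue := by
  rw [← not_iff_not, not_universallyTrue_formula, exists_model_iff]
  simp only [universalReachability, PMDP.UniversalReach, Set.mem_ofPred_eq, not_forall]
  exact exists_congr fun w => exists_congr fun h =>
    exists_scheduler_iff_exists_isCert I.bound.pos I.init I.cmp I.threshold

end Instance

end PReach

theorem mainTheorem4 :
    PReach.InForallR PReach.instanceEncoding PReach.universalReachability := by
  exact ⟨PReach.Instance.formula, PReach.computableInPolyTime_formula,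
    PReach.Instance.mem_universalReachability_iff⟩
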